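/- \textbf{Setting.} Let $\{f(\cdot;\theta):\theta\in\Theta\}$, $\Theta\subset\mathbb{R}^{p}$, $\theta=(\theta_1,\theta_2)\in\mathbb{R}^{r}\times\mathbb{R}^{q}$, $p=r+q$, be a family of positive probability densities with true parameter $\theta_0$. Write $S(\theta;y)=\partial\log f(y;\theta)/\partial\theta$, $I(\theta;y)=-\partial^2\log f(y;\theta)/\partial\theta\,\partial\theta^{T}$, and $\mathcal I(\theta)=E\{I(\theta;Y)\}$ with $Y\sim f(\cdot;\theta_0)$. Along a sequence indexed by $\nu$, finite populations $y_1,\dots,y_N$ ($N=N_\nu$) of independent draws from $f(\cdot;\theta_0)$ are generated, and a Poisson sample $A$ is drawn: unit $i$ is selected with inclusion probability $\pi_i\in(0,1]$. The $\pi_i$ may be constants or random and dependent on $y_i$ (informative sampling); the triples of $y_i$, $\pi_i$ and the selection indicator of unit $i$ are independent over $i$, and the conditional selection probability given $(y_i,\pi_i)$ is $\pi_i$. Let $n=|A|$, $w_i=\pi_i^{-1}$, $n_0=\sum_{i=1}^N E(\pi_i)$, $l_w(\theta)=N^{-1}\sum_{i\in A}w_i\log f(y_i;\theta)$, $\hat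 S_w(\theta)=N^{-1}\sum_{i\in A}w_iS(\theta;y_i)$, and let $\hat\theta=(\hat\theta_1,\hat\theta_2)$ be a maximizer of $l_w$ over $\Theta$. \textbf{Regularity conditions.} There is a compact convex set $B\subset\Theta$ with $\theta_0$ in its interior $B^\circ$ such that: (i) for every $y$, $f(y;\cdot)$ is continuous on $B$ and twice continuously differentiable on $B^\circ$; (ii) $\sup_{\theta\in B^\circ}E\|S(\theta;Y)\|^6<\infty$; (iii) for $\theta\in B^\circ$, $n_0\,\mathrm{var}\{\hat S_w(\theta)\}$ converges to a positive definite matrix $\Sigma_S(\theta)$; (iv) the entries of $I(\theta;y)$, $\theta\in B^\circ$, are bounded in absolute value by a function $H(y)$ with $E\,H(Y)<\infty$, and $\mathcal I(\theta_0)$ is nonsingular; (v) $\theta_0$ is identifiable: $f(\cdot;\theta)$ and $f(\cdot;\theta_0)$ define different distributions for $\theta\in\Theta$, $\theta\neq\theta_0$; moreover, either $\log f(y;\theta)-\log f(y;\theta_0)\le g(y)$ for all $\theta\in\Theta\setminus B$ and all $y$, with some $g$ such that $g(Y)$ is integrable and $E\,g(Y)<0$ (no restriction if $B=\Theta$), or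 $\Theta$ is convex and $\log f(y;\cdot)$ is concave on $\Theta$ for every $y$; (vi) $n_0\to\infty$, $n_0/N\to0$, and $C_1\le Nn_0^{-1}\pi_i\le C_2$ almost surely with positive constants $C_1,C_2$. \textbf{Bootstrap.} Given the sample, draw $(N_i^*)_{i\in A}$ from the multinomial distribution with $N$ trials and success probabilities proportional to $w_i$; given these, draw independent $m_i^*\sim\mathrm{Bin}(N_i^*,\pi_i)$, $i\in A$; set $w_i^*=w_im_i^*$ and $l_w^*(\theta)=N^{-1}\sum_{i\in A}w_i^*\log f(y_i;\theta)$. Let $\hat\theta^*$ be a maximizer of $l_w^*$ over $\Theta$, let $\hat\theta_1^{*(0)}$ be a maximizer of $\theta_1\mapsto l_w^*(\theta_1,\hat\theta_2)$ over $\{\theta_1:(\theta_1,\hat\theta_2)\in\Theta\}$, and put $$W^*(\hat\theta_2)=-2n\{l_w^*(\hat\theta_1^{*(0)},\hat\theta_2)-l_w^*(\hat\theta^*)\}.$$ (Where a maximizer does not exist, the corresponding estimator is arbitrary.) \textbf{Theorem.} Under these conditions let $\Sigma_\theta=\mathcal I(\theta_0)^{-1}\Sigma_S(\theta_0)\{\mathcal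 I(\theta_0)^{-1}\}^{T}$, the asymptotic variance of $\sqrt n(\hat\theta-\theta_0)$, let $\Sigma_{\theta,22}$ be its $\theta_2$-block (the limit version of $n\,\mathrm{var}(\hat\theta_2)$), and let $\mathcal I_{22\cdot1}=\mathcal I_{22}-\mathcal I_{21}\mathcal I_{11}^{-1}\mathcal I_{12}$ at $\theta_0$. The eigenvalues $c_1\ge\cdots\ge c_q$ of $\Sigma_{\theta,22}\,\mathcal I_{22\cdot1}$, counted with multiplicity, are real and positive, and the conditional distribution of $W^*(\hat\theta_2)$ given the sample converges weakly, in probability, to the distribution of $$\mathcal G_1=\sum_{i=1}^q c_iZ_i^2,\qquad Z_1,\dots,Z_q\ \text{independent standard normal}.$$ Under the null hypothesis $\theta_2=\theta_2^{(0)}$ one has $\theta_0=(\theta_1,\theta_2^{(0)})$, and $\mathcal G_1$ is the Lumley--Scott limit of the pseudo likelihood ratio statistic. -/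

import Mathlib

open MeasureTheory ProbabilityTheory Filter Topology BoundedContinuousFunction

noncomputable section

namespace SurveyBootstrap

/-! ### Parameters `θ = (θ₁, θ₂) ∈ ℝ^r × ℝ^q` -/

/-- The space `ℝ^(r+q)` of parameters, with the Euclidean norm. -/
abbrev Param (r q : ℕ) := EuclideanSpace ℝ (Fin r ⊕ Fin q)

/-- The parameter `(θ₁, θ₂)`. -/
def join {r q : ℕ} (θ₁ : Fin r → ℝ) (θ₂ : Fin q → ℝ) : Param r q :=
  WithLp.toLp 2 (Sum.elim θ₁ θ₂)

/-- The component `θ₂` of `θ = (θ₁, θ₂)`. -/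
def second {r q : ℕ} (θ : Param r q) : Fin q → ℝ := fun j => θ (Sum.inr j)

/-! ### The super-population model -/

section Model

variable {r q : ℕ} {𝓨 : Type*} [MeasurableSpace 𝓨]

/-- The distribution with density `f(·; θ)` with respect to `μ`. -/
def modelLaw (μ : Measure 𝓨) (f : 𝓨 → Param r q → ℝ) (θ : Param r q) : Measure 𝓨 :=
  μ.withDensity fun y => ENNReal.ofReal (f y θ)

/-- The score `S(θ; y) = ∂ log f(y; θ) / ∂θ`. -/
def score (f : 𝓨 → Param r q → ℝ) (θ : Param r q) (y : 𝓨) : Param r q :=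
  gradient (fun t => Real.log (f y t)) θ

/-- The matrix `I(θ; y) = - ∂² log f(y; θ) / ∂θ ∂θᵀ`. -/
def obsInfo (f : 𝓨 → Param r q → ℝ) (θ : Param r q) (y : 𝓨) :
    Matrix (Fin r ⊕ Fin q) (Fin r ⊕ Fin q) ℝ :=
  fun j k => - (fderiv ℝ (fun t => score f t y) θ (EuclideanSpace.single k 1)) j

/-- The matrix `𝓘(θ) = E{I(θ; Y)}`, where `Y` has density `f(·; θ₀)`. -/
def info (μ : Measure 𝓨) (f : 𝓨 → Param r q → ℝ) (θ₀ θ : Param r q) :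
    Matrix (Fin r ⊕ Fin q) (Fin r ⊕ Fin q) ℝ :=
  fun j k => ∫ y, obsInfo f θ y j k ∂(modelLaw μ f θ₀)

/-- `M₂₂·₁ = M₂₂ - M₂₁ M₁₁⁻¹ M₁₂`. -/
def schur (M : Matrix (Fin r ⊕ Fin q) (Fin r ⊕ Fin q) ℝ) : Matrix (Fin q) (Fin q) ℝ :=
  M.toBlocks₂₂ - M.toBlocks₂₁ * M.toBlocks₁₁⁻¹ * M.toBlocks₁₂

/-- The asymptotic covariance matrix `Σ_θ = 𝓘⁻¹ Σ_S (𝓘⁻¹)ᵀ` of the pseudo maximum likelihood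
estimator, as a function of `𝓘 = 𝓘(θ₀)` and `Σ_S = Σ_S(θ₀)`. -/
def sandwich (M VS : Matrix (Fin r ⊕ Fin q) (Fin r ⊕ Fin q) ℝ) :
    Matrix (Fin r ⊕ Fin q) (Fin r ⊕ Fin q) ℝ :=
  M⁻¹ * VS * (M⁻¹).transpose

/-- The matrix `P = Σ_{θ,22} 𝓘₂₂·₁`, where `Σ_{θ,22}` is the limit of `n var(θ̂₂)`. -/
def designEffect (M VS : Matrix (Fin r ⊕ Fin q) (Fin r ⊕ Fin q) ℝ) : Matrix (Fin q) (Fin q) ℝ :=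
  (sandwich M VS).toBlocks₂₂ * schur M

/-- The law of `∑ᵢ cᵢ Zᵢ²` with independent standard normal `Z₁, …, Z_q`. -/
def weightedChiSq (c : Fin q → ℝ) : Measure ℝ :=
  (Measure.pi fun _ : Fin q => gaussianReal 0 1).map fun z => ∑ i, c i * z i ^ 2

/-- Regularity of the parametric model with parameter space `Θ` and true parameter `θ₀`. The set
`B` is a compact convex neighbourhood of `θ₀` (for instance a closed box). -/
structure RegularModel (μ : Measure 𝓨) (f : 𝓨 → Param r q → ℝ) (Θ B : Set (Param r q))
    (θ₀ : Param r q) : Prop where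
  /-- `f(·; θ)`, `θ ∈ Θ`, are positive probability densities. -/
  density_measurable : ∀ θ ∈ Θ, Measurable fun y => f y θ
  density_pos : ∀ y, ∀ θ ∈ Θ, 0 < f y θ
  density_lintegral : ∀ θ ∈ Θ, ∫⁻ y, ENNReal.ofReal (f y θ) ∂μ = 1
  /-- The parameter is identifiable. -/
  identifiable : ∀ θ ∈ Θ, modelLaw μ f θ = modelLaw μ f θ₀ → θ = θ₀
  subset : B ⊆ Θ
  compact : IsCompact B
  convex : Convex ℝ B
  interior : θ₀ ∈ interior B
  /-- Continuous second-order derivatives with respect to `θ`. -/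
  continuousOn : ∀ y, ContinuousOn (fun θ => f y θ) B
  contDiffOn : ∀ y, ContDiffOn ℝ 2 (fun θ => f y θ) (_root_.interior B)
  /-- The sixth moment of the score is bounded. -/
  score_moment : ∃ K : ℝ, ∀ θ ∈ _root_.interior B,
    Integrable (fun y => ‖score f θ y‖ ^ 6) (modelLaw μ f θ₀) ∧
      ∫ y, ‖score f θ y‖ ^ 6 ∂(modelLaw μ f θ₀) ≤ K
  /-- The second derivatives of `log f` are dominated by an integrable function. -/
  info_dominated : ∃ H : 𝓨 → ℝ, Integrable H (modelLaw μ f θ₀) ∧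
    ∀ θ ∈ _root_.interior B, ∀ y j k, |obsInfo f θ y j k| ≤ H y
  /-- `𝓘(θ₀)` is nonsingular. -/
  info_nonsingular : IsUnit (info μ f θ₀ θ₀).det
  /-- Parameters outside `B` do not compete with `θ₀`: the log-likelihood ratio outside `B` is
  dominated by an integrable function with negative mean (nothing is assumed if `B = Θ`), or the
  log-likelihood is concave. -/
  outside : (∃ g : 𝓨 → ℝ, Integrable g (modelLaw μ f θ₀) ∧ ∫ y, g y ∂(modelLaw μ f θ₀) < 0 ∧
      ∀ θ ∈ Θ \ B, ∀ y, Real.log (f y θ) - Real.log (f y θ₀) ≤ g y) ∨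
    ∀ y, ConcaveOn ℝ Θ fun θ => Real.log (f y θ)

end Model

/-! ### Weighted log-likelihoods and maximizers -/

section Estimation

variable {r q : ℕ} {𝓨 : Type*} {N : ℕ}

/-- `N⁻¹ ∑_{i ∈ A} wᵢ log f(yᵢ; θ)`. -/
def wLogLik (f : 𝓨 → Param r q → ℝ) (A : Finset (Fin N)) (w : Fin N → ℝ) (y : Fin N → 𝓨)
    (θ : Param r q) : ℝ :=
  (N : ℝ)⁻¹ * ∑ i ∈ A, w i * Real.log (f (y i) θ)

/-- The weighted score `Ŝ_w(θ) = N⁻¹ ∑_{i ∈ A} wᵢ S(θ; yᵢ)`. -/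
def wScore (f : 𝓨 → Param r q → ℝ) (A : Finset (Fin N)) (w : Fin N → ℝ) (y : Fin N → 𝓨)
    (θ : Param r q) : Param r q :=
  (N : ℝ)⁻¹ • ∑ i ∈ A, w i • score f θ (y i)

/-- `t` is a choice of `argmax_{s ∈ T} l(s)`: if `l` has a maximizer over `T`, then `t` is one
(there may be several). -/
def IsArgmax {α : Type*} (l : α → ℝ) (T : Set α) (t : α) : Prop :=
  (∃ s ∈ T, IsMaxOn l T s) → t ∈ T ∧ IsMaxOn l T t

end Estimation

/-! ### Poisson sampling from a random finite population -/

section Sampling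

variable {r q : ℕ} {𝓨 Ω : Type*} [MeasurableSpace 𝓨] [MeasurableSpace Ω]

/-- The expected sample size `n₀ = ∑ᵢ πᵢ` (with `E πᵢ` in place of `πᵢ` if `πᵢ` is random). -/
def expSize (P : Measure Ω) {N : ℕ} (pi : Fin N → Ω → ℝ) : ℝ := ∑ i, ∫ ω, pi i ω ∂P

/-- A sequence of finite populations `(y_{ν,i})_{i ≤ N_ν}` from the model, with Poisson samples
`A_ν` drawn with the inclusion probabilities `π_{ν,i}`. These may depend on the population values
(informative sampling); deterministic inclusion probabilities are the special case of constant
functions. `VS θ` is the limit of `n₀ var{Ŝ_w(θ)}`. -/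
structure PoissonSurvey (P : Measure Ω) (μ : Measure 𝓨) (f : 𝓨 → Param r q → ℝ)
    (B : Set (Param r q)) (θ₀ : Param r q) (N : ℕ → ℕ)
    (Y : (ν : ℕ) → Fin (N ν) → Ω → 𝓨) (pi : (ν : ℕ) → Fin (N ν) → Ω → ℝ)
    (A : (ν : ℕ) → Ω → Finset (Fin (N ν)))
    (VS : Param r q → Matrix (Fin r ⊕ Fin q) (Fin r ⊕ Fin q) ℝ) : Prop where
  measurable_Y : ∀ ν i, Measurable (Y ν i)
  measurable_pi : ∀ ν i, Measurable (pi ν i)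
  measurable_A : ∀ ν i, MeasurableSet {ω | i ∈ A ν ω}
  pi_pos : ∀ ν i ω, 0 < pi ν i ω
  pi_le_one : ∀ ν i ω, pi ν i ω ≤ 1
  /-- The population values have density `f(·; θ₀)`. -/
  law_Y : ∀ ν i, P.map (Y ν i) = modelLaw μ f θ₀
  /-- Different units are generated and selected independently. -/
  indep : ∀ ν, iIndepFun (fun i ω => (Y ν i ω, pi ν i ω, i ∈ A ν ω)) P
  /-- Unit `i` is selected with probability `πᵢ`. -/
  inclusion : ∀ ν i,
    P⟦{ω | i ∈ A ν ω} | MeasurableSpace.comap (fun ω => (Y ν i ω, pi ν i ω)) inferInstance⟧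
      =ᵐ[P] pi ν i
  /-- `n₀ → ∞`, `n₀ / N → 0` and `C₁ ≤ N n₀⁻¹ πᵢ ≤ C₂`. -/
  size_tendsto : Tendsto (fun ν => expSize P (pi ν)) atTop atTop
  fraction_tendsto : Tendsto (fun ν => expSize P (pi ν) / N ν) atTop (𝓝 0)
  pi_bounds : ∃ C₁ C₂ : ℝ, 0 < C₁ ∧ 0 < C₂ ∧ ∀ ν i, ∀ᵐ ω ∂P,
    C₁ ≤ N ν * (expSize P (pi ν))⁻¹ * pi ν i ω ∧ N ν * (expSize P (pi ν))⁻¹ * pi ν i ω ≤ C₂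
  /-- `n₀ var{Ŝ_w(θ)}` converges to a positive definite matrix. -/
  score_var : ∀ θ ∈ interior B, (VS θ).PosDef ∧ ∀ j k,
    Tendsto (fun ν => expSize P (pi ν) *
      cov[fun ω => wScore f (A ν ω) (fun i => (pi ν i ω)⁻¹) (fun i => Y ν i ω) θ j,
        fun ω => wScore f (A ν ω) (fun i => (pi ν i ω)⁻¹) (fun i => Y ν i ω) θ k; P])
      atTop (𝓝 (VS θ j k))

end Sampling

/-! ### The bootstrap -/

section Bootstrap

variable {N : ℕ}

/-- The probability of the counts `k = (Nᵢ*)_{i ∈ A}` under the multinomial distribution with `N`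
trials and success probabilities `pᵢ ∝ wᵢ = πᵢ⁻¹`, `i ∈ A`. -/
def multinomialProb (A : Finset (Fin N)) (pi : Fin N → ℝ) (k : Fin N → ℕ) : ℝ :=
  Nat.multinomial A k * ∏ i ∈ A, ((pi i)⁻¹ / ∑ j ∈ A, (pi j)⁻¹) ^ k i

/-- The probability of `m = (mᵢ*)_{i ∈ A}` if the `mᵢ*` are independent with the binomial
distributions `Bin(kᵢ, πᵢ)`. -/
def binomialProb (A : Finset (Fin N)) (pi : Fin N → ℝ) (k m : Fin N → ℕ) : ℝ :=
  ∏ i ∈ A, ((k i).choose (m i) * pi i ^ m i * (1 - pi i) ^ (k i - m i))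

/-- The bootstrap law of `(mᵢ*)_{i ∈ A}` given the sample (extended by `mᵢ* = 0` for `i ∉ A`):
first `(Nᵢ*)` is multinomial, and then, given `(Nᵢ*)`, the `mᵢ*` are independent `Bin(Nᵢ*, πᵢ)`.
It is a probability measure when `A` is nonempty and the zero measure when `A` is empty and
`0 < N`. -/
def bootLaw (A : Finset (Fin N)) (pi : Fin N → ℝ) : Measure (Fin N → ℕ) :=
  ∑ k ∈ A.piAntidiag N, ∑ m ∈ Finset.Iic k,
    ENNReal.ofReal (multinomialProb A pi k * binomialProb A pi k m) • Measure.dirac m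

/-- The bootstrap log-likelihood `l_w*(θ) = N⁻¹ ∑_{i ∈ A} wᵢ mᵢ* log f(yᵢ; θ)`, `wᵢ = πᵢ⁻¹`. -/
def bootLogLik {r q : ℕ} {𝓨 : Type*} (f : 𝓨 → Param r q → ℝ) (A : Finset (Fin N))
    (pi : Fin N → ℝ) (y : Fin N → 𝓨) (m : Fin N → ℕ) (θ : Param r q) : ℝ :=
  wLogLik f A (fun i => (pi i)⁻¹ * m i) y θ

/-- The random laws `κ ν` converge weakly in probability to `G`. -/
def WeakConvInProb {Ω : Type*} [MeasurableSpace Ω] (P : Measure Ω) (κ : ℕ → Ω → Measure ℝ)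
    (G : Measure ℝ) : Prop :=
  ∀ h : ℝ →ᵇ ℝ, TendstoInMeasure P (fun ν ω => ∫ x, h x ∂(κ ν ω)) atTop (fun _ => ∫ x, h x ∂G)

end Bootstrap

end SurveyBootstrap

end

/-! The statement involves two layers of randomness, the sample and the bootstrap counts given the
sample. Convergence in probability is turned into ordinary convergence along a filter
(`kernelFilter`): the sample gives `surveyFilter`, the bootstrap on top of it gives `bootFilter`.
Deterministic arguments about maximizers are then proved once for an arbitrary filter and used at
both levels.

Analytic core. If the weighted averages of every integrable function converge to its model mean
(`WeightedLLN`), the weighted log-likelihood is a `QuadraticCriterion`: near θ₀ its increment is s·h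
− h·𝓘h/2 up to o(‖h‖²), and away from θ₀ it is smaller by a fixed amount. Its maxima over Θ and over
a slice with θ₂ fixed are then asymptotically those of the quadratic (`argmax_expansion`). The law
of large numbers holds for the sample weights (`weightedLLN`) and for the bootstrap weights
(`bootstrap_weightedLLN`). Hence θ̂ − θ₀ ≈ 𝓘⁻¹Ŝ_w, and since the bootstrap restriction passes
through θ̂, the sample score cancels: W* is asymptotically a quadratic form in √n(Ŝ_w* − Ŝ_w) alone,
namely the form 𝓘₂₂·₁ in the θ₂-component of 𝓘⁻¹ applied to it (`likelihoodRatio`,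
`tendsto_bootRatio_sub`).

Probabilistic core. The two bootstrap stages amount to N independent trials, each retaining unit i
of A with probability 1/W, W = Σ wⱼ, because πᵢwᵢ = 1. So the counts have generating function (1 +
W⁻¹Σ(zᵢ − 1))^N (`integral_prod_pow_bootLaw`); as N/W → 1, they behave like independent Poisson(1)
variables. The conditional covariance of √n(Ŝ_w* − Ŝ_w) is therefore close to nN⁻²Σ_A wᵢ²SᵢSᵢᵀ. This
has the limit Σ_S: the score has mean zero at θ₀, so the expectation of n₀N⁻²Σ_A wᵢ²SᵢSᵢᵀ is exactly
n₀ var Ŝ_w(θ₀). Third moments give the conditional central limit theorem through characteristic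
functions (`tendsto_charFun_surveyDev`).

Finally `exists_standardization` provides L with L Σ_S Lᵀ = 1 in which the quadratic form is Σ
cᵢ(Lv)ᵢ², the cᵢ being the eigenvalues of Σ_{θ,22}𝓘₂₂·₁. -/

noncomputable section

namespace SurveyBootstrap

set_option linter.unusedSectionVars false

/-! ### Convergence in probability as convergence along a filter -/

section KernelFilter

variable {α : Type*} {β : α → Type*} [∀ a, MeasurableSpace (β a)]

/-- The sets of pairs `⟨a, b⟩` whose complement has `κ a`-probability tending to `0` along `l`.
Convergence along this filter is convergence in `κ`-probability along `l`. -/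
def kernelFilter (l : Filter α) (κ : ∀ a, Measure (β a)) : Filter (Σ a, β a) where
  sets := {s | Tendsto (fun a => κ a {b | (⟨a, b⟩ : Σ a, β a) ∉ s}) l (𝓝 0)}
  univ_sets := by simpa using tendsto_const_nhds
  sets_of_superset := by
    intro s t hs hst
    exact tendsto_of_tendsto_of_tendsto_of_le_of_le tendsto_const_nhds hs (fun _ => zero_le)
      fun a => measure_mono fun b hb h => hb (hst h)
  inter_sets := by
    intro s t hs ht
    have h := Tendsto.add (Set.mem_ofPred_eq ▸ hs) (Set.mem_ofPred_eq ▸ ht)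
    rw [add_zero] at h
    refine tendsto_of_tendsto_of_tendsto_of_le_of_le tendsto_const_nhds h (fun _ => zero_le)
      fun a => (measure_mono ?_).trans (measure_union_le _ _)
    intro b hb
    by_contra hc
    simp only [Set.mem_union, Set.mem_ofPred_eq, not_or, not_not] at hc
    exact hb hc

variable {l : Filter α} {κ : ∀ a, Measure (β a)}

theorem mem_kernelFilter {s : Set (Σ a, β a)} :
    s ∈ kernelFilter l κ ↔ Tendsto (fun a => κ a {b | (⟨a, b⟩ : Σ a, β a) ∉ s}) l (𝓝 0) :=
  Iff.rfl

theorem mem_kernelFilter_iff {s : Set (Σ a, β a)} :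
    s ∈ kernelFilter l κ ↔
      ∀ η : ENNReal, 0 < η → ∀ᶠ a in l, κ a {b | (⟨a, b⟩ : Σ a, β a) ∉ s} ≤ η := by
  rw [mem_kernelFilter, ENNReal.tendsto_nhds_zero]

/-- The exceptional fibre is empty as soon as the base index is good. This lifts limits of the
sample to the joint level of sample and bootstrap counts. -/
theorem tendsto_fst_kernelFilter : Tendsto Sigma.fst (kernelFilter l κ) l := by
  intro s hs
  rw [mem_map, mem_kernelFilter]
  refine tendsto_const_nhds.congr' ?_
  filter_upwards [hs] with a ha
  simp [ha]

theorem tendsto_kernelFilter_iff {Z : (Σ a, β a) → ℝ} {c : ℝ} :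
    Tendsto Z (kernelFilter l κ) (𝓝 c) ↔
      ∀ ε > 0, Tendsto (fun a => κ a {b | ε ≤ |Z ⟨a, b⟩ - c|}) l (𝓝 0) := by
  rw [Metric.tendsto_nhds]
  refine forall₂_congr fun ε _ => ?_
  rw [Filter.Eventually, mem_kernelFilter]
  simp only [Set.mem_ofPred_eq, not_lt, Real.dist_eq]

/-- Markov's inequality. Integrability has to be required, as the integral of a non-integrable
function is 0 by convention. -/
theorem tendsto_kernelFilter_of_integral [∀ a, IsFiniteMeasure (κ a)] {X : (Σ a, β a) → ℝ}
    (hX : ∀ᶠ a in l, Integrable (fun b => X ⟨a, b⟩) (κ a))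
    (h : Tendsto (fun a => ∫ b, |X ⟨a, b⟩| ∂κ a) l (𝓝 0)) :
    Tendsto X (kernelFilter l κ) (𝓝 0) := by
  rw [tendsto_kernelFilter_iff]
  intro ε hε
  have h2 : Tendsto (fun a => ENNReal.ofReal ((∫ b, |X ⟨a, b⟩| ∂κ a) / ε)) l (𝓝 0) := by
    have := ENNReal.tendsto_ofReal (h.div_const ε)
    simpa using this
  refine tendsto_of_tendsto_of_tendsto_of_le_of_le' tendsto_const_nhds h2
    (Eventually.of_forall fun _ => zero_le) ?_
  filter_upwards [hX] with a ha
  have h3 := mul_meas_ge_le_integral_of_nonneg (μ := κ a) (f := fun b => |X ⟨a, b⟩|)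
    (Eventually.of_forall fun b => abs_nonneg _) ha.abs ε
  rw [← ENNReal.ofReal_toReal (measure_ne_top (κ a) _)]
  apply ENNReal.ofReal_le_ofReal
  rw [le_div_iff₀ hε, mul_comm]
  simpa [Measure.real] using h3

theorem tendsto_kernelFilter_of_sq [∀ a, IsFiniteMeasure (κ a)] {X : (Σ a, β a) → ℝ}
    (hX : ∀ᶠ a in l, Integrable (fun b => X ⟨a, b⟩ ^ 2) (κ a))
    (h : Tendsto (fun a => ∫ b, X ⟨a, b⟩ ^ 2 ∂κ a) l (𝓝 0)) :
    Tendsto X (kernelFilter l κ) (𝓝 0) := by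
  have h1 : Tendsto (fun x => X x ^ 2) (kernelFilter l κ) (𝓝 0) := by
    apply tendsto_kernelFilter_of_integral hX
    simpa using h
  have h2 := (Real.continuous_sqrt.tendsto 0).comp h1
  rw [Real.sqrt_zero] at h2
  rw [tendsto_zero_iff_abs_tendsto_zero]
  refine h2.congr fun x => ?_
  simp [Real.sqrt_sq_eq_abs]

/-- `Z` is tight with respect to the laws `κ a` along `l`. -/
def TightAlong (l : Filter α) (κ : ∀ a, Measure (β a)) (Z : (Σ a, β a) → ℝ) : Prop :=
  ∀ η : ENNReal, 0 < η → ∃ K : ℝ, 0 ≤ K ∧ ∀ᶠ a in l, κ a {b | K < |Z ⟨a, b⟩|} ≤ η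

/-- Markov's inequality at the threshold (|C| + 1)/η', which leaves mass at most η'. -/
theorem tightAlong_of_integral [∀ a, IsFiniteMeasure (κ a)] {X : (Σ a, β a) → ℝ} (C : ℝ)
    (hX : ∀ᶠ a in l, Integrable (fun b => X ⟨a, b⟩) (κ a) ∧ ∫ b, |X ⟨a, b⟩| ∂κ a ≤ C) :
    TightAlong l κ X := by
  intro η hη
  obtain ⟨η', hη', hη'η⟩ : ∃ η' : ℝ, 0 < η' ∧ ENNReal.ofReal η' ≤ η := by
    by_cases ht : η = ⊤
    · exact ⟨1, one_pos, by simp [ht]⟩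
    · exact ⟨η.toReal, ENNReal.toReal_pos hη.ne' ht, by rw [ENNReal.ofReal_toReal ht]⟩
  refine ⟨(|C| + 1) / η', by positivity, ?_⟩
  filter_upwards [hX] with a ⟨ha, hC⟩
  have hK : 0 < (|C| + 1) / η' := by positivity
  have h3 := mul_meas_ge_le_integral_of_nonneg (μ := κ a) (f := fun b => |X ⟨a, b⟩|)
    (Eventually.of_forall fun b => abs_nonneg _) ha.abs ((|C| + 1) / η')
  refine le_trans ?_ hη'η
  rw [← ENNReal.ofReal_toReal (measure_ne_top (κ a) _)]
  apply ENNReal.ofReal_le_ofReal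
  have h4 : (κ a {b | (|C| + 1) / η' < |X ⟨a, b⟩|}).toReal ≤
      (κ a).real {b | (|C| + 1) / η' ≤ |X ⟨a, b⟩|} :=
    ENNReal.toReal_mono (measure_ne_top _ _) (measure_mono <| Set.ofPred_subset_ofPred.2 fun b hb => hb.le)
  have h5 : (|C| + 1) / η' * (κ a).real {b | (|C| + 1) / η' ≤ |X ⟨a, b⟩|} ≤ |C| + 1 := by
    linarith [le_abs_self C]
  have h6 : (κ a).real {b | (|C| + 1) / η' ≤ |X ⟨a, b⟩|} ≤ η' := by
    rw [div_mul_eq_mul_div, div_le_iff₀ hη'] at h5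
    exact le_of_mul_le_mul_left h5 (by positivity)
  exact h4.trans h6

theorem TightAlong.of_sq {X : (Σ a, β a) → ℝ} (h : TightAlong l κ fun x => X x ^ 2) :
    TightAlong l κ X := by
  intro η hη
  obtain ⟨K, hK0, hK⟩ := h η hη
  refine ⟨Real.sqrt K, Real.sqrt_nonneg _, hK.mono fun a ha => (measure_mono ?_).trans ha⟩
  intro b hb
  simp only [Set.mem_ofPred_eq] at hb ⊢
  rw [abs_of_nonneg (sq_nonneg _), ← sq_abs]
  exact (Real.sqrt_lt' (by linarith [Real.sqrt_nonneg K])).1 hb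

/-- Boundedness along a filter, tested against null functions. Along `kernelFilter` this is
boundedness in probability. -/
def BoundedAlong {γ : Type*} (l : Filter γ) (Z : γ → ℝ) : Prop :=
  ∀ e : γ → ℝ, Tendsto e l (𝓝 0) → Tendsto (fun x => e x * Z x) l (𝓝 0)

namespace BoundedAlong

variable {γ : Type*} {m : Filter γ} {X Z : γ → ℝ}

theorem add (hX : BoundedAlong m X) (hZ : BoundedAlong m Z) : BoundedAlong m fun x => X x + Z x := by
  intro e he
  simpa [mul_add] using (hX e he).add (hZ e he)

/-- The two tests are applied in succession: e·X is again null and may be used to test Z. Defining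
boundedness through null functions thus avoids splitting events. -/
theorem mul (hX : BoundedAlong m X) (hZ : BoundedAlong m Z) : BoundedAlong m fun x => X x * Z x := by
  intro e he
  simpa [mul_assoc] using hZ _ (hX e he)

theorem mono (hZ : BoundedAlong m Z) (h : ∀ᶠ x in m, |X x| ≤ |Z x|) : BoundedAlong m X := by
  intro e he
  refine squeeze_zero_norm' ?_ ((tendsto_zero_iff_norm_tendsto_zero).1 (hZ e he))
  filter_upwards [h] with x hx
  simp only [norm_mul, Real.norm_eq_abs]
  gcongr

theorem congr (hZ : BoundedAlong m Z) (h : ∀ᶠ x in m, X x = Z x) : BoundedAlong m X :=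
  hZ.mono (h.mono fun x hx => by rw [hx])

theorem of_tendsto {c : ℝ} (h : Tendsto Z m (𝓝 c)) : BoundedAlong m Z := by
  intro e he
  simpa using he.mul h

theorem const (c : ℝ) : BoundedAlong m fun _ => c := of_tendsto tendsto_const_nhds

theorem sum {ι : Type*} (s : Finset ι) {F : ι → γ → ℝ} (h : ∀ i ∈ s, BoundedAlong m (F i)) :
    BoundedAlong m fun x => ∑ i ∈ s, F i x := by
  intro e he
  simp only [Finset.mul_sum]
  simpa using tendsto_finsetSum s fun i hi => h i hi e he

end BoundedAlong

/-- On |Z| ≤ K the product is below ε once |e| < ε/(K + 1); the event |Z| > K has mass at most η/2.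
-/
theorem TightAlong.boundedAlong {Z : (Σ a, β a) → ℝ} (h : TightAlong l κ Z) :
    BoundedAlong (kernelFilter l κ) Z := by
  intro e he
  rw [tendsto_kernelFilter_iff] at he ⊢
  intro ε hε
  rw [ENNReal.tendsto_nhds_zero]
  intro η hη
  obtain ⟨K, hK0, hK⟩ := h (η / 2) (ENNReal.half_pos hη.ne')
  have he' := (ENNReal.tendsto_nhds_zero.1 (he (ε / (K + 1)) (by positivity))) (η / 2)
    (ENNReal.half_pos hη.ne')
  filter_upwards [hK, he'] with a h1 h2
  refine (measure_mono ?_).trans ((measure_union_le {b | K < |Z ⟨a, b⟩|}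
    {b | ε / (K + 1) ≤ |e ⟨a, b⟩ - 0|}).trans
      ((add_le_add h1 h2).trans (ENNReal.add_halves η).le))
  intro b hb
  by_contra hc
  simp only [Set.mem_union, Set.mem_ofPred_eq, not_or, not_lt, not_le, sub_zero] at hc hb
  rw [lt_div_iff₀ (by positivity)] at hc
  rw [abs_mul] at hb
  nlinarith [abs_nonneg (e ⟨a, b⟩), abs_nonneg (Z ⟨a, b⟩)]

/-- Here Z depends on the outer variable only, while the null function e lives on the inner level.
The outer event |Z| > K is discarded once; on its complement the inner probability of |eZ| ≥ ε is at
most that of |e| ≥ ε/(K + 1). -/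
theorem TightAlong.boundedAlong_fst {γ : (Σ a, β a) → Type*} [∀ x, MeasurableSpace (γ x)]
    {κ' : ∀ x, Measure (γ x)} {Z : (Σ a, β a) → ℝ} (h : TightAlong l κ Z) :
    BoundedAlong (kernelFilter (kernelFilter l κ) κ') fun x => Z x.1 := by
  intro e he
  rw [tendsto_kernelFilter_iff] at he ⊢
  intro ε hε
  rw [ENNReal.tendsto_nhds_zero]
  intro δ hδ
  rw [Filter.Eventually, mem_kernelFilter_iff]
  intro η hη
  obtain ⟨K, hK0, hK⟩ := h (η / 2) (ENNReal.half_pos hη.ne')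
  have he' := (ENNReal.tendsto_nhds_zero.1 (he (ε / (K + 1)) (by positivity))) δ hδ
  rw [Filter.Eventually, mem_kernelFilter_iff] at he'
  filter_upwards [hK, he' (η / 2) (ENNReal.half_pos hη.ne')] with a h1 h2
  refine (measure_mono ?_).trans ((measure_union_le _ _).trans
      ((add_le_add h1 h2).trans (ENNReal.add_halves η).le))
  intro b hb
  by_contra hc
  simp only [Set.mem_union, Set.mem_ofPred_eq, not_or, not_lt, sub_zero, not_le] at hc hb
  refine absurd (lt_of_lt_of_le hb ((measure_mono ?_).trans hc.2)) (lt_irrefl _)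
  intro d hd
  simp only [Set.mem_ofPred_eq] at hd ⊢
  by_contra hc2
  rw [not_le, lt_div_iff₀ (by positivity)] at hc2
  rw [abs_mul] at hd
  nlinarith [abs_nonneg (e ⟨⟨a, b⟩, d⟩), abs_nonneg (Z ⟨a, b⟩)]

/-- Bounded convergence in probability: for mass at most one, the integral is at most ε/2 plus C
times the measure of |X| ≥ ε/2. -/
theorem tendsto_integral_of_bounded [∀ a, IsFiniteMeasure (κ a)] {X : (Σ a, β a) → ℝ} {C : ℝ}
    (hκ : ∀ᶠ a in l, κ a Set.univ ≤ 1)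
    (hC : ∀ x, |X x| ≤ C) (hm : ∀ a, Measurable fun b => X ⟨a, b⟩)
    (h : Tendsto X (kernelFilter l κ) (𝓝 0)) :
    Tendsto (fun a => ∫ b, X ⟨a, b⟩ ∂κ a) l (𝓝 0) := by
  rw [Metric.tendsto_nhds]
  intro ε hε
  rw [tendsto_kernelFilter_iff] at h
  have h1 := h (ε / 2) (by positivity)
  have h2 : Tendsto (fun a => C * (κ a {b | ε / 2 ≤ |X ⟨a, b⟩ - 0|}).toReal) l (𝓝 0) := by
    simpa using ((ENNReal.tendsto_toReal ENNReal.zero_ne_top).comp h1).const_mul C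
  filter_upwards [h2.eventually (gt_mem_nhds (half_pos hε)), hκ] with a ha hκa
  rw [dist_zero_right]
  have hκ1 : (κ a).real Set.univ ≤ 1 := by
    have := ENNReal.toReal_mono ENNReal.one_ne_top hκa
    simpa [Measure.real] using this
  set S : Set (β a) := {b | ε / 2 ≤ |X ⟨a, b⟩ - 0|} with hS
  have hSm : MeasurableSet S := measurableSet_le measurable_const (by
    have := hm a
    simpa using this.abs)
  calc ‖∫ b, X ⟨a, b⟩ ∂κ a‖ ≤ ∫ b, ‖X ⟨a, b⟩‖ ∂κ a := norm_integral_le_integral_norm _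
    _ ≤ ∫ b, (S.indicator (fun _ => C) b + ε / 2) ∂κ a := by
        apply integral_mono_of_nonneg (Eventually.of_forall fun b => norm_nonneg _)
        · exact ((integrable_const C).indicator hSm).add (integrable_const _)
        · refine Eventually.of_forall fun b => ?_
          by_cases hb : b ∈ S
          · have := hC ⟨a, b⟩
            simp only [Set.indicator_of_mem hb, Real.norm_eq_abs]
            linarith
          · simp only [Set.indicator_of_notMem hb, Real.norm_eq_abs]
            simp only [hS, Set.mem_ofPred_eq, sub_zero, not_le] at hb
            linarith
    _ = C * (κ a S).toReal + (κ a).real Set.univ * (ε / 2) := by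
        rw [integral_add ((integrable_const C).indicator hSm) (integrable_const _),
          integral_indicator_const _ hSm, integral_const]
        simp [Measure.real, mul_comm]
    _ < ε := by nlinarith

/-- Continuity is uniform only on compact sets, so tightness is used to confine Q to [−K, K]; the
margin 1 in the interval leaves room for W, which differs from Q by less than 1. -/
theorem tendsto_comp_sub_of_tight {Q W : (Σ a, β a) → ℝ} (hQ : TightAlong l κ Q)
    (hW : Tendsto (fun x => W x - Q x) (kernelFilter l κ) (𝓝 0)) {h : ℝ → ℝ} (hh : Continuous h) :
    Tendsto (fun x => h (W x) - h (Q x)) (kernelFilter l κ) (𝓝 0) := by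
  rw [tendsto_kernelFilter_iff] at hW ⊢
  intro ε hε
  rw [ENNReal.tendsto_nhds_zero]
  intro η hη
  obtain ⟨K, hK0, hK⟩ := hQ (η / 2) (ENNReal.half_pos hη.ne')
  have huc := (isCompact_Icc (a := -(K + 1)) (b := K + 1)).uniformContinuousOn_of_continuous
    hh.continuousOn
  rw [Metric.uniformContinuousOn_iff] at huc
  obtain ⟨δ, hδ, hδh⟩ := huc ε hε
  have h3 := (ENNReal.tendsto_nhds_zero.1 (hW (min δ 1) (by positivity))) (η / 2)
    (ENNReal.half_pos hη.ne')
  filter_upwards [hK, h3] with a h1 h2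
  refine (measure_mono ?_).trans ((measure_union_le _ _).trans
      ((add_le_add h1 h2).trans (ENNReal.add_halves η).le))
  intro b hb
  by_contra hc
  simp only [Set.mem_union, Set.mem_ofPred_eq, not_or, not_lt, sub_zero, not_le] at hc hb
  obtain ⟨hc1, hc2⟩ := hc
  have hd := lt_min_iff.1 hc2
  rw [abs_le] at hc1
  have h4 := abs_lt.1 hd.2
  have := hδh (W ⟨a, b⟩) ⟨by linarith, by linarith⟩ (Q ⟨a, b⟩) ⟨by linarith, by linarith⟩ hd.1
  rw [Real.dist_eq] at this
  linarith

/-- Weak convergence to the standard Gaussian law along an arbitrary filter, from the pointwise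
convergence of the characteristic functions and bounded second moments. -/
theorem tendsto_integral_stdGaussian {E : Type*} [NormedAddCommGroup E] [InnerProductSpace ℝ E]
    [FiniteDimensional ℝ E] [MeasurableSpace E] [BorelSpace E] {ζ : (Σ a, β a) → E} {C : ℝ}
    (hζ : ∀ a, Measurable fun b => ζ ⟨a, b⟩)
    (hκ : ∀ᶠ a in l, IsProbabilityMeasure (κ a))
    (hC : ∀ᶠ a in l, Integrable (fun b => ‖ζ ⟨a, b⟩‖) (κ a) ∧ ∫ b, ‖ζ ⟨a, b⟩‖ ∂κ a ≤ C)
    (hchar : ∀ u : E, Tendsto (fun a => charFun ((κ a).map fun b => ζ ⟨a, b⟩) u) l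
      (𝓝 (charFun (stdGaussian E) u)))
    (φ : E →ᵇ ℝ) :
    Tendsto (fun a => ∫ b, φ (ζ ⟨a, b⟩) ∂κ a) l (𝓝 (∫ x, φ x ∂stdGaussian E)) := by
  classical
  let good : α → Prop := fun a => IsProbabilityMeasure (κ a) ∧
    Integrable (fun b => ‖ζ ⟨a, b⟩‖) (κ a) ∧ ∫ b, ‖ζ ⟨a, b⟩‖ ∂κ a ≤ C
  have hgood : ∀ᶠ a in l, good a := hκ.and hC
  -- At indices where the hypotheses fail the law is replaced by the point mass at 0. The whole
  -- family is then tight, and the limit along the filter is unaffected.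
  let μ : α → ProbabilityMeasure E := fun a =>
    if h : good a then ⟨(κ a).map fun b => ζ ⟨a, b⟩,
      haveI := h.1
      Measure.isProbabilityMeasure_map (hζ a).aemeasurable⟩
    else ⟨Measure.dirac 0, inferInstance⟩
  have hμ : ∀ a, good a → ((μ a : ProbabilityMeasure E) : Measure E) =
      (κ a).map fun b => ζ ⟨a, b⟩ := by
    intro a ha
    simp [μ, ha]
  have htight : IsTightMeasureSet {(μ a : Measure E) | a} := by
    rw [isTightMeasureSet_iff_exists_isCompact_measure_compl_le]
    intro ε hε
    obtain ⟨ε', hε', hε'ε⟩ : ∃ ε' : ℝ, 0 < ε' ∧ ENNReal.ofReal ε' ≤ ε := by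
      by_cases ht : ε = ⊤
      · exact ⟨1, one_pos, by simp [ht]⟩
      · exact ⟨ε.toReal, ENNReal.toReal_pos hε.ne' ht, by rw [ENNReal.ofReal_toReal ht]⟩
    refine ⟨Metric.closedBall 0 ((|C| + 1) / ε'), isCompact_closedBall _ _, ?_⟩
    rintro _ ⟨a, rfl⟩
    have hK : 0 < (|C| + 1) / ε' := by positivity
    by_cases ha : good a
    · rw [hμ a ha, Measure.map_apply (hζ a) Metric.isClosed_closedBall.measurableSet.compl]
      have := ha.1
      have h3 := mul_meas_ge_le_integral_of_nonneg (μ := κ a) (f := fun b => ‖ζ ⟨a, b⟩‖)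
        (Eventually.of_forall fun b => norm_nonneg _) ha.2.1 ((|C| + 1) / ε')
      refine le_trans ?_ hε'ε
      rw [← ENNReal.ofReal_toReal (measure_ne_top (κ a) _)]
      apply ENNReal.ofReal_le_ofReal
      have h4 : (κ a ((fun b => ζ ⟨a, b⟩) ⁻¹' (Metric.closedBall 0 ((|C| + 1) / ε'))ᶜ)).toReal ≤
          (κ a).real {b | (|C| + 1) / ε' ≤ ‖ζ ⟨a, b⟩‖} := by
        refine ENNReal.toReal_mono (measure_ne_top _ _) (measure_mono fun b hb => ?_)
        simp only [Set.mem_preimage, Set.mem_compl_iff, Metric.mem_closedBall, dist_zero_right,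
          not_le] at hb
        exact hb.le
      have h5 : (|C| + 1) / ε' * (κ a).real {b | (|C| + 1) / ε' ≤ ‖ζ ⟨a, b⟩‖} ≤ |C| + 1 := by
        linarith [le_abs_self C, ha.2.2]
      rw [div_mul_eq_mul_div, div_le_iff₀ hε'] at h5
      exact h4.trans (le_of_mul_le_mul_left h5 (by positivity))
    · have : ((μ a : ProbabilityMeasure E) : Measure E) = Measure.dirac 0 := by simp [μ, ha]
      rw [this, Measure.dirac_apply' _ Metric.isClosed_closedBall.measurableSet.compl]
      simp [hK.le]
  let μ₀ : ProbabilityMeasure E := ⟨stdGaussian E, inferInstance⟩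
  have hcf : ∀ u : E, Tendsto (fun a => charFun (μ a : Measure E) u) l
      (𝓝 (charFun (μ₀ : Measure E) u)) := by
    intro u
    refine (hchar u).congr' ?_
    filter_upwards [hgood] with a ha
    rw [hμ a ha]
  -- Trigonometric polynomials separate points, so in a tight family the convergence of
  -- characteristic functions determines the weak limit, along any filter.
  have hlim : Tendsto μ l (𝓝 μ₀) := by
    refine ProbabilityMeasure.tendsto_of_tight_of_separatesPoints htight (𝕜 := ℂ)
      (A := charPoly Real.continuous_probChar (L := innerₗ E) continuous_inner) ?_ ?_
    · refine separatesPoints_charPoly Real.continuous_probChar Real.probChar_ne_one _ ?_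
      exact fun v hv ↦ DFunLike.ne_iff.mpr ⟨v, inner_self_ne_zero.mpr hv⟩
    · exact fun g ↦ ProbabilityMeasure.tendsto_charPoly_of_tendsto_charFun hcf
  have := (ProbabilityMeasure.tendsto_iff_forall_integral_tendsto.1 hlim) φ
  refine this.congr' ?_
  filter_upwards [hgood] with a ha
  rw [hμ a ha, integral_map (hζ a).aemeasurable φ.continuous.aestronglyMeasurable]

end KernelFilter

/-! ### Moments and generating function of the bootstrap law -/

section BootstrapMoments

variable {N : ℕ} {A : Finset (Fin N)} {pi : Fin N → ℝ}

theorem multinomialProb_mul_binomialProb_nonneg (h0 : ∀ i, 0 < pi i) (h1 : ∀ i, pi i ≤ 1)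
    (k m : Fin N → ℕ) : 0 ≤ multinomialProb A pi k * binomialProb A pi k m := by
  unfold multinomialProb binomialProb
  have hw : ∀ i, 0 ≤ (pi i)⁻¹ := fun i => (inv_pos.2 (h0 i)).le
  refine mul_nonneg (mul_nonneg (Nat.cast_nonneg _) (Finset.prod_nonneg fun i _ => pow_nonneg
    (div_nonneg (hw i) (Finset.sum_nonneg fun j _ => hw j)) _)) (Finset.prod_nonneg fun i _ => ?_)
  have := h1 i
  have := (h0 i).le
  have : 0 ≤ 1 - pi i := by linarith
  positivity

instance isFiniteMeasure_bootLaw : IsFiniteMeasure (bootLaw A pi) := by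
  unfold bootLaw
  constructor
  simp only [Measure.finsetSum_apply, Measure.smul_apply, smul_eq_mul, measure_univ, mul_one]
  exact ENNReal.sum_lt_top.2 fun k _ => ENNReal.sum_lt_top.2 fun m _ => ENNReal.ofReal_lt_top

theorem integrable_bootLaw {E : Type*} [NormedAddCommGroup E] (φ : (Fin N → ℕ) → E) :
    Integrable φ (bootLaw A pi) := by
  unfold bootLaw
  refine integrable_finsetSum_measure.2 fun k _ => integrable_finsetSum_measure.2 fun m _ => ?_
  exact Integrable.smul_measure (integrable_dirac (by simp)) ENNReal.ofReal_ne_top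

theorem integral_bootLaw {E : Type*} [NormedAddCommGroup E] [NormedSpace ℝ E] [CompleteSpace E]
    (h0 : ∀ i, 0 < pi i) (h1 : ∀ i, pi i ≤ 1)
    (φ : (Fin N → ℕ) → E) :
    ∫ m, φ m ∂bootLaw A pi = ∑ k ∈ A.piAntidiag N, ∑ m ∈ Finset.Iic k,
      (multinomialProb A pi k * binomialProb A pi k m) • φ m := by
  have hi : ∀ k m : Fin N → ℕ, Integrable φ
      (ENNReal.ofReal (multinomialProb A pi k * binomialProb A pi k m) • Measure.dirac m) :=
    fun k m => Integrable.smul_measure (integrable_dirac (by simp)) ENNReal.ofReal_ne_top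
  unfold bootLaw
  rw [integral_finsetSum_measure fun k _ => integrable_finsetSum_measure.2 fun m _ => hi k m]
  refine Finset.sum_congr rfl fun k _ => ?_
  rw [integral_finsetSum_measure fun m _ => hi k m]
  refine Finset.sum_congr rfl fun m _ => ?_
  rw [integral_smul_measure, integral_dirac, ENNReal.toReal_ofReal
    (multinomialProb_mul_binomialProb_nonneg h0 h1 k m)]

/-- The sum over m ≤ k runs over a box and factors into one binomial theorem per unit; units outside
`A` have kᵢ = 0 and contribute the factor 1. -/
theorem sum_binomialProb_mul {𝕜 : Type*} [RCLike 𝕜] {k : Fin N → ℕ} (hk : ∀ i ∉ A, k i = 0)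
    (z : Fin N → 𝕜) :
    ∑ m ∈ Finset.Iic k, (binomialProb A pi k m : 𝕜) * ∏ i ∈ A, z i ^ m i =
      ∏ i ∈ A, (1 - (pi i : 𝕜) + pi i * z i) ^ k i := by
  classical
  have hI : Finset.Iic k = Fintype.piFinset fun i => Finset.Iic (k i) := by
    ext m; simp [Pi.le_def]
  let g : (i : Fin N) → ℕ → 𝕜 := fun i j => if i ∈ A then
    ((k i).choose j * (pi i : 𝕜) ^ j * (1 - pi i) ^ (k i - j)) * z i ^ j else 1
  have h1 : ∀ m : Fin N → ℕ, (binomialProb A pi k m : 𝕜) * ∏ i ∈ A, z i ^ m i =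
      ∏ i, g i (m i) := by
    intro m
    unfold binomialProb
    push_cast
    rw [← Finset.prod_mul_distrib]
    simp only [g]
    rw [Finset.prod_ite_mem, Finset.univ_inter]
  have h2 : ∏ i ∈ A, (1 - (pi i : 𝕜) + pi i * z i) ^ k i =
      ∏ i, if i ∈ A then (1 - (pi i : 𝕜) + pi i * z i) ^ k i else 1 := by
    rw [Finset.prod_ite_mem, Finset.univ_inter]
  rw [Finset.sum_congr rfl fun m _ => h1 m, hI, h2, ← Finset.prod_univ_sum]
  refine Finset.prod_congr rfl fun i _ => ?_
  by_cases hi : i ∈ A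
  · simp only [g, hi, if_true]
    rw [add_comm, add_pow, Nat.range_succ_eq_Iic]
    refine Finset.sum_congr rfl fun j _ => ?_
    rw [mul_pow]; ring
  · simp only [g, hi, if_false, hk i hi]
    simp

/-- With pᵢ = wᵢ/W and πᵢwᵢ = 1 one has pᵢ(1 − πᵢ + πᵢzᵢ) = pᵢ + W⁻¹(zᵢ − 1), so the retention
probability of a trial is the same for all units of `A`. The multinomial theorem collapses both
stages into one power. Total mass, moments and characteristic functions of the bootstrap law are all
read off from this formula. -/
theorem integral_prod_pow_bootLaw {𝕜 : Type*} [RCLike 𝕜] (hA : A.Nonempty)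
    (h0 : ∀ i, 0 < pi i) (h1 : ∀ i, pi i ≤ 1) (z : Fin N → 𝕜) :
    ∫ m, ∏ i ∈ A, z i ^ m i ∂bootLaw A pi =
      (1 + ((∑ j ∈ A, (pi j)⁻¹ : ℝ) : 𝕜)⁻¹ * ∑ i ∈ A, (z i - 1)) ^ N := by
  rw [integral_bootLaw h0 h1]
  have hW : 0 < ∑ j ∈ A, (pi j)⁻¹ := Finset.sum_pos (fun i _ => inv_pos.2 (h0 i)) hA
  have hW' : ((∑ j ∈ A, (pi j)⁻¹ : ℝ) : 𝕜) ≠ 0 := by exact_mod_cast hW.ne'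
  have hin : ∀ k ∈ A.piAntidiag N, ∑ m ∈ Finset.Iic k,
      (multinomialProb A pi k * binomialProb A pi k m) • ∏ i ∈ A, z i ^ m i =
      (Nat.multinomial A k : 𝕜) * ∏ i ∈ A, ((((pi i)⁻¹ / ∑ j ∈ A, (pi j)⁻¹ : ℝ) : 𝕜) *
        (1 - (pi i : 𝕜) + pi i * z i)) ^ k i := by
    intro k hk
    have hk' : ∀ i ∉ A, k i = 0 := by
      intro i hi
      by_contra hne
      exact hi ((Finset.mem_piAntidiag.1 hk).2 i hne)
    have hs : ∀ m, (multinomialProb A pi k * binomialProb A pi k m) • ∏ i ∈ A, z i ^ m i =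
        (multinomialProb A pi k : 𝕜) * ((binomialProb A pi k m : 𝕜) * ∏ i ∈ A, z i ^ m i) := by
      intro m
      rw [RCLike.real_smul_eq_coe_mul]
      push_cast
      ring
    rw [Finset.sum_congr rfl fun m _ => hs m, ← Finset.mul_sum, sum_binomialProb_mul hk']
    unfold multinomialProb
    push_cast
    rw [mul_assoc, ← Finset.prod_mul_distrib]
    congr 1
    exact Finset.prod_congr rfl fun i _ => (mul_pow _ _ _).symm
  rw [Finset.sum_congr rfl hin, ← Finset.sum_pow_eq_sum_piAntidiag]
  congr 1
  have hterm : ∀ i ∈ A, (((pi i)⁻¹ / ∑ j ∈ A, (pi j)⁻¹ : ℝ) : 𝕜) *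
      (1 - (pi i : 𝕜) + pi i * z i) =
      ((∑ j ∈ A, (pi j)⁻¹ : ℝ) : 𝕜)⁻¹ * (((pi i)⁻¹ : ℝ) : 𝕜) +
        ((∑ j ∈ A, (pi j)⁻¹ : ℝ) : 𝕜)⁻¹ * (z i - 1) := by
    intro i _
    have hp : (pi i : 𝕜) ≠ 0 := by exact_mod_cast (h0 i).ne'
    rw [RCLike.ofReal_div, RCLike.ofReal_inv]
    field_simp
    ring
  rw [Finset.sum_congr rfl hterm, Finset.sum_add_distrib, ← Finset.mul_sum, ← Finset.mul_sum]
  congr 1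
  rw [← RCLike.ofReal_sum, inv_mul_cancel₀ hW']

theorem isProbabilityMeasure_bootLaw (hA : A.Nonempty) (h0 : ∀ i, 0 < pi i) (h1 : ∀ i, pi i ≤ 1) :
    IsProbabilityMeasure (bootLaw A pi) := by
  have h := integral_prod_pow_bootLaw (𝕜 := ℝ) hA h0 h1 fun _ => 1
  simp only [one_pow, Finset.prod_const_one, integral_const, smul_eq_mul, mul_one, sub_self,
    Finset.sum_const_zero, mul_zero, add_zero] at h
  exact (isProbabilityMeasure_iff_real).2 h

theorem integral_cexp_bootLaw (hA : A.Nonempty) (h0 : ∀ i, 0 < pi i) (h1 : ∀ i, pi i ≤ 1)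
    (a : Fin N → ℝ) :
    ∫ m, Complex.exp (((∑ i ∈ A, a i * m i : ℝ) : ℂ) * Complex.I) ∂bootLaw A pi =
      (1 + ((∑ j ∈ A, (pi j)⁻¹ : ℝ) : ℂ)⁻¹ * ∑ i ∈ A, (Complex.exp (a i * Complex.I) - 1)) ^ N := by
  have h := integral_prod_pow_bootLaw (𝕜 := ℂ) hA h0 h1 fun i => Complex.exp (a i * Complex.I)
  simp only [Complex.coe_algebraMap] at h
  rw [← h]
  congr 1
  ext m
  push_cast
  rw [Finset.sum_mul, Complex.exp_sum]
  refine Finset.prod_congr rfl fun i _ => ?_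
  rw [← Complex.exp_nat_mul]
  congr 1
  ring

theorem mgf_bootLaw (hA : A.Nonempty) (h0 : ∀ i, 0 < pi i) (h1 : ∀ i, pi i ≤ 1)
    (a : Fin N → ℝ) (s : ℝ) :
    mgf (fun m : Fin N → ℕ => ∑ i ∈ A, a i * m i) (bootLaw A pi) s =
      (1 + (∑ j ∈ A, (pi j)⁻¹)⁻¹ * ∑ i ∈ A, (Real.exp (s * a i) - 1)) ^ N := by
  have h := integral_prod_pow_bootLaw (𝕜 := ℝ) hA h0 h1 fun i => Real.exp (s * a i)
  simp only [RCLike.ofReal_real_eq_id, id] at h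
  rw [← h, mgf]
  congr 1
  ext m
  beta_reduce
  rw [Finset.mul_sum, Real.exp_sum]
  refine Finset.prod_congr rfl fun i _ => ?_
  rw [← Real.exp_nat_mul]
  congr 1
  ring

theorem integrableExpSet_bootLaw (X : (Fin N → ℕ) → ℝ) :
    integrableExpSet X (bootLaw A pi) = Set.univ := by
  ext s
  simp only [integrableExpSet, Set.mem_ofPred_eq, Set.mem_univ, iff_true]
  exact integrable_bootLaw _

theorem hasDerivAt_expSum (c : ℝ) (a : Fin N → ℝ) (b : Fin N → ℝ) (d s : ℝ) :
    HasDerivAt (fun s => d + c * ∑ i ∈ A, (b i * Real.exp (s * a i)))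
      (c * ∑ i ∈ A, b i * a i * Real.exp (s * a i)) s := by
  have h : HasDerivAt (fun s => ∑ i ∈ A, (b i * Real.exp (s * a i)))
      (∑ i ∈ A, b i * a i * Real.exp (s * a i)) s := by
    refine HasDerivAt.fun_sum fun i _ => ?_
    have h1 : HasDerivAt (fun s : ℝ => s * a i) (a i) s := by
      simpa using (hasDerivAt_id s).mul_const (a i)
    have := (h1.exp).const_mul (b i)
    rwa [mul_comm (Real.exp _), ← mul_assoc] at this
  exact (h.const_mul c).const_add d

/-- First derivative of the moment generating function at 0; integrability is automatic because the
law has finite support. -/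
theorem integral_linear_bootLaw (hA : A.Nonempty) (h0 : ∀ i, 0 < pi i) (h1 : ∀ i, pi i ≤ 1)
    (a : Fin N → ℝ) :
    ∫ m, ∑ i ∈ A, a i * m i ∂bootLaw A pi = N * (∑ j ∈ A, (pi j)⁻¹)⁻¹ * ∑ i ∈ A, a i := by
  have h := deriv_mgf_zero (X := fun m : Fin N → ℕ => ∑ i ∈ A, a i * m i) (μ := bootLaw A pi)
    (by rw [integrableExpSet_bootLaw]; simp)
  rw [← h]
  have hf : mgf (fun m : Fin N → ℕ => ∑ i ∈ A, a i * m i) (bootLaw A pi) = fun s =>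
      ((1 - (∑ j ∈ A, (pi j)⁻¹)⁻¹ * A.card) +
        (∑ j ∈ A, (pi j)⁻¹)⁻¹ * ∑ i ∈ A, 1 * Real.exp (s * a i)) ^ N := by
    ext s
    rw [mgf_bootLaw hA h0 h1, Finset.sum_sub_distrib]
    simp
    ring
  rw [hf, ((hasDerivAt_expSum _ a _ _ 0).fun_pow N).deriv]
  simp
  ring

theorem integral_linear_sq_bootLaw (hA : A.Nonempty) (h0 : ∀ i, 0 < pi i) (h1 : ∀ i, pi i ≤ 1)
    (a : Fin N → ℝ) :
    ∫ m, (∑ i ∈ A, a i * m i) ^ 2 ∂bootLaw A pi =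
      N * (∑ j ∈ A, (pi j)⁻¹)⁻¹ * ∑ i ∈ A, a i ^ 2 +
      N * (N - 1) * ((∑ j ∈ A, (pi j)⁻¹)⁻¹ * ∑ i ∈ A, a i) ^ 2 := by
  have h := iteratedDeriv_mgf_zero (X := fun m : Fin N → ℕ => ∑ i ∈ A, a i * m i)
    (μ := bootLaw A pi) (by rw [integrableExpSet_bootLaw]; simp) 2
  simp only [Pi.pow_apply] at h
  rw [← h]
  have hf : mgf (fun m : Fin N → ℕ => ∑ i ∈ A, a i * m i) (bootLaw A pi) = fun s =>
      ((1 - (∑ j ∈ A, (pi j)⁻¹)⁻¹ * A.card) +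
        (∑ j ∈ A, (pi j)⁻¹)⁻¹ * ∑ i ∈ A, 1 * Real.exp (s * a i)) ^ N := by
    ext s
    rw [mgf_bootLaw hA h0 h1, Finset.sum_sub_distrib]
    simp
    ring
  rw [iteratedDeriv_succ, iteratedDeriv_one, hf]
  have hd : deriv (fun s : ℝ => ((1 - (∑ j ∈ A, (pi j)⁻¹)⁻¹ * (A.card : ℝ)) +
        (∑ j ∈ A, (pi j)⁻¹)⁻¹ * ∑ i ∈ A, 1 * Real.exp (s * a i)) ^ N) = fun s =>
      N * ((1 - (∑ j ∈ A, (pi j)⁻¹)⁻¹ * (A.card : ℝ)) +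
        (∑ j ∈ A, (pi j)⁻¹)⁻¹ * ∑ i ∈ A, 1 * Real.exp (s * a i)) ^ (N - 1) *
        (0 + (∑ j ∈ A, (pi j)⁻¹)⁻¹ * ∑ i ∈ A, (1 * a i) * Real.exp (s * a i)) := by
    ext s
    rw [((hasDerivAt_expSum _ a _ _ s).fun_pow N).deriv, zero_add]
  rw [hd, ((((hasDerivAt_expSum _ a _ _ 0).fun_pow (N - 1)).const_mul (N : ℝ)).fun_mul
    (hasDerivAt_expSum _ a _ _ 0)).deriv]
  -- A nonempty `A` forces 1 ≤ N, so the truncated subtraction in the exponent is the true one.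
  have hN : ((N - 1 : ℕ) : ℝ) = N - 1 := by
    obtain ⟨i, _⟩ := hA
    have : 1 ≤ N := Nat.one_le_iff_ne_zero.2 fun h => by subst h; exact i.elim0
    push_cast [this]
    ring
  simp [hN]
  ring_nf

end BootstrapMoments

/-! ### Quadratic expansion of a maximized criterion along a filter -/

section Maximization

open scoped RealInnerProductSpace

variable {V : Type*} [NormedAddCommGroup V] [InnerProductSpace ℝ V]

/-- The concave quadratic function `h ↦ s·h - h·Jh / 2`. -/
def quadApprox (J : V →L[ℝ] V) (s h : V) : ℝ := ⟪s, h⟫ - ⟪h, J h⟫ / 2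

theorem quadApprox_add {J : V →L[ℝ] V} (hsymm : ∀ x y, ⟪J x, y⟫ = ⟪x, J y⟫) (s h e : V) :
    quadApprox J s (h + e) = quadApprox J s h + ⟪s - J h, e⟫ - ⟪e, J e⟫ / 2 := by
  unfold quadApprox
  simp only [map_add, inner_add_left, inner_add_right, inner_sub_left, hsymm]
  have : ⟪e, J h⟫ = ⟪h, J e⟫ := by rw [← hsymm, real_inner_comm]
  rw [this]
  ring

/-- The criteria `ℓ x`, `x → l`, on `Θ` have a common quadratic expansion at `θ₀` with gradients
`s x` and negative Hessian `J`, and parameters away from `θ₀` do not compete. -/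
structure QuadraticCriterion {γ : Type*} (l : Filter γ) (ℓ : γ → V → ℝ) (Θ : Set V) (θ₀ : V)
    (s : γ → V) (J : V →L[ℝ] V) : Prop where
  symm : ∀ x y, ⟪J x, y⟫ = ⟪x, J y⟫
  coercive : ∃ c > 0, ∀ h, c * ‖h‖ ^ 2 ≤ ⟪h, J h⟫
  expansion : ∀ ε > 0, ∃ δ > 0, ∀ᶠ x in l, ∀ h, ‖h‖ ≤ δ →
    |ℓ x (θ₀ + h) - ℓ x θ₀ - quadApprox J (s x) h| ≤ ε * ‖h‖ ^ 2
  gradient_tendsto : Tendsto (fun x => ‖s x‖) l (𝓝 0)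
  separated : ∀ ε > 0, ∃ c > 0, ∀ᶠ x in l, ∀ θ ∈ Θ, ε ≤ ‖θ - θ₀‖ → ℓ x θ - ℓ x θ₀ ≤ -c
  continuousOn : ∃ ρ > 0, Metric.closedBall θ₀ ρ ⊆ Θ ∧
    ∀ x, ContinuousOn (ℓ x) (Metric.closedBall θ₀ ρ)

namespace QuadraticCriterion

variable {γ : Type*} {l : Filter γ} {ℓ : γ → V → ℝ} {Θ : Set V} {θ₀ : V} {s : γ → V}
  {J : V →L[ℝ] V}

/-- The expansion is uniform over ‖h‖ ≤ δ, so it may be evaluated at a moving point tending to 0.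
Where h x = 0 the quotient defining e is 0 and the identity is trivial. -/
theorem exists_remainder (H : QuadraticCriterion l ℓ Θ θ₀ s J) {h : γ → V}
    (hh : Tendsto (fun x => ‖h x‖) l (𝓝 0)) :
    ∃ e : γ → ℝ, Tendsto e l (𝓝 0) ∧ ∀ᶠ x in l,
      ℓ x (θ₀ + h x) - ℓ x θ₀ = quadApprox J (s x) (h x) + e x * ‖h x‖ ^ 2 := by
  refine ⟨fun x => (ℓ x (θ₀ + h x) - ℓ x θ₀ - quadApprox J (s x) (h x)) / ‖h x‖ ^ 2, ?_, ?_⟩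
  · rw [Metric.tendsto_nhds]
    intro ε hε
    obtain ⟨δ, hδ, H'⟩ := H.expansion (ε / 2) (half_pos hε)
    filter_upwards [H', hh.eventually (gt_mem_nhds hδ)] with x hx hx'
    have := hx (h x) hx'.le
    rw [dist_zero_right, Real.norm_eq_abs, abs_div, abs_of_nonneg (sq_nonneg ‖h x‖)]
    by_cases h0 : ‖h x‖ = 0
    · simp [h0, hε]
    · have : 0 < ‖h x‖ ^ 2 := by positivity
      rw [div_lt_iff₀ this]
      nlinarith
  · obtain ⟨δ, hδ, H'⟩ := H.expansion 1 one_pos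
    filter_upwards [H', hh.eventually (gt_mem_nhds hδ)] with x hx hx'
    by_cases h0 : h x = 0
    · simp [h0, quadApprox]
    · have : ‖h x‖ ^ 2 ≠ 0 := by positivity
      field_simp
      ring

theorem abs_quadApprox_le (J : V →L[ℝ] V) (s h : V) :
    |quadApprox J s h| ≤ ‖s‖ * ‖h‖ + ‖J‖ * ‖h‖ ^ 2 := by
  unfold quadApprox
  have h1 := abs_real_inner_le_norm s h
  have h2 := abs_real_inner_le_norm h (J h)
  have h3 := J.le_opNorm h
  have h4 : |⟪h, J h⟫ / 2| ≤ ‖J‖ * ‖h‖ ^ 2 := by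
    rw [abs_div, abs_two]
    have : ‖h‖ * ‖J h‖ ≤ ‖h‖ * (‖J‖ * ‖h‖) := by gcongr
    have : 0 ≤ ‖J‖ * ‖h‖ ^ 2 := by positivity
    nlinarith
  exact (abs_sub _ _).trans (add_le_add h1 h4)

theorem tendsto_criterion (H : QuadraticCriterion l ℓ Θ θ₀ s J) {h : γ → V}
    (hh : Tendsto (fun x => ‖h x‖) l (𝓝 0)) :
    Tendsto (fun x => ℓ x (θ₀ + h x) - ℓ x θ₀) l (𝓝 0) := by
  obtain ⟨e, he, h1⟩ := H.exists_remainder hh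
  have h2 : Tendsto (fun x => quadApprox J (s x) (h x)) l (𝓝 0) := by
    refine squeeze_zero_norm (fun x => abs_quadApprox_le J (s x) (h x)) ?_
    simpa using (H.gradient_tendsto.mul hh).add ((hh.pow 2).const_mul ‖J‖)
  have h3 : Tendsto (fun x => quadApprox J (s x) (h x) + e x * ‖h x‖ ^ 2) l (𝓝 0) := by
    simpa using h2.add (he.mul (hh.pow 2))
  exact h3.congr' (h1.mono fun x hx => hx.symm)

variable [FiniteDimensional ℝ V] {E : Submodule ℝ V} {t θt : γ → V}

/-- `IsArgmax` is empty unless a maximizer exists, so existence comes first: outside a small ball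
the criterion stays below its value at t by separation, and on the ball cut with the slice t + E it
attains its maximum by compactness. The same comparison with t forces the chosen maximizer into the
ball. -/
theorem eventually_argmax (H : QuadraticCriterion l ℓ Θ θ₀ s J)
    (ht : Tendsto (fun x => ‖t x - θ₀‖) l (𝓝 0))
    (hmax : ∀ x, IsArgmax (ℓ x) {θ | θ ∈ Θ ∧ θ - t x ∈ E} (θt x)) {ε : ℝ} (hε : 0 < ε) :
    ∀ᶠ x in l, ‖θt x - θ₀‖ < ε ∧ (θt x ∈ Θ ∧ θt x - t x ∈ E) ∧
      (t x ∈ Θ) ∧ ∀ θ ∈ Θ, θ - t x ∈ E → ℓ x θ ≤ ℓ x (θt x) := by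
  obtain ⟨ρ, hρ, hΘ, hcont⟩ := H.continuousOn
  set ε' := min ε ρ with hε'
  have hε'0 : 0 < ε' := lt_min hε hρ
  obtain ⟨c, hc, hsep⟩ := H.separated ε' hε'0
  have h1 := H.tendsto_criterion ht
  filter_upwards [hsep, h1.eventually (lt_mem_nhds (neg_lt_zero.2 hc)),
    ht.eventually (gt_mem_nhds hε'0)] with x hx1 hx2 hx3
  rw [add_sub_cancel] at hx2
  have htball : t x ∈ Metric.closedBall θ₀ ε' := by
    rw [Metric.mem_closedBall, dist_eq_norm]; exact hx3.le
  have hsub : Metric.closedBall θ₀ ε' ⊆ Metric.closedBall θ₀ ρ :=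
    Metric.closedBall_subset_closedBall (min_le_right _ _)
  have htΘ : t x ∈ Θ := hΘ (hsub htball)
  have hfar : ∀ θ ∈ Θ, ε' ≤ ‖θ - θ₀‖ → ℓ x θ < ℓ x (t x) := by
    intro θ hθ h
    have := hx1 θ hθ h
    linarith
  have hKc : IsCompact (Metric.closedBall θ₀ ε' ∩ {θ | θ - t x ∈ E}) := by
    refine (isCompact_closedBall _ _).inter_right ?_
    exact (Submodule.closed_of_finiteDimensional E).preimage
      (continuous_id.sub continuous_const)
  obtain ⟨θm, hθm, hθmax⟩ := hKc.exists_isMaxOn ⟨t x, htball, by simp⟩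
    ((hcont x).mono (Set.inter_subset_left.trans hsub))
  have hex : ∃ θ ∈ {θ | θ ∈ Θ ∧ θ - t x ∈ E}, IsMaxOn (ℓ x) {θ | θ ∈ Θ ∧ θ - t x ∈ E} θ := by
    refine ⟨θm, ⟨hΘ (hsub hθm.1), hθm.2⟩, ?_⟩
    rintro θ ⟨hθ, hθE⟩
    by_cases hb : θ ∈ Metric.closedBall θ₀ ε'
    · exact hθmax ⟨hb, hθE⟩
    · rw [Metric.mem_closedBall, dist_eq_norm, not_le] at hb
      exact (hfar θ hθ hb.le).le.trans (hθmax ⟨htball, by simp⟩)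
  obtain ⟨hm1, hm2⟩ := hmax x hex
  refine ⟨?_, hm1, htΘ, fun θ hθ hθE => hm2 ⟨hθ, hθE⟩⟩
  by_contra hcon
  rw [not_lt] at hcon
  have := hfar (θt x) hm1.1 ((min_le_left _ _).trans hcon)
  have h5 : ℓ x (t x) ≤ ℓ x (θt x) := hm2 ⟨htΘ, by simp⟩
  linarith

theorem argmax_tendsto (H : QuadraticCriterion l ℓ Θ θ₀ s J)
    (ht : Tendsto (fun x => ‖t x - θ₀‖) l (𝓝 0))
    (hmax : ∀ x, IsArgmax (ℓ x) {θ | θ ∈ Θ ∧ θ - t x ∈ E} (θt x)) :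
    Tendsto (fun x => ‖θt x - θ₀‖) l (𝓝 0) := by
  rw [Metric.tendsto_nhds]
  intro ε hε
  filter_upwards [H.eventually_argmax ht hmax hε] with x hx
  simpa using hx.1

/-- The maximum over `Θ ∩ (t + E)` is asymptotically the maximum of the quadratic approximation,
which is attained at `ξ + Π (τ - ξ)`, `ξ = J⁻¹ s`, `τ = t - θ₀`, with the `J`-orthogonal projection
`1 - Π` onto `E`. -/
theorem argmax_expansion (H : QuadraticCriterion l ℓ Θ θ₀ s J)
    (ht : Tendsto (fun x => ‖t x - θ₀‖) l (𝓝 0))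
    (hmax : ∀ x, IsArgmax (ℓ x) {θ | θ ∈ Θ ∧ θ - t x ∈ E} (θt x))
    {Ji Pr : V →L[ℝ] V} (hJi : ∀ v, J (Ji v) = v) (hPrE : ∀ v, v - Pr v ∈ E)
    (hPrJ : ∀ v, ∀ e ∈ E, ⟪J (Pr v), e⟫ = 0)
    {rn : γ → ℝ} (hs : BoundedAlong l fun x => rn x * ‖s x‖)
    (hτ : BoundedAlong l fun x => rn x * ‖t x - θ₀‖)
    {hh : γ → V} (hhdef : ∀ x, hh x = Ji (s x) + Pr (t x - θ₀ - Ji (s x))) :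
    Tendsto (fun x => rn x ^ 2 * (ℓ x (θt x) - ℓ x θ₀ - quadApprox J (s x) (hh x))) l (𝓝 0) ∧
    Tendsto (fun x => rn x * ‖θt x - θ₀ - hh x‖) l (𝓝 0) := by
  obtain ⟨c, hc, hcoer⟩ := H.coercive
  have hθt := H.argmax_tendsto ht hmax
  have hhle : ∀ x, ‖hh x‖ ≤ (‖Ji‖ + ‖Pr‖ * ‖Ji‖) * ‖s x‖ + ‖Pr‖ * ‖t x - θ₀‖ := by
    intro x
    rw [hhdef]
    have h1 := Ji.le_opNorm (s x)
    have h2 := Pr.le_opNorm (t x - θ₀ - Ji (s x))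
    have h3 := norm_sub_le (t x - θ₀) (Ji (s x))
    calc _ ≤ ‖Ji (s x)‖ + ‖Pr (t x - θ₀ - Ji (s x))‖ := norm_add_le _ _
      _ ≤ ‖Ji‖ * ‖s x‖ + ‖Pr‖ * (‖t x - θ₀‖ + ‖Ji‖ * ‖s x‖) := by
          refine add_le_add h1 (h2.trans ?_)
          gcongr
          linarith
      _ = _ := by ring
  have hhtend : Tendsto (fun x => ‖hh x‖) l (𝓝 0) := by
    refine squeeze_zero (fun x => norm_nonneg _) hhle ?_
    simpa using (H.gradient_tendsto.const_mul (‖Ji‖ + ‖Pr‖ * ‖Ji‖)).add (ht.const_mul ‖Pr‖)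
  have hhB : BoundedAlong l fun x => rn x * ‖hh x‖ := by
    have hb := ((BoundedAlong.const (m := l) (‖Ji‖ + ‖Pr‖ * ‖Ji‖)).mul hs).add
      ((BoundedAlong.const (m := l) ‖Pr‖).mul hτ)
    refine hb.mono (Eventually.of_forall fun x => ?_)
    rw [show (‖Ji‖ + ‖Pr‖ * ‖Ji‖) * (rn x * ‖s x‖) + ‖Pr‖ * (rn x * ‖t x - θ₀‖) =
      rn x * ((‖Ji‖ + ‖Pr‖ * ‖Ji‖) * ‖s x‖ + ‖Pr‖ * ‖t x - θ₀‖) by ring, abs_mul, abs_mul,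
      abs_norm]
    gcongr
    exact (hhle x).trans (le_abs_self _)
  obtain ⟨e1, he1, hq1⟩ := H.exists_remainder hθt
  obtain ⟨e2, he2, hq2⟩ := H.exists_remainder ht
  obtain ⟨e3, he3, hq3⟩ := H.exists_remainder hhtend
  -- Completing the square: the gradient of the quadratic at `hh` is −JΠ(τ − ξ), which annihilates
  -- E, so on the slice only the second-order loss remains.
  have hqle : ∀ x, ∀ h, h - (t x - θ₀) ∈ E → quadApprox J (s x) h =
      quadApprox J (s x) (hh x) - ⟪h - hh x, J (h - hh x)⟫ / 2 := by
    intro x h hE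
    have hmem : h - hh x ∈ E := by
      have h1 := hPrE (t x - θ₀ - Ji (s x))
      have h2 := E.add_mem hE h1
      rw [hhdef]
      convert h2 using 1
      abel
    have h3 := quadApprox_add H.symm (s x) (hh x) (h - hh x)
    rw [add_sub_cancel] at h3
    rw [h3]
    have h4 : s x - J (hh x) = - J (Pr (t x - θ₀ - Ji (s x))) := by
      rw [hhdef, map_add, hJi]; abel
    rw [h4, inner_neg_left, hPrJ _ _ hmem]
    ring
  have hev := H.eventually_argmax ht hmax one_pos
  obtain ⟨ρ, hρ, hΘ, -⟩ := H.continuousOn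
  -- the rate of convergence
  have hB1 : BoundedAlong l fun x => rn x ^ 2 * ‖θt x - θ₀‖ ^ 2 := by
    have hb := ((BoundedAlong.const (m := l) (4 / c * (2 / c))).mul (hs.mul hs)).add
      (((BoundedAlong.const (m := l) (4 / c)).mul (hs.mul hτ)).add
        ((BoundedAlong.const (m := l) (4 / c * (‖J‖ + 1))).mul (hτ.mul hτ)))
    refine hb.mono ?_
    have hc8 : 0 < c / 8 := by positivity
    filter_upwards [hev, hq1, hq2, he1.eventually (Metric.ball_mem_nhds 0 hc8),
      he2.eventually (Metric.ball_mem_nhds 0 one_pos)] with x hx h1 h2 h3 h4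
    simp only [add_sub_cancel] at h1 h2
    obtain ⟨-, -, htΘ, hmx⟩ := hx
    have h5 := hmx (t x) htΘ (by simp)
    rw [dist_zero_right, Real.norm_eq_abs] at h3 h4
    set a := ‖θt x - θ₀‖
    set b := ‖t x - θ₀‖
    set σ := ‖s x‖
    have ha : 0 ≤ a := norm_nonneg _
    have hb0 : 0 ≤ b := norm_nonneg _
    have hσ : 0 ≤ σ := norm_nonneg _
    have h6 : quadApprox J (s x) (θt x - θ₀) ≤ σ * a - c * a ^ 2 / 2 := by
      unfold quadApprox
      have := hcoer (θt x - θ₀)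
      have := real_inner_le_norm (s x) (θt x - θ₀)
      linarith
    have h7 : -(σ * b + ‖J‖ * b ^ 2) ≤ quadApprox J (s x) (t x - θ₀) :=
      (abs_le.1 (abs_quadApprox_le J (s x) (t x - θ₀))).1
    have h8 : e1 x * a ^ 2 ≤ c / 8 * a ^ 2 := by
      gcongr; exact (le_abs_self _).trans h3.le
    have h9 : -1 * b ^ 2 ≤ e2 x * b ^ 2 := by
      gcongr; exact (abs_le.1 h4.le).1
    -- Young's inequality. Together with the c/8 from the remainder it leaves c/4 of the coercivity
    -- constant c/2.
    have h10 : σ * a ≤ c / 8 * a ^ 2 + 2 / c * σ ^ 2 := by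
      have : c / 8 * a ^ 2 + 2 / c * σ ^ 2 - σ * a = (c * a - 4 * σ) ^ 2 / (8 * c) := by
        field_simp; ring
      have h' : 0 ≤ (c * a - 4 * σ) ^ 2 / (8 * c) := by positivity
      linarith
    have h11 : c / 4 * a ^ 2 ≤ 2 / c * σ ^ 2 + σ * b + (‖J‖ + 1) * b ^ 2 := by
      linarith
    have h12 : a ^ 2 ≤ 4 / c * (2 / c * σ ^ 2 + σ * b + (‖J‖ + 1) * b ^ 2) := by
      rw [div_mul_eq_mul_div, le_div_iff₀ hc]
      linarith
    rw [show 4 / c * (2 / c) * (rn x * σ * (rn x * σ)) + (4 / c * (rn x * σ * (rn x * b)) +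
      4 / c * (‖J‖ + 1) * (rn x * b * (rn x * b))) =
      rn x ^ 2 * (4 / c * (2 / c * σ ^ 2 + σ * b + (‖J‖ + 1) * b ^ 2)) by ring,
      abs_mul, abs_mul, abs_of_nonneg (sq_nonneg a)]
    gcongr
    exact h12.trans (le_abs_self _)
  have hup : Tendsto (fun x => e1 x * (rn x ^ 2 * ‖θt x - θ₀‖ ^ 2)) l (𝓝 0) := hB1 e1 he1
  have hlow : Tendsto (fun x => e3 x * (rn x * ‖hh x‖ * (rn x * ‖hh x‖))) l (𝓝 0) :=
    (hhB.mul hhB) e3 he3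
  -- Lower bound: θ₀ + `hh` is feasible, so the maximum is at least the value there. Upper bound:
  -- the expansion at the maximizer with the square completed; its loss term also shows that the
  -- maximizer is close to θ₀ + `hh`.
  have hmain : ∀ᶠ x in l, e3 x * (rn x * ‖hh x‖ * (rn x * ‖hh x‖)) ≤
        rn x ^ 2 * (ℓ x (θt x) - ℓ x θ₀ - quadApprox J (s x) (hh x)) ∧
      rn x ^ 2 * (ℓ x (θt x) - ℓ x θ₀ - quadApprox J (s x) (hh x)) +
        rn x ^ 2 * (c / 2 * ‖θt x - θ₀ - hh x‖ ^ 2) ≤ e1 x * (rn x ^ 2 * ‖θt x - θ₀‖ ^ 2) := by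
    filter_upwards [hev, hq1, hq3, hhtend.eventually (gt_mem_nhds hρ)] with x hx h1 h3 h4
    simp only [add_sub_cancel] at h1
    obtain ⟨-, ⟨-, hE⟩, htΘ, hmx⟩ := hx
    have h5 := hmx (θ₀ + hh x) (hΘ (by simpa using h4.le)) (by
      have h1 := E.neg_mem (hPrE (t x - θ₀ - Ji (s x)))
      rw [hhdef]
      convert h1 using 1
      abel)
    have h6 := hqle x (θt x - θ₀) (by simpa using hE)
    have h7 := hcoer (θt x - θ₀ - hh x)
    have hr := sq_nonneg (rn x)
    constructor
    · have : e3 x * ‖hh x‖ ^ 2 ≤ ℓ x (θt x) - ℓ x θ₀ - quadApprox J (s x) (hh x) := by linarith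
      nlinarith [mul_le_mul_of_nonneg_left this hr]
    · have : (ℓ x (θt x) - ℓ x θ₀ - quadApprox J (s x) (hh x)) +
          c / 2 * ‖θt x - θ₀ - hh x‖ ^ 2 ≤ e1 x * ‖θt x - θ₀‖ ^ 2 := by linarith
      nlinarith [mul_le_mul_of_nonneg_left this hr]
  have hres : Tendsto (fun x => rn x ^ 2 * (ℓ x (θt x) - ℓ x θ₀ - quadApprox J (s x) (hh x))) l
      (𝓝 0) := by
    refine tendsto_of_tendsto_of_tendsto_of_le_of_le' hlow hup (hmain.mono fun x hx => hx.1)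
      (hmain.mono fun x hx => ?_)
    have : 0 ≤ rn x ^ 2 * (c / 2 * ‖θt x - θ₀ - hh x‖ ^ 2) := by positivity
    linarith [hx.2]
  refine ⟨hres, ?_⟩
  have h3 : Tendsto (fun x => (rn x * ‖θt x - θ₀ - hh x‖) ^ 2) l (𝓝 0) := by
    have hd := (hup.sub hres).const_mul (2 / c)
    rw [sub_zero, mul_zero] at hd
    refine squeeze_zero' (Eventually.of_forall fun x => sq_nonneg _) (hmain.mono fun x hx => ?_) hd
    rw [div_mul_eq_mul_div, le_div_iff₀ hc]
    nlinarith [hx.2]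
  rw [tendsto_zero_iff_abs_tendsto_zero]
  have h4 := (Real.continuous_sqrt.tendsto 0).comp h3
  rw [Real.sqrt_zero] at h4
  refine h4.congr fun x => ?_
  simp [Real.sqrt_sq_eq_abs]

end QuadraticCriterion

end Maximization

/-! ### Simultaneous diagonalization and the profiled quadratic form -/

section LinearAlgebra

open Matrix

theorem exists_orthogonal_diagonalization {q : ℕ} {G : Matrix (Fin q) (Fin q) ℝ} (hG : G.PosDef) :
    ∃ (U : Matrix (Fin q) (Fin q) ℝ) (d : Fin q → ℝ), Antitone d ∧ (∀ i, 0 < d i) ∧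
      Uᵀ * U = 1 ∧ U * Uᵀ = 1 ∧ G = U * diagonal d * Uᵀ := by
  have hH := hG.isHermitian
  let U : Matrix (Fin q) (Fin q) ℝ := hH.eigenvectorUnitary
  have hU1 : Uᵀ * U = 1 := by
    have := Unitary.coe_star_mul_self hH.eigenvectorUnitary
    rwa [star_eq_conjTranspose, conjTranspose_eq_transpose_of_trivial] at this
  have hU2 : U * Uᵀ = 1 := mul_eq_one_comm.1 hU1
  have hspec : G = U * diagonal hH.eigenvalues * Uᵀ := by
    have h := hH.spectral_theorem
    rw [Unitary.conjStarAlgAut_apply] at h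
    rw [star_eq_conjTranspose, conjTranspose_eq_transpose_of_trivial] at h
    exact h
  -- Sorting the negated eigenvalues increasingly puts the eigenvalues in decreasing order.
  let σ : Equiv.Perm (Fin q) := Tuple.sort fun i => - hH.eigenvalues i
  have hσ : Monotone ((fun i => - hH.eigenvalues i) ∘ σ) := Tuple.monotone_sort _
  refine ⟨U.submatrix id σ, hH.eigenvalues ∘ σ, ?_, fun i => hG.eigenvalues_pos _, ?_, ?_, ?_⟩
  · intro i j hij
    have := hσ hij
    simp only [Function.comp] at this ⊢
    linarith
  · rw [transpose_submatrix, ← submatrix_mul _ _ _ _ _ Function.bijective_id, hU1]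
    simp
  · rw [transpose_submatrix, ← submatrix_mul _ _ _ _ _ σ.bijective, hU2]
    simp
  · rw [← submatrix_diagonal_equiv, transpose_submatrix, ← submatrix_mul _ _ _ _ _ σ.bijective,
      ← submatrix_mul _ _ _ _ _ σ.bijective, ← hspec]
    simp

/-- Simultaneous diagonalization of the forms `V⁻¹` and `S`. -/
theorem exists_simultaneous_diagonalization {q : ℕ} {V S : Matrix (Fin q) (Fin q) ℝ}
    (hV : V.PosDef) (hS : S.PosDef) :
    ∃ c : Fin q → ℝ, Antitone c ∧ (∀ i, 0 < c i) ∧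
      (V * S).charpoly = ∏ i, (Polynomial.X - Polynomial.C (c i)) ∧
      ∃ T : Matrix (Fin q) (Fin q) ℝ, T * V * Tᵀ = 1 ∧ Tᵀ * diagonal c * T = S := by
  obtain ⟨U, d, -, hd, hU1, hU2, hVU⟩ := exists_orthogonal_diagonalization hV
  -- V = BᵀB. Then V S = Bᵀ(B S) and B S Bᵀ have the same characteristic polynomial, and an
  -- orthogonal diagonalization O of the latter yields T = Oᵀ(B⁻¹)ᵀ.
  let B : Matrix (Fin q) (Fin q) ℝ := diagonal (fun i => Real.sqrt (d i)) * Uᵀ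
  let Bi : Matrix (Fin q) (Fin q) ℝ := U * diagonal (fun i => (Real.sqrt (d i))⁻¹)
  have hsq : ∀ i, Real.sqrt (d i) ≠ 0 := fun i => (Real.sqrt_pos.2 (hd i)).ne'
  have hBB : B * Bi = 1 := by
    simp only [B, Bi]
    rw [Matrix.mul_assoc, ← Matrix.mul_assoc Uᵀ, hU1, Matrix.one_mul, diagonal_mul_diagonal]
    simp [hsq]
  have hBB' : Bi * B = 1 := mul_eq_one_comm.1 hBB
  have hVB : V = Bᵀ * B := by
    simp only [B]
    rw [transpose_mul, transpose_transpose, diagonal_transpose, Matrix.mul_assoc,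
      ← Matrix.mul_assoc (diagonal _) (diagonal _), diagonal_mul_diagonal, ← Matrix.mul_assoc, hVU]
    congr 3
    ext i
    rw [Real.mul_self_sqrt (hd i).le]
  have hG : (B * S * Bᵀ).PosDef := by
    have h := hS.conjTranspose_mul_mul_same (B := Bᵀ) (by
      intro x y hxy
      have h2 : Biᵀ *ᵥ (Bᵀ *ᵥ x) = Biᵀ *ᵥ (Bᵀ *ᵥ y) := by simp only [hxy]
      rwa [mulVec_mulVec, mulVec_mulVec, ← transpose_mul, hBB, transpose_one, one_mulVec,
        one_mulVec] at h2)
    rwa [conjTranspose_eq_transpose_of_trivial, transpose_transpose] at h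
  obtain ⟨O, c, hca, hc, hO1, hO2, hGO⟩ := exists_orthogonal_diagonalization hG
  have hBiT : Biᵀ * Bᵀ = 1 := by rw [← transpose_mul, hBB, transpose_one]
  have hBiT' : Bᵀ * Biᵀ = 1 := mul_eq_one_comm.1 hBiT
  refine ⟨c, hca, hc, ?_, Oᵀ * Biᵀ, ?_, ?_⟩
  · rw [hVB, Matrix.mul_assoc, charpoly_mul_comm, hGO, charpoly_mul_comm, ← Matrix.mul_assoc, hO1,
      Matrix.one_mul, charpoly_diagonal]
  · rw [hVB, transpose_mul Oᵀ Biᵀ, transpose_transpose, transpose_transpose]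
    calc Oᵀ * Biᵀ * (Bᵀ * B) * (Bi * O) = Oᵀ * ((Biᵀ * Bᵀ) * (B * Bi)) * O := by
          simp only [Matrix.mul_assoc]
      _ = 1 := by rw [hBiT, hBB, Matrix.mul_one, Matrix.mul_one, hO1]
  · rw [transpose_mul Oᵀ Biᵀ, transpose_transpose, transpose_transpose]
    calc Bi * O * diagonal c * (Oᵀ * Biᵀ) = Bi * (O * diagonal c * Oᵀ) * Biᵀ := by
          simp only [Matrix.mul_assoc]
      _ = (Bi * B) * S * (Bᵀ * Biᵀ) := by rw [← hGO]; simp only [Matrix.mul_assoc]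
      _ = S := by rw [hBB', hBiT', Matrix.one_mul, Matrix.mul_one]

variable {r q : ℕ}

/-- The matrix of `v ↦ (-M₁₁⁻¹ M₁₂ v₂, v₂)`. -/
def profileMatrix (M : Matrix (Fin r ⊕ Fin q) (Fin r ⊕ Fin q) ℝ) :
    Matrix (Fin r ⊕ Fin q) (Fin r ⊕ Fin q) ℝ :=
  fromBlocks 0 (-(M.toBlocks₁₁⁻¹ * M.toBlocks₁₂)) 0 1

/-- The upper right block is M₁₁(−M₁₁⁻¹M₁₂) + M₁₂ = 0. This is the orthogonality which makes `1 -
profileMatrix M` the M-orthogonal projection onto the directions with θ₂ fixed. -/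
theorem mul_profileMatrix {M : Matrix (Fin r ⊕ Fin q) (Fin r ⊕ Fin q) ℝ} (hM : M.PosDef) :
    M * profileMatrix M = fromBlocks 0 0 0 (schur M) := by
  have h11 : M.toBlocks₁₁.PosDef := hM.submatrix Sum.inl_injective
  have hdet : IsUnit M.toBlocks₁₁.det := h11.det_pos.ne'.isUnit
  conv_lhs => rw [← fromBlocks_toBlocks M]
  rw [profileMatrix, fromBlocks_multiply]
  simp only [toBlocks_fromBlocks₁₁, toBlocks_fromBlocks₁₂, Matrix.mul_zero, Matrix.mul_one,
    add_zero]
  congr 1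
  · rw [Matrix.mul_neg, ← Matrix.mul_assoc, mul_nonsing_inv _ hdet, Matrix.one_mul,
      neg_add_cancel]
  · rw [schur, Matrix.mul_neg, ← Matrix.mul_assoc]
    abel

theorem profileMatrix_transpose_mul {M : Matrix (Fin r ⊕ Fin q) (Fin r ⊕ Fin q) ℝ}
    (hM : M.PosDef) :
    (profileMatrix M)ᵀ * (M * profileMatrix M) = fromBlocks 0 0 0 (schur M) := by
  rw [mul_profileMatrix hM, profileMatrix, fromBlocks_transpose, fromBlocks_multiply]
  simp

theorem dotProduct_profile {M : Matrix (Fin r ⊕ Fin q) (Fin r ⊕ Fin q) ℝ}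
    (hM : M.PosDef) (v : Fin r ⊕ Fin q → ℝ) :
    (profileMatrix M *ᵥ v) ⬝ᵥ (M *ᵥ (profileMatrix M *ᵥ v)) =
      (v ∘ Sum.inr) ⬝ᵥ (schur M *ᵥ (v ∘ Sum.inr)) := by
  have h : ∀ w, (profileMatrix M *ᵥ v) ⬝ᵥ w = v ⬝ᵥ ((profileMatrix M)ᵀ *ᵥ w) := fun w => by
    rw [dotProduct_mulVec, vecMul_transpose]
  rw [h, mulVec_mulVec, mulVec_mulVec, Matrix.mul_assoc, profileMatrix_transpose_mul hM, fromBlocks_mulVec]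
  simp [dotProduct, Fintype.sum_sum_type]

/-- The Schur complement is the form M restricted to the range of the profile matrix, whose vectors
are determined by their θ₂-part; symmetry and positivity are inherited. -/
theorem schur_posDef {M : Matrix (Fin r ⊕ Fin q) (Fin r ⊕ Fin q) ℝ} (hM : M.PosDef) :
    (schur M).PosDef := by
  have hH : Mᵀ = M := by
    have := hM.isHermitian
    rwa [IsHermitian, conjTranspose_eq_transpose_of_trivial] at this
  apply PosDef.of_dotProduct_mulVec_pos
  · have h : (profileMatrix M)ᵀ * (M * profileMatrix M) =
        ((profileMatrix M)ᵀ * (M * profileMatrix M))ᵀ := by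
      rw [transpose_mul, transpose_mul, transpose_transpose, hH, Matrix.mul_assoc]
    rw [profileMatrix_transpose_mul hM, fromBlocks_transpose, fromBlocks_inj] at h
    rw [IsHermitian, conjTranspose_eq_transpose_of_trivial]
    exact h.2.2.2.symm
  · intro x hx
    have h := dotProduct_profile hM (Sum.elim 0 x)
    rw [Sum.elim_comp_inr] at h
    rw [star_trivial, ← h]
    have hne : profileMatrix M *ᵥ Sum.elim 0 x ≠ 0 := by
      intro h0
      apply hx
      have h2 := congrArg (fun w => w ∘ Sum.inr) h0
      rw [profileMatrix, fromBlocks_mulVec] at h2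
      simpa using h2
    simpa using hM.dotProduct_mulVec_pos hne

/-- The left-hand form sees v only through the θ₂-component of M⁻¹v, on which it is the Schur
complement. If v has covariance `VS`, this component has covariance Σ_{θ,22}; diagonalizing the two
matrices simultaneously gives uncorrelated coordinates of variance one with coefficients cᵢ. L is
that coordinate change composed with the lower rows of M⁻¹. -/
theorem exists_standardization {M VS : Matrix (Fin r ⊕ Fin q) (Fin r ⊕ Fin q) ℝ} (hM : M.PosDef)
    (hVS : VS.PosDef) :
    ∃ c : Fin q → ℝ, Antitone c ∧ (∀ i, 0 < c i) ∧
      (designEffect M VS).charpoly = ∏ i, (Polynomial.X - Polynomial.C (c i)) ∧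
      ∃ L : Matrix (Fin q) (Fin r ⊕ Fin q) ℝ, L * VS * Lᵀ = 1 ∧ ∀ v : Fin r ⊕ Fin q → ℝ,
        (profileMatrix M *ᵥ (M⁻¹ *ᵥ v)) ⬝ᵥ (M *ᵥ (profileMatrix M *ᵥ (M⁻¹ *ᵥ v))) =
          ∑ i, c i * (L *ᵥ v) i ^ 2 := by
  have hdet : IsUnit M.det := hM.det_pos.ne'.isUnit
  have hsand : (sandwich M VS).PosDef := by
    have h := hVS.conjTranspose_mul_mul_same (B := (M⁻¹)ᵀ) (by
      intro x y hxy
      have h2 : Mᵀ *ᵥ ((M⁻¹)ᵀ *ᵥ x) = Mᵀ *ᵥ ((M⁻¹)ᵀ *ᵥ y) := by simp only [hxy]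
      rwa [mulVec_mulVec, mulVec_mulVec, ← transpose_mul, nonsing_inv_mul _ hdet, transpose_one,
        one_mulVec, one_mulVec] at h2)
    rwa [conjTranspose_eq_transpose_of_trivial, transpose_transpose] at h
  have h22 : (sandwich M VS).toBlocks₂₂.PosDef := hsand.submatrix Sum.inr_injective
  obtain ⟨c, hca, hc, hchar, T, hT1, hT2⟩ :=
    exists_simultaneous_diagonalization h22 (schur_posDef hM)
  refine ⟨c, hca, hc, hchar, T * M⁻¹.submatrix Sum.inr id, ?_, fun v => ?_⟩
  · rw [← hT1]
    have : (sandwich M VS).toBlocks₂₂ =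
        M⁻¹.submatrix Sum.inr id * VS * (M⁻¹.submatrix Sum.inr id)ᵀ := by
      rw [transpose_submatrix]
      have h1 : M⁻¹.submatrix (Sum.inr : Fin q → Fin r ⊕ Fin q) id * VS =
          (M⁻¹ * VS).submatrix Sum.inr id := by
        rw [submatrix_mul _ _ _ id _ Function.bijective_id, submatrix_id_id]
      rw [h1, ← submatrix_mul _ _ _ id _ Function.bijective_id]
      rfl
    rw [this, transpose_mul]
    simp only [Matrix.mul_assoc]
  · rw [dotProduct_profile hM, ← hT2]
    have h1 : (M⁻¹ *ᵥ v) ∘ Sum.inr = M⁻¹.submatrix Sum.inr id *ᵥ v := rfl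
    rw [h1, ← mulVec_mulVec v T, ← mulVec_mulVec, ← mulVec_mulVec, dotProduct_mulVec,
      vecMul_transpose, dotProduct]
    refine Finset.sum_congr rfl fun i _ => ?_
    rw [mulVec_diagonal]
    ring

end LinearAlgebra

/-! ### Pointwise expansions of the log-likelihood -/

section Pointwise

open scoped RealInnerProductSpace
open Matrix

variable {r q : ℕ} {𝓨 : Type*}

theorem norm_le_sum_abs {ι : Type*} [Fintype ι] (x : EuclideanSpace ℝ ι) : ‖x‖ ≤ ∑ j, |x j| := by
  have h : ‖x‖ ^ 2 ≤ (∑ j, |x j|) ^ 2 := by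
    rw [EuclideanSpace.real_norm_sq_eq]
    calc ∑ j, x j ^ 2 = ∑ j, |x j| ^ 2 := by simp
      _ ≤ (∑ j, |x j|) ^ 2 := Finset.sum_sq_le_sq_sum_of_nonneg fun i _ => abs_nonneg _
  exact abs_le_of_sq_le_sq' h (Finset.sum_nonneg fun i _ => abs_nonneg _) |>.2

theorem abs_apply_le_norm {ι : Type*} [Fintype ι] (x : EuclideanSpace ℝ ι) (j : ι) :
    |x j| ≤ ‖x‖ := by
  simpa using PiLp.norm_apply_le x j

theorem inner_eq_dotProduct {ι : Type*} [Fintype ι] (x y : EuclideanSpace ℝ ι) :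
    ⟪x, y⟫ = x ⬝ᵥ y := by
  rw [EuclideanSpace.inner_eq_star_dotProduct, dotProduct_comm]
  simp

variable {f : 𝓨 → Param r q → ℝ} {y : 𝓨} {U : Set (Param r q)}

theorem hasGradientAt_score {θ : Param r q}
    (h : DifferentiableAt ℝ (fun t => Real.log (f y t)) θ) :
    HasFDerivAt (fun t => Real.log (f y t)) (innerSL ℝ (score f θ y)) θ := by
  have := h.hasGradientAt.hasFDerivAt
  exact this

theorem differentiableAt_score (hU : IsOpen U)
    (hF : ContDiffOn ℝ 2 (fun t => Real.log (f y t)) U) {θ : Param r q} (hθ : θ ∈ U) :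
    DifferentiableAt ℝ (fun t => score f t y) θ := by
  have h1 : ContDiffOn ℝ 1 (fderiv ℝ fun t => Real.log (f y t)) U :=
    hF.fderiv_of_isOpen hU (by norm_num)
  have h2 : DifferentiableAt ℝ (fderiv ℝ fun t => Real.log (f y t)) θ :=
    (h1.differentiableOn (by norm_num)).differentiableAt (hU.mem_nhds hθ)
  exact (InnerProductSpace.toDual ℝ (Param r q)).symm.differentiableAt.comp θ h2

theorem continuousOn_fderiv_score (hU : IsOpen U)
    (hF : ContDiffOn ℝ 2 (fun t => Real.log (f y t)) U) :
    ContinuousOn (fun θ => fderiv ℝ (fun t => score f t y) θ) U := by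
  have h1 : ContDiffOn ℝ 1 (fderiv ℝ fun t => Real.log (f y t)) U :=
    hF.fderiv_of_isOpen hU (by norm_num)
  have h2 : ContDiffOn ℝ 1 (fun t => score f t y) U :=
    (InnerProductSpace.toDual ℝ (Param r q)).symm.contDiff.comp_contDiffOn h1
  exact h2.continuousOn_fderiv_of_isOpen hU le_rfl

theorem fderiv_score_apply (θ h : Param r q) (j : Fin r ⊕ Fin q) :
    fderiv ℝ (fun t => score f t y) θ h j = - (obsInfo f θ y *ᵥ h) j := by
  have h1 : h = ∑ k, h k • EuclideanSpace.single k (1 : ℝ) := by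
    ext i
    simp only [WithLp.ofLp_sum, Finset.sum_apply, PiLp.smul_apply, PiLp.single_apply, smul_eq_mul,
      mul_ite, mul_one, mul_zero, Finset.sum_ite_eq, Finset.mem_univ, if_true]
  conv_lhs => rw [h1]
  rw [map_sum]
  simp only [map_smul, mulVec, dotProduct, obsInfo, neg_mul, Finset.sum_neg_distrib, neg_neg]
  rw [WithLp.ofLp_sum, Finset.sum_apply]
  refine Finset.sum_congr rfl fun k _ => ?_
  simp [mul_comm]

theorem inner_fderiv_score (θ h : Param r q) :
    ⟪h, fderiv ℝ (fun t => score f t y) θ h⟫ = - (h ⬝ᵥ (obsInfo f θ y *ᵥ h)) := by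
  rw [inner_eq_dotProduct, dotProduct, dotProduct, ← Finset.sum_neg_distrib]
  refine Finset.sum_congr rfl fun j _ => ?_
  rw [fderiv_score_apply]
  ring

/-- Symmetry of the second derivative of a C² function, carried through the Riesz identification of
derivative and gradient. -/
theorem obsInfo_symm (hU : IsOpen U)
    (hF : ContDiffOn ℝ 2 (fun t => Real.log (f y t)) U) {θ : Param r q} (hθ : θ ∈ U)
    (j k : Fin r ⊕ Fin q) : obsInfo f θ y j k = obsInfo f θ y k j := by
  have h1 : ContDiffOn ℝ 1 (fderiv ℝ fun t => Real.log (f y t)) U :=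
    hF.fderiv_of_isOpen hU (by norm_num)
  have h2 : DifferentiableAt ℝ (fderiv ℝ fun t => Real.log (f y t)) θ :=
    (h1.differentiableOn (by norm_num)).differentiableAt (hU.mem_nhds hθ)
  have hsymm : IsSymmSndFDerivAt ℝ (fun t => Real.log (f y t)) θ :=
    (hF.contDiffAt (hU.mem_nhds hθ)).isSymmSndFDerivAt (by simp)
  have h3 : ∀ v w : Param r q, ⟪fderiv ℝ (fun t => score f t y) θ v, w⟫ =
      fderiv ℝ (fderiv ℝ fun t => Real.log (f y t)) θ v w := by
    intro v w
    have h4 : (fun t => ⟪score f t y, w⟫) = fun t => fderiv ℝ (fun t => Real.log (f y t)) t w := by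
      ext t
      exact InnerProductSpace.toDual_symm_apply
    have h5 : fderiv ℝ (fun t => ⟪score f t y, w⟫) θ v =
        fderiv ℝ (fun t => fderiv ℝ (fun t => Real.log (f y t)) t w) θ v := by rw [h4]
    rw [fderiv_inner_apply ℝ (differentiableAt_score hU hF hθ) (differentiableAt_const w),
      fderiv_clm_apply h2 (differentiableAt_const w)] at h5
    simpa using h5
  have h5 : ∀ j k, obsInfo f θ y j k = - fderiv ℝ (fderiv ℝ fun t => Real.log (f y t)) θ
      (EuclideanSpace.single k 1) (EuclideanSpace.single j 1) := by
    intro j k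
    rw [← h3, obsInfo, real_inner_comm, EuclideanSpace.inner_single_left]
    simp
  rw [h5, h5, hsymm.eq]

theorem norm_fderiv_score_le {θ : Param r q} {C : ℝ} (hC : 0 ≤ C)
    (h : ∀ j k, |obsInfo f θ y j k| ≤ C) :
    ‖fderiv ℝ (fun t => score f t y) θ‖ ≤ ((r + q : ℕ) : ℝ) ^ 2 * C := by
  refine ContinuousLinearMap.opNorm_le_bound _ (by positivity) fun v => ?_
  refine (norm_le_sum_abs _).trans ?_
  have h1 : ∀ j, |fderiv ℝ (fun t => score f t y) θ v j| ≤ ((r + q : ℕ) : ℝ) * (C * ‖v‖) := by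
    intro j
    rw [fderiv_score_apply, abs_neg, mulVec, dotProduct]
    refine (Finset.abs_sum_le_sum_abs _ _).trans ?_
    calc ∑ k, |obsInfo f θ y j k * v k| ≤ ∑ _k : Fin r ⊕ Fin q, C * ‖v‖ := by
          refine Finset.sum_le_sum fun k _ => ?_
          rw [abs_mul]
          exact mul_le_mul (h j k) (abs_apply_le_norm v k) (abs_nonneg _) hC
      _ = _ := by simp
  calc _ ≤ ∑ _j : Fin r ⊕ Fin q, ((r + q : ℕ) : ℝ) * (C * ‖v‖) :=
        Finset.sum_le_sum fun j _ => h1 j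
    _ = _ := by simp; ring

/-- The second-order Taylor formula with Lagrange remainder, along a segment. -/
theorem exists_taylor_two (hU : IsOpen U) (hF : ContDiffOn ℝ 2 (fun t => Real.log (f y t)) U)
    {θ h : Param r q} (hseg : ∀ t ∈ Set.Icc (0 : ℝ) 1, θ + t • h ∈ U) :
    ∃ c ∈ Set.Ioo (0 : ℝ) 1, Real.log (f y (θ + h)) - Real.log (f y θ) - ⟪score f θ y, h⟫ =
      ⟪h, fderiv ℝ (fun t => score f t y) (θ + c • h) h⟫ / 2 := by
  let φ : ℝ → ℝ := fun t => Real.log (f y (θ + t • h))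
  let φ' : ℝ → ℝ := fun t => ⟪score f (θ + t • h) y, h⟫
  let φ'' : ℝ → ℝ := fun t => ⟪h, fderiv ℝ (fun t => score f t y) (θ + t • h) h⟫
  have hline : ∀ t : ℝ, HasDerivAt (fun t : ℝ => θ + t • h) h t := by
    intro t
    simpa using ((hasDerivAt_id t).smul_const h).const_add θ
  have hφ : ∀ t ∈ Set.Icc (0 : ℝ) 1, HasDerivAt φ (φ' t) t := by
    intro t ht
    have hd : DifferentiableAt ℝ (fun t => Real.log (f y t)) (θ + t • h) :=
      (hF.differentiableOn (by norm_num)).differentiableAt (hU.mem_nhds (hseg t ht))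
    exact (hasGradientAt_score hd).comp_hasDerivAt t (hline t)
  have hφ' : ∀ t ∈ Set.Icc (0 : ℝ) 1, HasDerivAt φ' (φ'' t) t := by
    intro t ht
    have hd := (differentiableAt_score hU hF (hseg t ht)).hasFDerivAt
    have h1 := hd.comp_hasDerivAt t (hline t)
    have h2 := h1.inner ℝ (hasDerivAt_const t h)
    simp only [inner_zero_right, zero_add] at h2
    rw [real_inner_comm] at h2
    exact h2
  -- With this K the function φ(t) − φ(0) − tφ'(0) − t²K vanishes at 0 and 1 and has zero derivative
  -- at 0; Rolle's theorem, used twice, gives φ'' = 2K at an interior point.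
  let K : ℝ := φ 1 - φ 0 - φ' 0
  have hg : ∀ t ∈ Set.Icc (0 : ℝ) 1, HasDerivAt (fun t => φ t - φ 0 - t * φ' 0 - t ^ 2 * K)
      (φ' t - φ' 0 - 2 * t * K) t := by
    intro t ht
    have h1 := (((hφ t ht).sub_const (φ 0)).fun_sub ((hasDerivAt_id t).mul_const (φ' 0))).fun_sub
      (((hasDerivAt_id t).fun_pow 2).mul_const K)
    simpa using h1
  have hg' : ∀ t ∈ Set.Icc (0 : ℝ) 1, HasDerivAt (fun t => φ' t - φ' 0 - 2 * t * K)
      (φ'' t - 2 * K) t := by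
    intro t ht
    have h1 := ((hφ' t ht).sub_const (φ' 0)).fun_sub
      (((hasDerivAt_id t).const_mul 2).mul_const K)
    simpa using h1
  obtain ⟨c₁, hc₁, h1⟩ := exists_hasDerivAt_eq_zero (zero_lt_one' ℝ)
    (fun t ht => (hg t ht).continuousAt.continuousWithinAt) (by simp [K])
    (fun t ht => hg t (Set.Ioo_subset_Icc_self ht))
  have hsub : Set.Icc 0 c₁ ⊆ Set.Icc (0 : ℝ) 1 := Set.Icc_subset_Icc_right hc₁.2.le
  obtain ⟨c₂, hc₂, h2⟩ := exists_hasDerivAt_eq_zero hc₁.1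
    (fun t ht => (hg' t (hsub ht)).continuousAt.continuousWithinAt) (by
      simp only [mul_zero, zero_mul, sub_self]; exact h1.symm)
    (fun t ht => hg' t (hsub (Set.Ioo_subset_Icc_self ht)))
  refine ⟨c₂, ⟨hc₂.1, hc₂.2.trans hc₁.2⟩, ?_⟩
  have h3 : K = Real.log (f y (θ + h)) - Real.log (f y θ) - ⟪score f θ y, h⟫ := by
    simp [K, φ, φ']
  rw [← h3]
  simp only [φ''] at h2
  linarith

/-- The remainder of the second-order expansion of the log-likelihood at `θ`. -/
def taylorRemainder (f : 𝓨 → Param r q → ℝ) (θ : Param r q) (y : 𝓨) (h : Param r q) : ℝ :=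
  Real.log (f y (θ + h)) - Real.log (f y θ) - ⟪score f θ y, h⟫ + h ⬝ᵥ (obsInfo f θ y *ᵥ h) / 2

theorem taylorRemainder_zero (f : 𝓨 → Param r q → ℝ) (θ : Param r q) (y : 𝓨) :
    taylorRemainder f θ y 0 = 0 := by
  simp [taylorRemainder]

/-- The Lagrange remainder and the quadratic term combine into a difference of second derivatives,
at an intermediate point and at θ, so only the oscillation C matters. -/
theorem abs_taylorRemainder_le (hU : IsOpen U)
    (hF : ContDiffOn ℝ 2 (fun t => Real.log (f y t)) U) {θ h : Param r q} {δ C : ℝ}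
    (hball : Metric.ball θ δ ⊆ U) (hh : ‖h‖ < δ)
    (hC : ∀ t ∈ Metric.ball θ δ, ‖fderiv ℝ (fun t => score f t y) t -
      fderiv ℝ (fun t => score f t y) θ‖ ≤ C) :
    |taylorRemainder f θ y h| ≤ C / 2 * ‖h‖ ^ 2 := by
  have hseg : ∀ t ∈ Set.Icc (0 : ℝ) 1, θ + t • h ∈ Metric.ball θ δ := by
    intro t ht
    rw [Metric.mem_ball, dist_eq_norm, add_sub_cancel_left, norm_smul, Real.norm_eq_abs,
      abs_of_nonneg ht.1]
    nlinarith [norm_nonneg h, ht.2]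
  obtain ⟨c, hc, h1⟩ := exists_taylor_two hU hF fun t ht => hball (hseg t ht)
  have h2 : taylorRemainder f θ y h = ⟪h, (fderiv ℝ (fun t => score f t y) (θ + c • h) -
      fderiv ℝ (fun t => score f t y) θ) h⟫ / 2 := by
    rw [taylorRemainder, h1, _root_.sub_apply, inner_sub_right, inner_fderiv_score θ h]
    ring
  rw [h2, abs_div, abs_two]
  have h3 := abs_real_inner_le_norm h ((fderiv ℝ (fun t => score f t y) (θ + c • h) -
      fderiv ℝ (fun t => score f t y) θ) h)
  have h4 := ContinuousLinearMap.le_of_opNorm_le _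
    (hC _ (hseg c (Set.Ioo_subset_Icc_self hc))) h
  nlinarith [norm_nonneg h, mul_le_mul_of_nonneg_left h4 (norm_nonneg h)]

end Pointwise

/-! ### Consequences of the regularity of the model -/

section ModelConsequences

open scoped RealInnerProductSpace
open Matrix

variable {r q : ℕ} {𝓨 : Type*} [MeasurableSpace 𝓨]

/-- A derivative is a limit of difference quotients along a sequence; the shift n₀ keeps the
increments below δ. Measurability of score and information follows in this way from that of the
densities. -/
theorem measurable_of_hasDerivAt_zero {g : 𝓨 → ℝ → ℝ} {g' : 𝓨 → ℝ} {δ : ℝ} (hδ : 0 < δ)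
    (hm : ∀ t, |t| < δ → Measurable fun y => g y t) (hd : ∀ y, HasDerivAt (g y) (g' y) 0) :
    Measurable g' := by
  obtain ⟨n₀, hn₀⟩ := exists_nat_one_div_lt hδ
  have hlt : ∀ n : ℕ, 1 / ((n + n₀ : ℕ) + 1 : ℝ) < δ := fun n => by
    refine lt_of_le_of_lt ?_ hn₀
    apply one_div_le_one_div_of_le (by positivity)
    push_cast
    linarith [(Nat.cast_nonneg n : (0 : ℝ) ≤ n)]
  have ht : Tendsto (fun n : ℕ => 1 / ((n + n₀ : ℕ) + 1 : ℝ)) atTop (𝓝[≠] 0) := by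
    rw [tendsto_nhdsWithin_iff]
    refine ⟨(tendsto_add_atTop_iff_nat (f := fun n : ℕ => 1 / ((n : ℝ) + 1)) n₀).2
      tendsto_one_div_add_atTop_nhds_zero_nat, Eventually.of_forall fun n => ?_⟩
    have : (0 : ℝ) < 1 / ((n + n₀ : ℕ) + 1 : ℝ) := by positivity
    exact this.ne'
  refine measurable_of_tendsto_metrizable (f := fun n : ℕ => fun y =>
    (1 / ((n + n₀ : ℕ) + 1 : ℝ))⁻¹ • (g y (0 + 1 / ((n + n₀ : ℕ) + 1 : ℝ)) - g y 0)) ?_ ?_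
  · intro n
    have h1 := hm (0 + 1 / ((n + n₀ : ℕ) + 1 : ℝ)) (by
      rw [zero_add, abs_of_pos (by positivity)]
      exact hlt n)
    have h2 := hm 0 (by simpa using hδ)
    exact (h1.sub h2).const_mul _
  · rw [tendsto_pi_nhds]
    intro y
    exact (hasDerivAt_iff_tendsto_slope_zero.1 (hd y)).comp ht

variable {μ : Measure 𝓨} {f : 𝓨 → Param r q → ℝ} {Θ B : Set (Param r q)} {θ₀ θ : Param r q}

namespace RegularModel

theorem mem_param (hm : RegularModel μ f Θ B θ₀) : θ₀ ∈ Θ := hm.subset (interior_subset hm.interior)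

theorem isProbabilityMeasure (hm : RegularModel μ f Θ B θ₀) :
    IsProbabilityMeasure (modelLaw μ f θ₀) := by
  constructor
  rw [modelLaw, withDensity_apply _ MeasurableSet.univ, Measure.restrict_univ]
  exact hm.density_lintegral θ₀ hm.mem_param

theorem measurable_log (hm : RegularModel μ f Θ B θ₀) (hθ : θ ∈ Θ) :
    Measurable fun y => Real.log (f y θ) := (hm.density_measurable θ hθ).log

theorem contDiffOn_log (hm : RegularModel μ f Θ B θ₀) (y : 𝓨) :
    ContDiffOn ℝ 2 (fun t => Real.log (f y t)) (_root_.interior B) :=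
  (hm.contDiffOn y).log fun t ht => (hm.density_pos y t (hm.subset (interior_subset ht))).ne'

theorem continuousOn_log (hm : RegularModel μ f Θ B θ₀) (y : 𝓨) :
    ContinuousOn (fun t => Real.log (f y t)) B :=
  (hm.continuousOn y).log fun t ht => (hm.density_pos y t (hm.subset ht)).ne'

theorem hasFDerivAt_log (hm : RegularModel μ f Θ B θ₀) (y : 𝓨) (hθ : θ ∈ _root_.interior B) :
    HasFDerivAt (fun t => Real.log (f y t)) (innerSL ℝ (score f θ y)) θ :=
  hasGradientAt_score (((hm.contDiffOn_log y).differentiableOn (by norm_num)).differentiableAt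
    (isOpen_interior.mem_nhds hθ))

theorem exists_line_mem (hθ : θ ∈ _root_.interior B) (e : Param r q) :
    ∃ δ > 0, ∀ t : ℝ, |t| < δ → θ + t • e ∈ _root_.interior B := by
  have hc : ContinuousAt (fun t : ℝ => θ + t • e) 0 := by fun_prop
  have h1 : (fun t : ℝ => θ + t • e) ⁻¹' _root_.interior B ∈ 𝓝 (0 : ℝ) :=
    hc.preimage_mem_nhds (isOpen_interior.mem_nhds (by simpa using hθ))
  obtain ⟨δ, hδ, h2⟩ := Metric.mem_nhds_iff.1 h1
  exact ⟨δ, hδ, fun t ht => h2 (by simpa using ht)⟩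

theorem measurable_score_apply (hm : RegularModel μ f Θ B θ₀) (hθ : θ ∈ _root_.interior B)
    (j : Fin r ⊕ Fin q) : Measurable fun y => score f θ y j := by
  obtain ⟨δ, hδ, hline⟩ := exists_line_mem hθ (EuclideanSpace.single j (1 : ℝ))
  refine measurable_of_hasDerivAt_zero
    (g := fun y t => Real.log (f y (θ + t • EuclideanSpace.single j (1 : ℝ)))) hδ
    (fun t ht => hm.measurable_log (hm.subset (interior_subset (hline t ht)))) fun y => ?_
  have h1 : HasDerivAt (fun t : ℝ => θ + t • EuclideanSpace.single j (1 : ℝ))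
      (EuclideanSpace.single j (1 : ℝ)) 0 := by
    simpa using ((hasDerivAt_id (0 : ℝ)).smul_const (EuclideanSpace.single j (1 : ℝ))).const_add θ
  have h2 : HasFDerivAt (fun t => Real.log (f y t)) (innerSL ℝ (score f θ y))
      (θ + (0 : ℝ) • EuclideanSpace.single j (1 : ℝ)) := by
    simpa using hm.hasFDerivAt_log y hθ
  have h3 := h2.comp_hasDerivAt (0 : ℝ) h1
  simpa [Function.comp_def, EuclideanSpace.inner_single_right] using h3

theorem measurable_score (hm : RegularModel μ f Θ B θ₀) (hθ : θ ∈ _root_.interior B) :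
    Measurable (score f θ) := by
  have h : Measurable fun y => WithLp.toLp 2 fun j => score f θ y j :=
    (WithLp.measurable_toLp 2 _).comp (measurable_pi_lambda _ fun j =>
      hm.measurable_score_apply hθ j)
  exact h

theorem measurable_obsInfo (hm : RegularModel μ f Θ B θ₀) (hθ : θ ∈ _root_.interior B)
    (j k : Fin r ⊕ Fin q) : Measurable fun y => obsInfo f θ y j k := by
  obtain ⟨δ, hδ, hline⟩ := exists_line_mem hθ (EuclideanSpace.single k (1 : ℝ))
  refine measurable_of_hasDerivAt_zero
    (g := fun y t => - score f (θ + t • EuclideanSpace.single k (1 : ℝ)) y j) hδ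
    (fun t ht => (hm.measurable_score_apply (hline t ht) j).neg) fun y => ?_
  have h1 : HasDerivAt (fun t : ℝ => θ + t • EuclideanSpace.single k (1 : ℝ))
      (EuclideanSpace.single k (1 : ℝ)) 0 := by
    simpa using ((hasDerivAt_id (0 : ℝ)).smul_const (EuclideanSpace.single k (1 : ℝ))).const_add θ
  have h2 : HasFDerivAt (fun t => score f t y) (fderiv ℝ (fun t => score f t y) θ)
      (θ + (0 : ℝ) • EuclideanSpace.single k (1 : ℝ)) := by
    simpa using (differentiableAt_score isOpen_interior (hm.contDiffOn_log y) hθ).hasFDerivAt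
  have h3 := h2.comp_hasDerivAt (0 : ℝ) h1
  have h4 := ((EuclideanSpace.proj (𝕜 := ℝ) j).hasFDerivAt.comp_hasDerivAt (0 : ℝ) h3).neg
  exact h4

theorem measurable_taylorRemainder (hm : RegularModel μ f Θ B θ₀) {h : Param r q}
    (hh : θ₀ + h ∈ Θ) : Measurable fun y => taylorRemainder f θ₀ y h := by
  unfold taylorRemainder
  refine (((hm.measurable_log hh).sub (hm.measurable_log hm.mem_param)).sub ?_).add
    (Measurable.div_const ?_ _)
  · exact (hm.measurable_score hm.interior).inner_const
  · unfold dotProduct mulVec dotProduct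
    refine Finset.measurable_sum _ fun j _ => Measurable.const_mul (Finset.measurable_sum _
      fun k _ => (hm.measurable_obsInfo hm.interior j k).mul_const _) _

/-- One integrable function is made to dominate both the entries at θ₀ and the operator norms on the
interior of B. -/
theorem exists_fderiv_score_bound (hm : RegularModel μ f Θ B θ₀) :
    ∃ G : 𝓨 → ℝ, Integrable G (modelLaw μ f θ₀) ∧ (∀ y, 0 ≤ G y) ∧
      (∀ y, ∀ θ ∈ _root_.interior B, ‖fderiv ℝ (fun t => score f t y) θ‖ ≤ G y) ∧
      (∀ y, ∀ j k, |obsInfo f θ₀ y j k| ≤ G y) := by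
  obtain ⟨H, hHi, hH⟩ := hm.info_dominated
  have hb : ∀ θ ∈ _root_.interior B, ∀ y j k, |obsInfo f θ y j k| ≤ |H y| :=
    fun θ hθ y j k => (hH θ hθ y j k).trans (le_abs_self _)
  obtain ⟨c, hc0, hc⟩ : ∃ c : ℝ, 0 ≤ c ∧ ∀ y, ∀ θ ∈ _root_.interior B,
      ‖fderiv ℝ (fun t => score f t y) θ‖ ≤ c * |H y| :=
    ⟨_, by positivity, fun y θ hθ => norm_fderiv_score_le (abs_nonneg (H y)) (hb θ hθ y)⟩
  refine ⟨fun y => c * |H y| + |H y|, (hHi.abs.const_mul c).add hHi.abs,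
    fun y => by positivity, fun y θ hθ => ?_, fun y j k => ?_⟩
  · have := hc y θ hθ
    have := abs_nonneg (H y)
    linarith
  · have h1 := hb θ₀ hm.interior y j k
    have h2 : 0 ≤ c * |H y| := by positivity
    linarith

/-- The second-order Taylor remainders at `θ₀` are dominated by `ρ k y * ‖h‖ ^ 2` near `θ₀`, where
`ρ k` has arbitrarily small mean. -/
theorem exists_taylor_envelope (hm : RegularModel μ f Θ B θ₀) :
    ∃ (ρ : ℕ → 𝓨 → ℝ) (δ : ℕ → ℝ), (∀ k, 0 < δ k) ∧
      (∀ k, Integrable (ρ k) (modelLaw μ f θ₀)) ∧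
      Tendsto (fun k => ∫ y, ρ k y ∂modelLaw μ f θ₀) atTop (𝓝 0) ∧
      (∀ k, Metric.ball θ₀ (δ k) ⊆ _root_.interior B) ∧
      ∀ k y h, ‖h‖ < δ k → |taylorRemainder f θ₀ y h| ≤ ρ k y * ‖h‖ ^ 2 := by
  obtain ⟨δ₀, hδ₀, hball⟩ := Metric.isOpen_iff.1 isOpen_interior θ₀ hm.interior
  obtain ⟨G, hGi, hG0, hG, -⟩ := hm.exists_fderiv_score_bound
  have := hm.isProbabilityMeasure
  let d : ℕ → Param r q := TopologicalSpace.denseSeq _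
  let δ : ℕ → ℝ := fun k => δ₀ * (1 / ((k : ℝ) + 1))
  have hδpos : ∀ k, 0 < δ k := fun k => by positivity
  have hδle : ∀ k, δ k ≤ δ₀ := fun k => by
    have : 1 / ((k : ℝ) + 1) ≤ 1 := by
      rw [div_le_one (by positivity)]
      linarith [(Nat.cast_nonneg k : (0 : ℝ) ≤ k)]
    nlinarith
  have hδ0 : Tendsto δ atTop (𝓝 0) := by
    simpa [δ] using (tendsto_one_div_add_atTop_nhds_zero_nat (𝕜 := ℝ)).const_mul δ₀
  -- The envelope is a supremum of |remainder|/‖h‖² over a countable dense set of h, hence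
  -- measurable; continuity in h recovers all h with ‖h‖ < δ k at the end.
  let a : ℕ → 𝓨 → ℕ → ℝ := fun k y n =>
    if ‖d n‖ < δ k then |taylorRemainder f θ₀ y (d n)| / ‖d n‖ ^ 2 else 0
  have ha0 : ∀ k y n, 0 ≤ a k y n := by
    intro k y n
    simp only [a]
    split_ifs
    · positivity
    · exact le_rfl
  have haC : ∀ k y n C, 0 ≤ C → (∀ t ∈ Metric.ball θ₀ (δ k), ‖fderiv ℝ (fun t => score f t y) t -
      fderiv ℝ (fun t => score f t y) θ₀‖ ≤ C) → a k y n ≤ C / 2 := by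
    intro k y n C hC hb
    simp only [a]
    split_ifs with hn
    · have h1 := abs_taylorRemainder_le isOpen_interior (hm.contDiffOn_log y)
        ((Metric.ball_subset_ball (hδle k)).trans hball) hn hb
      by_cases h0 : ‖d n‖ = 0
      · rw [h0]; simp; linarith
      · rwa [div_le_iff₀ (by positivity)]
    · positivity
  have hGb : ∀ k y, ∀ t ∈ Metric.ball θ₀ (δ k), ‖fderiv ℝ (fun t => score f t y) t -
      fderiv ℝ (fun t => score f t y) θ₀‖ ≤ 2 * G y := by
    intro k y t ht
    have h1 := hG y t (hball (Metric.ball_subset_ball (hδle k) ht))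
    have h2 := hG y θ₀ hm.interior
    exact (norm_sub_le _ _).trans (by linarith)
  have haG : ∀ k y n, a k y n ≤ G y := by
    intro k y n
    have := haC k y n (2 * G y) (by linarith [hG0 y]) (hGb k y)
    linarith
  have hbdd : ∀ k y, BddAbove (Set.range (a k y)) := fun k y =>
    ⟨G y, by rintro _ ⟨n, rfl⟩; exact haG k y n⟩
  let ρ : ℕ → 𝓨 → ℝ := fun k y => ⨆ n, a k y n
  have hρ0 : ∀ k y, 0 ≤ ρ k y := fun k y => (ha0 k y 0).trans (le_ciSup (hbdd k y) 0)
  have hρG : ∀ k y, ρ k y ≤ G y := fun k y => ciSup_le (haG k y)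
  have hρm : ∀ k, Measurable (ρ k) := by
    intro k
    refine Measurable.iSup fun n => ?_
    simp only [a]
    split_ifs with hn
    · refine (Measurable.abs ?_).div_const _
      exact hm.measurable_taylorRemainder (hm.subset (interior_subset (hball
        (by simpa using lt_of_lt_of_le hn (hδle k)))))
    · exact measurable_const
  have hρb : ∀ k, ∀ᵐ y ∂modelLaw μ f θ₀, ‖ρ k y‖ ≤ G y := fun k =>
    Eventually.of_forall fun y => by
      rw [Real.norm_eq_abs, abs_of_nonneg (hρ0 k y)]; exact hρG k y
  refine ⟨ρ, δ, hδpos, fun k => hGi.mono' (hρm k).aestronglyMeasurable (hρb k), ?_,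
    fun k => (Metric.ball_subset_ball (hδle k)).trans hball, ?_⟩
  -- Continuity of the second derivative at θ₀ makes the envelope vanish pointwise as the balls
  -- shrink, and the integrable bound G carries this to the means.
  · have hlim : ∀ y, Tendsto (fun k => ρ k y) atTop (𝓝 0) := by
      intro y
      have hcont : ContinuousAt (fun θ => fderiv ℝ (fun t => score f t y) θ) θ₀ :=
        (continuousOn_fderiv_score isOpen_interior (hm.contDiffOn_log y)).continuousAt
          (isOpen_interior.mem_nhds hm.interior)
      rw [Metric.tendsto_atTop]
      intro ε hε
      obtain ⟨η, hη, hη'⟩ := Metric.continuousAt_iff.1 hcont ε hε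
      obtain ⟨K, hK⟩ := eventually_atTop.1 (hδ0.eventually (gt_mem_nhds hη))
      refine ⟨K, fun k hk => ?_⟩
      rw [dist_zero_right, Real.norm_eq_abs, abs_of_nonneg (hρ0 k y)]
      have h1 : ρ k y ≤ ε / 2 := ciSup_le fun n => haC k y n ε hε.le fun t ht => by
        have := hη' ((Metric.mem_ball.1 ht).trans (hK k hk))
        rw [dist_eq_norm] at this
        exact this.le
      linarith
    have := tendsto_integral_of_dominated_convergence G
      (fun k => (hρm k).aestronglyMeasurable) hGi hρb
      (Eventually.of_forall hlim)
    simpa using this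
  · intro k y h hh
    -- A violation at h persists on an open set, hence at a member of the dense sequence, against
    -- the definition of the supremum.
    by_contra hcon
    rw [not_le] at hcon
    let O : Set (Param r q) := {h | ‖h‖ < δ k ∧ ρ k y * ‖h‖ ^ 2 < |taylorRemainder f θ₀ y h|}
    have hcont : ContinuousOn (fun h => |taylorRemainder f θ₀ y h| - ρ k y * ‖h‖ ^ 2)
        (Metric.ball 0 (δ k)) := by
      have h1 : ContinuousOn (fun h => Real.log (f y (θ₀ + h))) (Metric.ball 0 (δ k)) := by
        refine (hm.continuousOn_log y).comp (by fun_prop) fun h hh => ?_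
        refine interior_subset (hball ?_)
        rw [Metric.mem_ball, dist_eq_norm, add_sub_cancel_left]
        rw [Metric.mem_ball, dist_zero_right] at hh
        exact hh.trans_le (hδle k)
      have h2 : Continuous fun h : Param r q => h ⬝ᵥ (obsInfo f θ₀ y *ᵥ h) / 2 := by
        unfold dotProduct mulVec dotProduct
        fun_prop
      unfold taylorRemainder
      refine (ContinuousOn.abs ?_).sub (by fun_prop)
      exact ((h1.sub continuousOn_const).sub (by fun_prop)).add h2.continuousOn
    have hO : IsOpen O := by
      have h1 := hcont.isOpen_inter_preimage Metric.isOpen_ball isOpen_Ioi (t := Set.Ioi 0)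
      convert h1 using 1
      ext h
      simp [O]
    obtain ⟨n, hn⟩ := (TopologicalSpace.denseRange_denseSeq (Param r q)).exists_mem_open hO
      ⟨h, hh, hcon⟩
    have hn' : ‖d n‖ < δ k ∧ ρ k y * ‖d n‖ ^ 2 < |taylorRemainder f θ₀ y (d n)| := hn
    have h1 : a k y n ≤ ρ k y := le_ciSup (hbdd k y) n
    simp only [a, hn'.1, if_true] at h1
    by_cases h0 : d n = 0
    · rw [h0, taylorRemainder_zero] at hn'
      simp at hn'
    · have h3 : 0 < ‖d n‖ ^ 2 := by positivity
      rw [div_le_iff₀ h3] at h1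
      linarith [hn'.2]

theorem integrable_norm_score_pow (hm : RegularModel μ f Θ B θ₀) {k : ℕ} (hk : k ≤ 6) :
    Integrable (fun y => ‖score f θ₀ y‖ ^ k) (modelLaw μ f θ₀) := by
  obtain ⟨K, hK⟩ := hm.score_moment
  have := hm.isProbabilityMeasure
  have h6 := (hK θ₀ hm.interior).1
  refine ((integrable_const (1 : ℝ)).add h6).mono'
    ((hm.measurable_score hm.interior).norm.pow_const k).aestronglyMeasurable
    (Eventually.of_forall fun y => ?_)
  rw [Real.norm_eq_abs, abs_of_nonneg (by positivity)]
  have h0 := norm_nonneg (score f θ₀ y)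
  simp only [Pi.add_apply]
  rcases le_total ‖score f θ₀ y‖ 1 with h | h
  · have := pow_le_one₀ h0 h (n := k)
    have : 0 ≤ ‖score f θ₀ y‖ ^ 6 := by positivity
    linarith
  · have := pow_le_pow_right₀ h hk
    linarith

theorem integrable_score_apply (hm : RegularModel μ f Θ B θ₀) (j : Fin r ⊕ Fin q) :
    Integrable (fun y => score f θ₀ y j) (modelLaw μ f θ₀) := by
  refine (hm.integrable_norm_score_pow (k := 1) (by norm_num)).mono'
    (hm.measurable_score_apply hm.interior j).aestronglyMeasurable
    (Eventually.of_forall fun y => ?_)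
  rw [pow_one]
  exact abs_apply_le_norm _ j

theorem integrable_obsInfo (hm : RegularModel μ f Θ B θ₀) (j k : Fin r ⊕ Fin q) :
    Integrable (fun y => obsInfo f θ₀ y j k) (modelLaw μ f θ₀) := by
  obtain ⟨G, hGi, -, -, hG⟩ := hm.exists_fderiv_score_bound
  exact hGi.mono' (hm.measurable_obsInfo hm.interior j k).aestronglyMeasurable
    (Eventually.of_forall fun y => hG y j k)

/-- The log-likelihood is Lipschitz on `B` with an integrable constant. -/
theorem exists_lipschitz_envelope (hm : RegularModel μ f Θ B θ₀) :
    ∃ L : 𝓨 → ℝ, Integrable L (modelLaw μ f θ₀) ∧ (∀ y, 0 ≤ L y) ∧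
      ∀ y, ∀ θ ∈ B, ∀ θ' ∈ B,
        |Real.log (f y θ) - Real.log (f y θ')| ≤ L y * ‖θ - θ'‖ := by
  obtain ⟨G, hGi, hG0, hG, -⟩ := hm.exists_fderiv_score_bound
  obtain ⟨D, hD⟩ := hm.compact.isBounded.exists_norm_le
  have hD0 : 0 ≤ D := (norm_nonneg _).trans (hD θ₀ (interior_subset hm.interior))
  have hS := hm.integrable_norm_score_pow (k := 1) (by norm_num)
  simp only [pow_one] at hS
  have hL0 : ∀ y, 0 ≤ ‖score f θ₀ y‖ + G y * (2 * D) := fun y => by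
    have := hG0 y
    positivity
  refine ⟨fun y => ‖score f θ₀ y‖ + G y * (2 * D), hS.add (hGi.mul_const _), hL0, fun y => ?_⟩
  have hconv : Convex ℝ (_root_.interior B) := hm.convex.interior
  have hlip : LipschitzOnWith (Real.toNNReal (‖score f θ₀ y‖ + G y * (2 * D)))
      (fun t => Real.log (f y t)) (_root_.interior B) := by
    refine hconv.lipschitzOnWith_of_nnnorm_fderiv_le (𝕜 := ℝ)
      (fun θ hθ => (hm.hasFDerivAt_log y hθ).differentiableAt) fun θ hθ => ?_
    rw [← NNReal.coe_le_coe, Real.coe_toNNReal _ (hL0 y), coe_nnnorm,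
      (hm.hasFDerivAt_log y hθ).fderiv, innerSL_apply_norm]
    have h1 := hconv.norm_image_sub_le_of_norm_fderiv_le (𝕜 := ℝ)
      (fun t ht => differentiableAt_score isOpen_interior (hm.contDiffOn_log y) ht)
      (hG y) hm.interior hθ
    have h2 : ‖θ - θ₀‖ ≤ 2 * D := by
      have := hD θ (interior_subset hθ)
      have := hD θ₀ (interior_subset hm.interior)
      exact (norm_sub_le _ _).trans (by linarith)
    have h3 : ‖score f θ y‖ ≤ ‖score f θ₀ y‖ + ‖score f θ y - score f θ₀ y‖ := by
      simpa using norm_add_le (score f θ₀ y) (score f θ y - score f θ₀ y)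
    have h4 := mul_le_mul_of_nonneg_left h2 (hG0 y)
    linarith
  -- The derivative bound gives a Lipschitz estimate on the interior only. A closed convex set with
  -- nonempty interior is the closure of that interior, so continuity extends the estimate to the
  -- boundary.
  have hcl : closure (_root_.interior B) = B := by
    rw [hm.convex.closure_interior_eq_closure_of_nonempty_interior ⟨θ₀, hm.interior⟩,
      hm.compact.isClosed.closure_eq]
  have hlip' := LipschitzOnWith.closure (by rw [hcl]; exact hm.continuousOn_log y) hlip
  rw [hcl] at hlip'
  intro θ hθ θ' hθ'
  have := hlip'.dist_le_mul θ hθ θ' hθ'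
  rwa [Real.dist_eq, dist_eq_norm, Real.coe_toNNReal _ (hL0 y)] at this

theorem integrable_log_sub (hm : RegularModel μ f Θ B θ₀) (hθ : θ ∈ B) :
    Integrable (fun y => Real.log (f y θ) - Real.log (f y θ₀)) (modelLaw μ f θ₀) := by
  obtain ⟨L, hL, -, hL'⟩ := hm.exists_lipschitz_envelope
  exact (hL.mul_const ‖θ - θ₀‖).mono'
    ((hm.measurable_log (hm.subset hθ)).sub (hm.measurable_log hm.mem_param)).aestronglyMeasurable
    (Eventually.of_forall fun y => hL' y θ hθ θ₀ (interior_subset hm.interior))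

/-- The Kullback–Leibler divergence is nonnegative, and positive away from `θ₀`. -/
theorem integral_log_sub_le (hm : RegularModel μ f Θ B θ₀) (hθ : θ ∈ B) :
    ∫ y, (Real.log (f y θ) - Real.log (f y θ₀)) ∂modelLaw μ f θ₀ ≤ 0 ∧
    (θ ≠ θ₀ → ∫ y, (Real.log (f y θ) - Real.log (f y θ₀)) ∂modelLaw μ f θ₀ < 0) := by
  have := hm.isProbabilityMeasure
  have hθΘ := hm.subset hθ
  have hm₀ := hm.density_measurable θ₀ hm.mem_param
  have hm₁ := hm.density_measurable θ hθΘ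
  have hgpos : ∀ y, 0 < f y θ / f y θ₀ := fun y =>
    div_pos (hm.density_pos y θ hθΘ) (hm.density_pos y θ₀ hm.mem_param)
  have hgm : Measurable fun y => f y θ / f y θ₀ := hm₁.div hm₀
  -- The likelihood ratio has mean one under θ₀, so log x ≤ x − 1 gives Gibbs' inequality. Equality
  -- forces the ratio to be 1 almost surely, hence equal laws, and identifiability applies.
  have hglin : ∫⁻ y, ENNReal.ofReal (f y θ / f y θ₀) ∂modelLaw μ f θ₀ = 1 := by
    rw [modelLaw, lintegral_withDensity_eq_lintegral_mul _ hm₀.ennreal_ofReal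
      hgm.ennreal_ofReal, ← hm.density_lintegral θ hθΘ]
    congr 1
    ext y
    have hp := hm.density_pos y θ₀ hm.mem_param
    rw [Pi.mul_apply, ← ENNReal.ofReal_mul hp.le, mul_div_cancel₀ _ hp.ne']
  have hgi : Integrable (fun y => f y θ / f y θ₀) (modelLaw μ f θ₀) := by
    refine ⟨hgm.aestronglyMeasurable, ?_⟩
    rw [hasFiniteIntegral_iff_ofReal (Eventually.of_forall fun y => (hgpos y).le), hglin]
    exact ENNReal.one_lt_top
  have hgint : ∫ y, f y θ / f y θ₀ ∂modelLaw μ f θ₀ = 1 := by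
    rw [integral_eq_lintegral_of_nonneg_ae (Eventually.of_forall fun y => (hgpos y).le)
      hgi.aestronglyMeasurable, hglin, ENNReal.toReal_one]
  have hlog : ∀ y, Real.log (f y θ) - Real.log (f y θ₀) = Real.log (f y θ / f y θ₀) := fun y =>
    (Real.log_div (hm.density_pos y θ hθΘ).ne' (hm.density_pos y θ₀ hm.mem_param).ne').symm
  have hli := hm.integrable_log_sub hθ
  have hnn : ∀ y, 0 ≤ f y θ / f y θ₀ - 1 - (Real.log (f y θ) - Real.log (f y θ₀)) := fun y => by
    rw [hlog]; linarith [Real.log_le_sub_one_of_pos (hgpos y)]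
  have hgi1 : Integrable (fun y => f y θ / f y θ₀ - 1) (modelLaw μ f θ₀) :=
    hgi.sub (integrable_const _)
  have hint : ∫ y, (f y θ / f y θ₀ - 1 - (Real.log (f y θ) - Real.log (f y θ₀)))
      ∂modelLaw μ f θ₀ =
      - ∫ y, (Real.log (f y θ) - Real.log (f y θ₀)) ∂modelLaw μ f θ₀ := by
    rw [integral_sub hgi1 hli, integral_sub hgi (integrable_const _),
      hgint]
    simp
  have hle : ∫ y, (Real.log (f y θ) - Real.log (f y θ₀)) ∂modelLaw μ f θ₀ ≤ 0 := by
    have := integral_nonneg_of_ae (μ := modelLaw μ f θ₀) (Eventually.of_forall hnn)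
    rw [hint] at this
    linarith
  refine ⟨hle, fun hne => lt_of_le_of_ne hle fun h0 => hne ?_⟩
  rw [h0, neg_zero, integral_eq_zero_iff_of_nonneg hnn
    (hgi1.sub hli)] at hint
  apply hm.identifiable θ hθΘ
  have h1 : ∀ᵐ y ∂modelLaw μ f θ₀, f y θ = f y θ₀ := by
    filter_upwards [hint] with y hy
    by_contra hne
    have hg1 : f y θ / f y θ₀ ≠ 1 := fun h =>
      hne ((div_eq_one_iff_eq (hm.density_pos y θ₀ hm.mem_param).ne').1 h)
    have := Real.log_lt_sub_one_of_pos (hgpos y) hg1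
    rw [hlog, Pi.zero_apply] at hy
    linarith
  rw [modelLaw, ae_withDensity_iff hm₀.ennreal_ofReal] at h1
  refine withDensity_congr_ae ?_
  filter_upwards [h1] with y hy
  rw [hy (ENNReal.ofReal_pos.2 (hm.density_pos y θ₀ hm.mem_param)).ne']

theorem integral_inner_score (hm : RegularModel μ f Θ B θ₀) (h : Param r q) :
    Integrable (fun y => ⟪score f θ₀ y, h⟫) (modelLaw μ f θ₀) ∧
    ∫ y, ⟪score f θ₀ y, h⟫ ∂modelLaw μ f θ₀ =
      ∑ j, h j * ∫ y, score f θ₀ y j ∂modelLaw μ f θ₀ := by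
  have h1 : ∀ y, ⟪score f θ₀ y, h⟫ = ∑ j, h j * score f θ₀ y j := fun y => by
    rw [inner_eq_dotProduct, dotProduct]
    exact Finset.sum_congr rfl fun j _ => mul_comm _ _
  simp only [h1]
  refine ⟨integrable_finsetSum _ fun j _ => (hm.integrable_score_apply j).const_mul _, ?_⟩
  rw [integral_finsetSum _ fun j _ => (hm.integrable_score_apply j).const_mul _]
  simp only [integral_const_mul]

theorem integral_obsInfo_form (hm : RegularModel μ f Θ B θ₀) (h : Param r q) :
    Integrable (fun y => h ⬝ᵥ (obsInfo f θ₀ y *ᵥ h)) (modelLaw μ f θ₀) ∧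
    ∫ y, h ⬝ᵥ (obsInfo f θ₀ y *ᵥ h) ∂modelLaw μ f θ₀ = h ⬝ᵥ (info μ f θ₀ θ₀ *ᵥ h) := by
  unfold dotProduct mulVec dotProduct info
  have hi : ∀ j k, Integrable (fun y => obsInfo f θ₀ y j k * h k) (modelLaw μ f θ₀) :=
    fun j k => (hm.integrable_obsInfo j k).mul_const _
  have hi2 : ∀ j, Integrable (fun y => h j * ∑ k, obsInfo f θ₀ y j k * h k) (modelLaw μ f θ₀) :=
    fun j => (integrable_finsetSum _ fun k _ => hi j k).const_mul _
  refine ⟨integrable_finsetSum _ fun j _ => hi2 j, ?_⟩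
  rw [integral_finsetSum _ fun j _ => hi2 j]
  refine Finset.sum_congr rfl fun j _ => ?_
  rw [integral_const_mul, integral_finsetSum _ fun k _ => hi j k]
  simp only [integral_mul_const]

/-- The mean log-likelihood ratio is at most 0 on B, and its second-order expansion is in error by
at most the mean envelope times ‖h‖². Unbiasedness of the score and positivity of the information
both come from this inequality, without differentiating ∫ f dμ under the integral sign. -/
theorem expectation_expansion (hm : RegularModel μ f Θ B θ₀) :
    ∃ (rk δ : ℕ → ℝ), (∀ k, 0 < δ k) ∧ Tendsto rk atTop (𝓝 0) ∧ ∀ k (h : Param r q), ‖h‖ < δ k →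
      ∑ j, h j * (∫ y, score f θ₀ y j ∂modelLaw μ f θ₀) - h ⬝ᵥ (info μ f θ₀ θ₀ *ᵥ h) / 2 -
        rk k * ‖h‖ ^ 2 ≤ 0 := by
  obtain ⟨ρ, δ, hδ, hρi, hρ0, hball, hρ⟩ := hm.exists_taylor_envelope
  refine ⟨fun k => ∫ y, ρ k y ∂modelLaw μ f θ₀, δ, hδ, hρ0, fun k h hh => ?_⟩
  have hmem : θ₀ + h ∈ B := interior_subset (hball k (by simpa using hh))
  obtain ⟨hi1, he1⟩ := hm.integral_inner_score h
  obtain ⟨hi2, he2⟩ := hm.integral_obsInfo_form h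
  have hM := (hm.integral_log_sub_le hmem).1
  have hi3 : Integrable (fun y => ⟪score f θ₀ y, h⟫ - h ⬝ᵥ (obsInfo f θ₀ y *ᵥ h) / 2)
    (modelLaw μ f θ₀) := hi1.sub (hi2.div_const 2)
  rw [← he1, ← he2, ← integral_div, ← integral_mul_const,
    ← integral_sub hi1 (hi2.div_const 2), ← integral_sub hi3 ((hρi k).mul_const _)]
  refine le_trans (integral_mono (hi3.sub ((hρi k).mul_const _))
    (hm.integrable_log_sub hmem) fun y => ?_) hM
  have h1 := (abs_le.1 (hρ k y h hh)).1
  unfold taylorRemainder at h1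
  beta_reduce
  linarith

/-- Along t·h, division by t and t ↓ 0 leave only the linear term, which is thus at most 0 for h and
for −h. The rest is quadratic in t; cancelling t² and letting the mean envelope tend to 0 leaves the
sign of the quadratic form. -/
theorem linear_form_zero (hm : RegularModel μ f Θ B θ₀) (h : Param r q) :
    ∑ j, h j * (∫ y, score f θ₀ y j ∂modelLaw μ f θ₀) ≤ 0 ∧ 0 ≤ h ⬝ᵥ (info μ f θ₀ θ₀ *ᵥ h) := by
  have key : ∀ h : Param r q, ∑ j, h j * (∫ y, score f θ₀ y j ∂modelLaw μ f θ₀) ≤ 0 := by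
    obtain ⟨rk, δ, hδ, -, hexp⟩ := hm.expectation_expansion
    intro h
    set a := ∑ j, h j * (∫ y, score f θ₀ y j ∂modelLaw μ f θ₀) with ha
    set b := h ⬝ᵥ (info μ f θ₀ θ₀ *ᵥ h) with hb
    have hev : ∀ᶠ t : ℝ in 𝓝[>] 0, a ≤ t * (b / 2 + rk 0 * ‖h‖ ^ 2) := by
      have h1 : ∀ᶠ t : ℝ in 𝓝[>] 0, t * ‖h‖ < δ 0 := by
        have : Tendsto (fun t : ℝ => t * ‖h‖) (𝓝[>] 0) (𝓝 (0 * ‖h‖)) :=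
          (tendsto_id.mul_const _).mono_left nhdsWithin_le_nhds
        rw [zero_mul] at this
        exact this.eventually (gt_mem_nhds (hδ 0))
      filter_upwards [h1, self_mem_nhdsWithin] with t ht (ht0 : 0 < t)
      have h2 := hexp 0 (t • h) (by rw [norm_smul, Real.norm_eq_abs, abs_of_pos ht0]; exact ht)
      have h3 : ∑ j, (t • h) j * (∫ y, score f θ₀ y j ∂modelLaw μ f θ₀) = t * a := by
        rw [ha, Finset.mul_sum]
        refine Finset.sum_congr rfl fun j _ => ?_
        simp [mul_assoc]
      have h4 : (t • h : Param r q) ⬝ᵥ (info μ f θ₀ θ₀ *ᵥ (t • h : Param r q)) = t ^ 2 * b := by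
        rw [WithLp.ofLp_smul, mulVec_smul, smul_dotProduct, dotProduct_smul, hb, smul_eq_mul,
          smul_eq_mul]
        ring
      rw [h3, h4, norm_smul, Real.norm_eq_abs, mul_pow, sq_abs] at h2
      have h5 : t * a ≤ t * (t * (b / 2 + rk 0 * ‖h‖ ^ 2)) := by nlinarith
      exact le_of_mul_le_mul_left h5 ht0
    have hlim : Tendsto (fun t : ℝ => t * (b / 2 + rk 0 * ‖h‖ ^ 2)) (𝓝[>] 0) (𝓝 0) := by
      have : Tendsto (fun t : ℝ => t * (b / 2 + rk 0 * ‖h‖ ^ 2)) (𝓝[>] 0)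
        (𝓝 (0 * (b / 2 + rk 0 * ‖h‖ ^ 2))) := (tendsto_id.mul_const _).mono_left nhdsWithin_le_nhds
      rwa [zero_mul] at this
    exact ge_of_tendsto hlim hev
  refine ⟨key h, ?_⟩
  obtain ⟨rk, δ, hδ, hrk, hexp⟩ := hm.expectation_expansion
  have ha0 : ∀ h : Param r q, ∑ j, h j * (∫ y, score f θ₀ y j ∂modelLaw μ f θ₀) = 0 := by
    intro h
    have h1 := key h
    have h2 := key (-h)
    simp only [PiLp.neg_apply, neg_mul, Finset.sum_neg_distrib] at h2
    linarith
  have hle : ∀ k, 0 ≤ h ⬝ᵥ (info μ f θ₀ θ₀ *ᵥ h) / 2 + rk k * ‖h‖ ^ 2 := by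
    intro k
    obtain ⟨t, ht0, ht⟩ : ∃ t : ℝ, 0 < t ∧ t * ‖h‖ < δ k := by
      refine ⟨δ k / (2 * (‖h‖ + 1)), by have := hδ k; positivity, ?_⟩
      rw [div_mul_eq_mul_div, div_lt_iff₀ (by positivity)]
      nlinarith [hδ k, norm_nonneg h]
    have h2 := hexp k (t • h) (by rw [norm_smul, Real.norm_eq_abs, abs_of_pos ht0]; exact ht)
    rw [ha0, WithLp.ofLp_smul, mulVec_smul, smul_dotProduct, dotProduct_smul, smul_eq_mul,
      smul_eq_mul, norm_smul, Real.norm_eq_abs, mul_pow, sq_abs] at h2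
    have h3 : 0 ≤ t ^ 2 * (h ⬝ᵥ (info μ f θ₀ θ₀ *ᵥ h) / 2 + rk k * ‖h‖ ^ 2) := by linarith
    exact nonneg_of_mul_nonneg_right h3 (by positivity)
  have hlim : Tendsto (fun k => h ⬝ᵥ (info μ f θ₀ θ₀ *ᵥ h) / 2 + rk k * ‖h‖ ^ 2) atTop
      (𝓝 (h ⬝ᵥ (info μ f θ₀ θ₀ *ᵥ h) / 2 + 0 * ‖h‖ ^ 2)) :=
    tendsto_const_nhds.add (hrk.mul_const _)
  have := ge_of_tendsto' hlim hle
  linarith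

theorem integral_score_eq_zero (hm : RegularModel μ f Θ B θ₀) (j : Fin r ⊕ Fin q) :
    ∫ y, score f θ₀ y j ∂modelLaw μ f θ₀ = 0 := by
  have h1 := (hm.linear_form_zero (EuclideanSpace.single j 1)).1
  have h2 := (hm.linear_form_zero (-EuclideanSpace.single j 1)).1
  simp only [PiLp.neg_apply, PiLp.single_apply, ite_mul, one_mul, zero_mul, neg_mul,
    Finset.sum_neg_distrib, Finset.sum_ite_eq', Finset.mem_univ, if_true] at h1 h2
  linarith

/-- The information matrix at `θ₀` is positive definite. -/
theorem info_posDef (hm : RegularModel μ f Θ B θ₀) : (info μ f θ₀ θ₀).PosDef := by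
  have hpsd : (info μ f θ₀ θ₀).PosSemidef := by
    refine PosSemidef.of_dotProduct_mulVec_nonneg ?_ fun x => ?_
    · ext j k
      simp only [conjTranspose_apply, star_trivial, info]
      congr 1
      ext y
      exact obsInfo_symm isOpen_interior (hm.contDiffOn_log y) hm.interior k j
    · simpa using (hm.linear_form_zero (WithLp.toLp 2 x)).2
  exact (hpsd.posDef_iff_isUnit).2 ((Matrix.isUnit_iff_isUnit_det _).2 hm.info_nonsingular)

end RegularModel

end ModelConsequences

/-! ### The weighted log-likelihood is a quadratic criterion -/

section WeightedCriterion

open scoped RealInnerProductSpace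
open Matrix

/-- The operator `v ↦ M v` on the Euclidean space. -/
def matrixCLM {ι : Type*} [Fintype ι] [DecidableEq ι] (M : Matrix ι ι ℝ) :
    EuclideanSpace ℝ ι →L[ℝ] EuclideanSpace ℝ ι := toEuclideanCLM (n := ι) (𝕜 := ℝ) M

theorem matrixCLM_apply {ι : Type*} [Fintype ι] [DecidableEq ι] (M : Matrix ι ι ℝ)
    (v : EuclideanSpace ℝ ι) (j : ι) : matrixCLM M v j = (M *ᵥ v) j := rfl

theorem inner_matrixCLM {ι : Type*} [Fintype ι] [DecidableEq ι] (M : Matrix ι ι ℝ)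
    (v w : EuclideanSpace ℝ ι) : ⟪v, matrixCLM M w⟫ = v ⬝ᵥ (M *ᵥ w) := by
  rw [inner_eq_dotProduct]
  rfl

theorem matrixCLM_mul {ι : Type*} [Fintype ι] [DecidableEq ι] (M M' : Matrix ι ι ℝ)
    (v : EuclideanSpace ℝ ι) : matrixCLM M (matrixCLM M' v) = matrixCLM (M * M') v := by
  ext j
  rw [matrixCLM_apply, matrixCLM_apply, ← mulVec_mulVec]
  rfl

theorem matrixCLM_one {ι : Type*} [Fintype ι] [DecidableEq ι] (v : EuclideanSpace ℝ ι) :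
    matrixCLM (1 : Matrix ι ι ℝ) v = v := by
  ext j
  rw [matrixCLM_apply, one_mulVec]

/-- The minimum of the form over the compact unit sphere serves as c; if the sphere is empty the
space is trivial. -/
theorem exists_coercive {ι : Type*} [Fintype ι] [DecidableEq ι] {M : Matrix ι ι ℝ}
    (hM : M.PosDef) : ∃ c > 0, ∀ h : EuclideanSpace ℝ ι, c * ‖h‖ ^ 2 ≤ ⟪h, matrixCLM M h⟫ := by
  have hpos : ∀ h : EuclideanSpace ℝ ι, h ≠ 0 → 0 < ⟪h, matrixCLM M h⟫ := by
    intro h hh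
    rw [inner_matrixCLM]
    have : (h : ι → ℝ) ≠ 0 := fun h0 => hh (by ext j; exact congrFun h0 j)
    simpa using hM.dotProduct_mulVec_pos this
  by_cases hne : (Metric.sphere (0 : EuclideanSpace ℝ ι) 1).Nonempty
  · obtain ⟨h₀, hh₀, hmin⟩ := (isCompact_sphere (0 : EuclideanSpace ℝ ι) 1).exists_isMinOn hne
      (f := fun h => ⟪h, matrixCLM M h⟫) (by fun_prop)
    have hn₀ : h₀ ≠ 0 := by
      rintro rfl
      simp at hh₀
    refine ⟨_, hpos h₀ hn₀, fun h => ?_⟩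
    by_cases hh : h = 0
    · simp [hh]
    · have hnorm : 0 < ‖h‖ := norm_pos_iff.2 hh
      have h1 : ⟪h₀, matrixCLM M h₀⟫ ≤ ⟪‖h‖⁻¹ • h, matrixCLM M (‖h‖⁻¹ • h)⟫ :=
        hmin (by simp [norm_smul, hnorm.ne'])
      rw [map_smul, real_inner_smul_left, real_inner_smul_right, ← mul_assoc, ← sq, inv_pow,
        inv_mul_eq_div, le_div_iff₀ (by positivity)] at h1
      exact h1
  · refine ⟨1, one_pos, fun h => ?_⟩
    have : h = 0 := by
      by_contra hh
      exact hne ⟨‖h‖⁻¹ • h, by simp [norm_smul, norm_ne_zero_iff.2 hh]⟩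
    simp [this]

theorem abs_dotProduct_mulVec_le {ι : Type*} [Fintype ι] (D : Matrix ι ι ℝ)
    (h : EuclideanSpace ℝ ι) : |h ⬝ᵥ (D *ᵥ h)| ≤ (∑ j, ∑ k, |D j k|) * ‖h‖ ^ 2 := by
  unfold dotProduct mulVec dotProduct
  rw [Finset.sum_mul]
  refine (Finset.abs_sum_le_sum_abs _ _).trans (Finset.sum_le_sum fun j _ => ?_)
  rw [Finset.mul_sum, Finset.sum_mul]
  refine (Finset.abs_sum_le_sum_abs _ _).trans (Finset.sum_le_sum fun k _ => ?_)
  rw [abs_mul, abs_mul]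
  have h1 := abs_apply_le_norm h j
  have h2 := abs_apply_le_norm h k
  calc |h j| * (|D j k| * |h k|) = |D j k| * (|h j| * |h k|) := by ring
    _ ≤ |D j k| * (‖h‖ * ‖h‖) := by gcongr
    _ = _ := by ring

variable {r q : ℕ} {𝓨 : Type*} [MeasurableSpace 𝓨]
  {μ : Measure 𝓨} {f : 𝓨 → Param r q → ℝ} {Θ B : Set (Param r q)} {θ₀ : Param r q}
  {γ : Type*} {l : Filter γ} {n : γ → ℕ} {W : ∀ x, Fin (n x) → ℝ} {yv : ∀ x, Fin (n x) → 𝓨}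

/-- The weighted averages `∑ᵢ Wᵢ g(yᵢ)` converge to the mean of `g` for every integrable `g`. -/
def WeightedLLN (ν₀ : Measure 𝓨) (l : Filter γ) (W : ∀ x, Fin (n x) → ℝ)
    (yv : ∀ x, Fin (n x) → 𝓨) : Prop :=
  ∀ g : 𝓨 → ℝ, Integrable g ν₀ →
    Tendsto (fun x => ∑ i, W x i * g (yv x i)) l (𝓝 (∫ y, g y ∂ν₀))

namespace RegularModel

theorem tendsto_weighted_score (hm : RegularModel μ f Θ B θ₀)
    (hL : WeightedLLN (modelLaw μ f θ₀) l W yv) (j : Fin r ⊕ Fin q) :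
    Tendsto (fun x => (∑ i, W x i • score f θ₀ (yv x i)) j) l (𝓝 0) := by
  have h := hL _ (hm.integrable_score_apply j)
  rw [hm.integral_score_eq_zero] at h
  refine h.congr fun x => ?_
  simp [WithLp.ofLp_sum, Finset.sum_apply]

theorem tendsto_norm_weighted_score (hm : RegularModel μ f Θ B θ₀)
    (hL : WeightedLLN (modelLaw μ f θ₀) l W yv) :
    Tendsto (fun x => ‖∑ i, W x i • score f θ₀ (yv x i)‖) l (𝓝 0) := by
  refine squeeze_zero (fun x => norm_nonneg _) (fun x => norm_le_sum_abs _) ?_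
  have := tendsto_finsetSum (Finset.univ : Finset (Fin r ⊕ Fin q)) fun j _ =>
    (hm.tendsto_weighted_score hL j).abs
  simpa using this

/-- There are two errors: the averaged Taylor remainders, dominated by the average of an envelope of
mean below ε/4, and the deviation of the averaged observed information from 𝓘(θ₀). Each is ‖h‖²
times a quantity free of h, whence the uniformity. -/
theorem weighted_expansion (hm : RegularModel μ f Θ B θ₀) (hW : ∀ x i, 0 ≤ W x i)
    (hL : WeightedLLN (modelLaw μ f θ₀) l W yv) {ε : ℝ} (hε : 0 < ε) :
    ∃ δ > 0, ∀ᶠ x in l, ∀ h : Param r q, ‖h‖ ≤ δ →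
      |∑ i, W x i * Real.log (f (yv x i) (θ₀ + h)) - ∑ i, W x i * Real.log (f (yv x i) θ₀) -
        quadApprox (matrixCLM (info μ f θ₀ θ₀)) (∑ i, W x i • score f θ₀ (yv x i)) h| ≤
        ε * ‖h‖ ^ 2 := by
  obtain ⟨ρ, δ, hδ, hρi, hρ0, -, hρ⟩ := hm.exists_taylor_envelope
  obtain ⟨k, hk⟩ := (hρ0.eventually (gt_mem_nhds (show 0 < ε / 4 by positivity))).exists
  refine ⟨δ k / 2, half_pos (hδ k), ?_⟩
  have h1 : ∀ᶠ x in l, ∑ i, W x i * ρ k (yv x i) < ε / 2 :=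
    (hL _ (hρi k)).eventually (gt_mem_nhds (by linarith))
  have h2 : Tendsto (fun x => ∑ j, ∑ k, |∑ i, W x i * obsInfo f θ₀ (yv x i) j k -
      info μ f θ₀ θ₀ j k|) l (𝓝 0) := by
    have : Tendsto (fun x => ∑ j, ∑ k, |∑ i, W x i * obsInfo f θ₀ (yv x i) j k -
      info μ f θ₀ θ₀ j k|) l (𝓝 (∑ _j : Fin r ⊕ Fin q, ∑ _k : Fin r ⊕ Fin q, |(0 : ℝ)|)) := by
      refine tendsto_finsetSum _ fun j _ => tendsto_finsetSum _ fun k _ => Tendsto.abs ?_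
      have := (hL _ (hm.integrable_obsInfo j k)).sub_const (info μ f θ₀ θ₀ j k)
      rwa [show ∫ y, obsInfo f θ₀ y j k ∂modelLaw μ f θ₀ = info μ f θ₀ θ₀ j k from rfl,
        sub_self] at this
    simpa using this
  filter_upwards [h1, h2.eventually (gt_mem_nhds (show (0 : ℝ) < ε by positivity))]
    with x hx1 hx2 h hh
  have hh' : ‖h‖ < δ k := lt_of_le_of_lt hh (half_lt_self (hδ k))
  let D : Matrix (Fin r ⊕ Fin q) (Fin r ⊕ Fin q) ℝ := fun j k =>
    ∑ i, W x i * obsInfo f θ₀ (yv x i) j k - info μ f θ₀ θ₀ j k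
  have hform : ∑ i, W x i * (h ⬝ᵥ (obsInfo f θ₀ (yv x i) *ᵥ h)) =
      h ⬝ᵥ (info μ f θ₀ θ₀ *ᵥ h) + h ⬝ᵥ (D *ᵥ h) := by
    rw [← dotProduct_add, ← add_mulVec]
    have : info μ f θ₀ θ₀ + D = ∑ i, W x i • obsInfo f θ₀ (yv x i) := by
      ext j k
      rw [Matrix.sum_apply]
      change info μ f θ₀ θ₀ j k + D j k = _
      simp only [D, Matrix.smul_apply, smul_eq_mul]
      abel
    rw [this, Matrix.sum_mulVec, dotProduct_sum]
    refine Finset.sum_congr rfl fun i _ => ?_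
    rw [smul_mulVec, dotProduct_smul, smul_eq_mul]
  have hid : ∑ i, W x i * Real.log (f (yv x i) (θ₀ + h)) -
      ∑ i, W x i * Real.log (f (yv x i) θ₀) -
        quadApprox (matrixCLM (info μ f θ₀ θ₀)) (∑ i, W x i • score f θ₀ (yv x i)) h =
      ∑ i, W x i * taylorRemainder f θ₀ (yv x i) h - (h ⬝ᵥ (D *ᵥ h)) / 2 := by
    have h3 : ∑ i, W x i * taylorRemainder f θ₀ (yv x i) h =
        ∑ i, W x i * Real.log (f (yv x i) (θ₀ + h)) - ∑ i, W x i * Real.log (f (yv x i) θ₀) -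
        ⟪∑ i, W x i • score f θ₀ (yv x i), h⟫ +
        (∑ i, W x i * (h ⬝ᵥ (obsInfo f θ₀ (yv x i) *ᵥ h))) / 2 := by
      rw [sum_inner, ← Finset.sum_sub_distrib, ← Finset.sum_sub_distrib, Finset.sum_div,
        ← Finset.sum_add_distrib]
      refine Finset.sum_congr rfl fun i _ => ?_
      rw [real_inner_smul_left, taylorRemainder]
      ring
    rw [h3, hform, quadApprox, inner_matrixCLM]
    ring
  rw [hid]
  have h4 : |∑ i, W x i * taylorRemainder f θ₀ (yv x i) h| ≤ ε / 2 * ‖h‖ ^ 2 := by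
    refine (Finset.abs_sum_le_sum_abs _ _).trans ?_
    calc ∑ i, |W x i * taylorRemainder f θ₀ (yv x i) h|
        ≤ ∑ i, W x i * ρ k (yv x i) * ‖h‖ ^ 2 := by
          refine Finset.sum_le_sum fun i _ => ?_
          rw [abs_mul, abs_of_nonneg (hW x i), mul_assoc]
          exact mul_le_mul_of_nonneg_left (hρ k _ h hh') (hW x i)
      _ ≤ _ := by
          rw [← Finset.sum_mul]
          gcongr
  have h5 : |h ⬝ᵥ (D *ᵥ h) / 2| ≤ ε / 2 * ‖h‖ ^ 2 := by
    rw [abs_div, abs_two]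
    have h6 := abs_dotProduct_mulVec_le D h
    have h7 : (∑ j, ∑ k, |D j k|) * ‖h‖ ^ 2 ≤ ε * ‖h‖ ^ 2 := by
      gcongr
    linarith
  refine (abs_sub _ _).trans ?_
  linarith

/-- On the sphere of radius η = min(ε, δ) the quadratic expansion puts the criterion at least cη²/4
below its value at θ₀; concavity along the segment from θ₀ to θ propagates this drop outwards. -/
theorem weighted_separated_of_concave (hm : RegularModel μ f Θ B θ₀) (hW : ∀ x i, 0 ≤ W x i)
    (hL : WeightedLLN (modelLaw μ f θ₀) l W yv)
    (hconc : ∀ y, ConcaveOn ℝ Θ fun θ => Real.log (f y θ)) {ε : ℝ} (hε : 0 < ε) :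
    ∃ c > 0, ∀ᶠ x in l, ∀ θ ∈ Θ, ε ≤ ‖θ - θ₀‖ →
      ∑ i, W x i * Real.log (f (yv x i) θ) - ∑ i, W x i * Real.log (f (yv x i) θ₀) ≤ -c := by
  obtain ⟨c, hc, hcoer⟩ := exists_coercive hm.info_posDef
  obtain ⟨δ, hδ, hexp⟩ := hm.weighted_expansion hW hL (show 0 < c / 8 by positivity)
  set η := min ε δ
  have hη : 0 < η := lt_min hε hδ
  refine ⟨c / 4 * η ^ 2, by positivity, ?_⟩
  filter_upwards [hexp, (hm.tendsto_norm_weighted_score hL).eventually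
    (gt_mem_nhds (show 0 < c * η / 8 by positivity))] with x hx1 hx2 θ hθ hd
  set ℓ : Param r q → ℝ := fun θ => ∑ i, W x i * Real.log (f (yv x i) θ) with hℓ
  have := hm.isProbabilityMeasure
  obtain ⟨y₁⟩ := nonempty_of_isProbabilityMeasure (modelLaw μ f θ₀)
  have hℓc : ConcaveOn ℝ Θ ℓ := by
    refine ⟨(hconc y₁).1, fun θ₁ h₁ θ₂ h₂ a b ha hb hab => ?_⟩
    simp only [hℓ, smul_eq_mul, Finset.mul_sum, ← Finset.sum_add_distrib]
    refine Finset.sum_le_sum fun i _ => ?_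
    have := mul_le_mul_of_nonneg_left ((hconc (yv x i)).2 h₁ h₂ ha hb hab) (hW x i)
    simp only [smul_eq_mul] at this
    linarith
  have hd0 : 0 < ‖θ - θ₀‖ := lt_of_lt_of_le hε hd
  set a := η / ‖θ - θ₀‖ with ha
  have ha0 : 0 < a := by positivity
  have ha1 : a ≤ 1 := by
    rw [ha, div_le_one hd0]
    exact (min_le_left _ _).trans hd
  have hnorm : ‖a • (θ - θ₀)‖ = η := by
    rw [norm_smul, Real.norm_eq_abs, abs_of_pos ha0, ha, div_mul_cancel₀ _ hd0.ne']
  have h1 := hx1 (a • (θ - θ₀)) (by rw [hnorm]; exact min_le_right _ _)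
  rw [hnorm] at h1
  have h2 : quadApprox (matrixCLM (info μ f θ₀ θ₀)) (∑ i, W x i • score f θ₀ (yv x i))
      (a • (θ - θ₀)) ≤ c * η / 8 * η - c * η ^ 2 / 2 := by
    unfold quadApprox
    have h3 := hcoer (a • (θ - θ₀))
    have h4 := real_inner_le_norm (∑ i, W x i • score f θ₀ (yv x i)) (a • (θ - θ₀))
    rw [hnorm] at h3 h4
    have h5 := mul_le_mul_of_nonneg_right hx2.le hη.le
    linarith
  have h6 : ℓ (θ₀ + a • (θ - θ₀)) - ℓ θ₀ ≤ -(c / 4 * η ^ 2) := by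
    have := (abs_le.1 h1).2
    simp only [hℓ]
    nlinarith
  have h7 := hℓc.2 hm.mem_param hθ (sub_nonneg.2 ha1) ha0.le (by ring)
  have h8 : (1 - a) • θ₀ + a • θ = θ₀ + a • (θ - θ₀) := by
    rw [sub_smul, one_smul, smul_sub]; abel
  rw [h8, smul_eq_mul, smul_eq_mul] at h7
  have h9 : a * (ℓ θ - ℓ θ₀) ≤ -(c / 4 * η ^ 2) := by linarith
  by_contra hcon
  rw [not_le] at hcon
  have hpos : 0 < c / 4 * η ^ 2 := by positivity
  have : -(c / 4 * η ^ 2) ≤ a * -(c / 4 * η ^ 2) := by nlinarith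
  have := mul_lt_mul_of_pos_left hcon ha0
  linarith

/-- Wald's argument: at each θ₁ ≠ θ₀ the averaged log-likelihood ratio tends to a negative number,
the Lipschitz envelope spreads this to a ball, and compactness reduces to finitely many balls. -/
theorem weighted_separated_on (hm : RegularModel μ f Θ B θ₀) (hW : ∀ x i, 0 ≤ W x i)
    (hL : WeightedLLN (modelLaw μ f θ₀) l W yv) {ε : ℝ} (hε : 0 < ε) :
    ∃ c > 0, ∀ᶠ x in l, ∀ θ ∈ B, ε ≤ ‖θ - θ₀‖ →
      ∑ i, W x i * Real.log (f (yv x i) θ) - ∑ i, W x i * Real.log (f (yv x i) θ₀) ≤ -c := by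
  obtain ⟨L, hLi, hL0, hLip⟩ := hm.exists_lipschitz_envelope
  have hK : IsCompact (B ∩ {θ | ε ≤ ‖θ - θ₀‖}) :=
    hm.compact.inter_right (isClosed_le continuous_const (by fun_prop))
  have hmain : ∃ c > 0, ∀ᶠ x in l, ∀ θ ∈ (B ∩ {θ | ε ≤ ‖θ - θ₀‖}) ∩ B,
      ∑ i, W x i * Real.log (f (yv x i) θ) - ∑ i, W x i * Real.log (f (yv x i) θ₀) ≤ -c := by
    refine hK.induction_on (p := fun s => ∃ c > 0, ∀ᶠ x in l, ∀ θ ∈ s ∩ B,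
      ∑ i, W x i * Real.log (f (yv x i) θ) - ∑ i, W x i * Real.log (f (yv x i) θ₀) ≤ -c)
      ⟨1, one_pos, by simp⟩ ?_ ?_ ?_
    · rintro s t hst ⟨c, hc, h⟩
      exact ⟨c, hc, h.mono fun x hx θ hθ => hx θ ⟨hst hθ.1, hθ.2⟩⟩
    · rintro s t ⟨c, hc, h⟩ ⟨c', hc', h'⟩
      refine ⟨min c c', lt_min hc hc', ?_⟩
      filter_upwards [h, h'] with x hx hx' θ hθ
      rcases hθ.1 with h1 | h1
      · have := hx θ ⟨h1, hθ.2⟩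
        linarith [min_le_left c c']
      · have := hx' θ ⟨h1, hθ.2⟩
        linarith [min_le_right c c']
    · rintro θ₁ ⟨hθ₁, hθ₁ε⟩
      have hne : θ₁ ≠ θ₀ := by
        rintro rfl
        simp only [Set.mem_ofPred_eq, sub_self, norm_zero] at hθ₁ε
        linarith
      have hneg := (hm.integral_log_sub_le hθ₁).2 hne
      set M := ∫ y, (Real.log (f y θ₁) - Real.log (f y θ₀)) ∂modelLaw μ f θ₀
      have hEL : 0 ≤ ∫ y, L y ∂modelLaw μ f θ₀ := integral_nonneg_of_ae (Eventually.of_forall hL0)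
      set Λ := ∫ y, L y ∂modelLaw μ f θ₀
      -- The average at θ₁ is eventually below 2M/3, and a move within this radius costs at most
      -- −M/3, which leaves the bound M/3 < 0.
      have hη : 0 < -M / 3 / (Λ + 1) := div_pos (by linarith) (by positivity)
      refine ⟨Metric.ball θ₁ (-M / 3 / (Λ + 1)),
        mem_nhdsWithin_of_mem_nhds (Metric.ball_mem_nhds _ hη), -M / 3, by linarith, ?_⟩
      filter_upwards [(hL _ (hm.integrable_log_sub hθ₁)).eventually
        (gt_mem_nhds (show M < 2 * M / 3 by linarith)),
        (hL _ hLi).eventually (gt_mem_nhds (show Λ < Λ + 1 by linarith))] with x hx1 hx2 θ hθ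
      have h1 : ∑ i, W x i * Real.log (f (yv x i) θ) - ∑ i, W x i * Real.log (f (yv x i) θ₁) ≤
          (∑ i, W x i * L (yv x i)) * ‖θ - θ₁‖ := by
        rw [← Finset.sum_sub_distrib, Finset.sum_mul]
        refine Finset.sum_le_sum fun i _ => ?_
        have := mul_le_mul_of_nonneg_left ((le_abs_self _).trans
          (hLip (yv x i) θ hθ.2 θ₁ hθ₁)) (hW x i)
        linarith
      have h2 : (∑ i, W x i * L (yv x i)) * ‖θ - θ₁‖ ≤ -M / 3 := by
        have h3 : ‖θ - θ₁‖ < -M / 3 / (Λ + 1) := by simpa [dist_eq_norm] using hθ.1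
        rw [lt_div_iff₀ (by positivity)] at h3
        have := mul_le_mul_of_nonneg_right hx2.le (norm_nonneg (θ - θ₁))
        linarith
      have h4 : ∑ i, W x i * (Real.log (f (yv x i) θ₁) - Real.log (f (yv x i) θ₀)) =
          ∑ i, W x i * Real.log (f (yv x i) θ₁) - ∑ i, W x i * Real.log (f (yv x i) θ₀) := by
        rw [← Finset.sum_sub_distrib]
        exact Finset.sum_congr rfl fun i _ => mul_sub _ _ _
      rw [h4] at hx1
      linarith
  obtain ⟨c, hc, h⟩ := hmain
  exact ⟨c, hc, h.mono fun x hx θ hθ hd => hx θ ⟨⟨hθ, hd⟩, hθ⟩⟩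

/-- Outside B the dominating function g turns the supremum over θ into a single average, which tends
to a negative mean; in the concave case the local expansion at θ₀ suffices. -/
theorem weighted_separated (hm : RegularModel μ f Θ B θ₀) (hW : ∀ x i, 0 ≤ W x i)
    (hL : WeightedLLN (modelLaw μ f θ₀) l W yv) {ε : ℝ} (hε : 0 < ε) :
    ∃ c > 0, ∀ᶠ x in l, ∀ θ ∈ Θ, ε ≤ ‖θ - θ₀‖ →
      ∑ i, W x i * Real.log (f (yv x i) θ) - ∑ i, W x i * Real.log (f (yv x i) θ₀) ≤ -c := by
  rcases hm.outside with ⟨g, hgi, hg0, hg⟩ | hconc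
  · obtain ⟨c, hc, h⟩ := hm.weighted_separated_on hW hL hε
    set M := ∫ y, g y ∂modelLaw μ f θ₀
    refine ⟨min c (-M / 2), lt_min hc (by linarith), ?_⟩
    filter_upwards [h, (hL g hgi).eventually (gt_mem_nhds (show M < M / 2 by linarith))]
      with x hx1 hx2 θ hθ hd
    by_cases hB : θ ∈ B
    · have := hx1 θ hB hd
      linarith [min_le_left c (-M / 2)]
    · have h1 : ∑ i, W x i * Real.log (f (yv x i) θ) - ∑ i, W x i * Real.log (f (yv x i) θ₀) ≤
          ∑ i, W x i * g (yv x i) := by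
        rw [← Finset.sum_sub_distrib]
        refine Finset.sum_le_sum fun i _ => ?_
        have := mul_le_mul_of_nonneg_left (hg θ ⟨hθ, hB⟩ (yv x i)) (hW x i)
        linarith
      linarith [min_le_right c (-M / 2)]
  · exact hm.weighted_separated_of_concave hW hL hconc hε

theorem quadraticCriterion (hm : RegularModel μ f Θ B θ₀) (hW : ∀ x i, 0 ≤ W x i)
    (hL : WeightedLLN (modelLaw μ f θ₀) l W yv) :
    QuadraticCriterion l (fun x θ => ∑ i, W x i * Real.log (f (yv x i) θ)) Θ θ₀
      (fun x => ∑ i, W x i • score f θ₀ (yv x i)) (matrixCLM (info μ f θ₀ θ₀)) where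
  symm := by
    intro v w
    have hH := hm.info_posDef.isHermitian
    rw [IsHermitian, conjTranspose_eq_transpose_of_trivial] at hH
    rw [real_inner_comm, inner_matrixCLM, inner_matrixCLM, dotProduct_mulVec, ← mulVec_transpose,
      hH, dotProduct_comm]
  coercive := exists_coercive hm.info_posDef
  expansion := fun ε hε => hm.weighted_expansion hW hL hε
  gradient_tendsto := hm.tendsto_norm_weighted_score hL
  separated := fun ε hε => hm.weighted_separated hW hL hε
  continuousOn := by
    obtain ⟨ρ, hρ, hball⟩ := Metric.nhds_basis_closedBall.mem_iff.1
      (isOpen_interior.mem_nhds hm.interior)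
    refine ⟨ρ, hρ, fun θ hθ => hm.subset (interior_subset (hball hθ)), fun x => ?_⟩
    refine continuousOn_finsetSum _ fun i _ => continuousOn_const.mul ?_
    exact (hm.continuousOn_log (yv x i)).mono fun θ hθ => interior_subset (hball hθ)

end RegularModel

end WeightedCriterion

/-! ### Moments of Poisson samples -/

section SurveyMoments

variable {r q : ℕ} {𝓨 Ω : Type*} [MeasurableSpace 𝓨] [MeasurableSpace Ω]
  {P : Measure Ω} [IsProbabilityMeasure P]
  {μ : Measure 𝓨} {f : 𝓨 → Param r q → ℝ} {Θ B : Set (Param r q)} {θ₀ : Param r q}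
  {N : ℕ → ℕ} {Y : (ν : ℕ) → Fin (N ν) → Ω → 𝓨} {pi : (ν : ℕ) → Fin (N ν) → Ω → ℝ}
  {A : (ν : ℕ) → Ω → Finset (Fin (N ν))}
  {VS : Param r q → Matrix (Fin r ⊕ Fin q) (Fin r ⊕ Fin q) ℝ}

/-- The selection indicator of unit `i`. -/
def selInd (A : (ν : ℕ) → Ω → Finset (Fin (N ν))) (ν : ℕ) (i : Fin (N ν)) (ω : Ω) : ℝ :=
  if i ∈ A ν ω then 1 else 0

theorem sum_selInd (ν : ℕ) (ω : Ω) (g : Fin (N ν) → ℝ) :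
    ∑ i, selInd A ν i ω * g i = ∑ i ∈ A ν ω, g i := by
  simp [selInd, Finset.sum_ite_mem]

theorem abs_selInd_le (ν : ℕ) (i : Fin (N ν)) (ω : Ω) : |selInd A ν i ω| ≤ 1 := by
  unfold selInd; split_ifs <;> norm_num

theorem selInd_mul_self (ν : ℕ) (i : Fin (N ν)) (ω : Ω) :
    selInd A ν i ω * selInd A ν i ω = selInd A ν i ω := by
  unfold selInd; split_ifs <;> norm_num

namespace PoissonSurvey

theorem measurable_selInd (hs : PoissonSurvey P μ f B θ₀ N Y pi A VS) (ν : ℕ) (i : Fin (N ν)) :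
    Measurable (selInd A ν i) :=
  Measurable.ite (hs.measurable_A ν i) measurable_const measurable_const

theorem integrable_comp (hs : PoissonSurvey P μ f B θ₀ N Y pi A VS) {g : 𝓨 → ℝ}
    (hgi : Integrable g (modelLaw μ f θ₀)) (ν : ℕ) (i : Fin (N ν)) :
    Integrable (fun ω => g (Y ν i ω)) P := by
  rw [← hs.law_Y ν i] at hgi
  exact hgi.comp_measurable (hs.measurable_Y ν i)

theorem integral_comp (hs : PoissonSurvey P μ f B θ₀ N Y pi A VS) {g : 𝓨 → ℝ}
    (hgi : Integrable g (modelLaw μ f θ₀)) (ν : ℕ) (i : Fin (N ν)) :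
    ∫ ω, g (Y ν i ω) ∂P = ∫ y, g y ∂modelLaw μ f θ₀ := by
  rw [← hs.law_Y ν i] at hgi ⊢
  exact (integral_map (hs.measurable_Y ν i).aemeasurable hgi.aestronglyMeasurable).symm

/-- The inclusion probabilities in integrated form. -/
theorem integral_selInd_mul (hs : PoissonSurvey P μ f B θ₀ N Y pi A VS) (ν : ℕ) (i : Fin (N ν))
    {φ : 𝓨 × ℝ → ℝ} (hφ : Measurable φ) (hi : Integrable (fun ω => φ (Y ν i ω, pi ν i ω)) P) :
    ∫ ω, selInd A ν i ω * φ (Y ν i ω, pi ν i ω) ∂P =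
      ∫ ω, pi ν i ω * φ (Y ν i ω, pi ν i ω) ∂P := by
  have hpair : Measurable fun ω => (Y ν i ω, pi ν i ω) :=
    (hs.measurable_Y ν i).prodMk (hs.measurable_pi ν i)
  have hsel : (selInd A ν i) = {ω | i ∈ A ν ω}.indicator fun _ => 1 := by
    ext ω
    simp [selInd, Set.indicator_apply]
  have hg : Integrable (selInd A ν i) P :=
    (integrable_const (1 : ℝ)).mono' (hs.measurable_selInd ν i).aestronglyMeasurable
      (Eventually.of_forall fun ω => abs_selInd_le ν i ω)
  have hsm : StronglyMeasurable[MeasurableSpace.comap (fun ω => (Y ν i ω, pi ν i ω)) inferInstance]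
      fun ω => φ (Y ν i ω, pi ν i ω) :=
    (hφ.comp (comap_measurable _)).stronglyMeasurable
  have hprod : Integrable ((fun ω => φ (Y ν i ω, pi ν i ω)) * selInd A ν i) P := by
    refine hi.abs.mono' (hi.aestronglyMeasurable.mul hg.aestronglyMeasurable)
      (Eventually.of_forall fun ω => ?_)
    rw [Pi.mul_apply, norm_mul, Real.norm_eq_abs, Real.norm_eq_abs]
    have := abs_selInd_le (A := A) ν i ω
    nlinarith [abs_nonneg (φ (Y ν i ω, pi ν i ω))]
  have h1 := condExp_mul_of_stronglyMeasurable_left hsm hprod hg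
  have h2 := hs.inclusion ν i
  rw [← hsel] at h2
  calc ∫ ω, selInd A ν i ω * φ (Y ν i ω, pi ν i ω) ∂P
      = ∫ ω, ((fun ω => φ (Y ν i ω, pi ν i ω)) * selInd A ν i) ω ∂P :=
        integral_congr_ae (Eventually.of_forall fun ω => mul_comm _ _)
    _ = ∫ ω, (P[(fun ω => φ (Y ν i ω, pi ν i ω)) * selInd A ν i |
          MeasurableSpace.comap (fun ω => (Y ν i ω, pi ν i ω)) inferInstance]) ω ∂P :=
        (integral_condExp hpair.comap_le).symm
    _ = ∫ ω, pi ν i ω * φ (Y ν i ω, pi ν i ω) ∂P := by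
        refine integral_congr_ae ?_
        filter_upwards [h1, h2] with ω hω1 hω2
        rw [hω1, Pi.mul_apply, hω2, mul_comm]

/-- The sampling weights are of order `N / n₀`. -/
theorem exists_weight_bound (hs : PoissonSurvey P μ f B θ₀ N Y pi A VS) :
    ∃ C : ℝ, 0 < C ∧ ∀ ν, 0 < expSize P (pi ν) → 0 < (N ν : ℝ) ∧
      ∀ i, ∀ᵐ ω ∂P, (pi ν i ω)⁻¹ ≤ C * (N ν / expSize P (pi ν)) := by
  obtain ⟨C₁, C₂, hC₁, -, hb⟩ := hs.pi_bounds
  refine ⟨C₁⁻¹, inv_pos.2 hC₁, fun ν hν => ?_⟩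
  have hN : 0 < (N ν : ℝ) := by
    rcases Nat.eq_zero_or_pos (N ν) with h | h
    · exfalso
      have : IsEmpty (Fin (N ν)) := by rw [h]; infer_instance
      simp [expSize] at hν
    · exact_mod_cast h
  refine ⟨hN, fun i => ?_⟩
  filter_upwards [hb ν i] with ω hω
  have hp := hs.pi_pos ν i ω
  have h1 := hω.1
  rw [inv_le_iff_one_le_mul₀ hp, inv_mul_eq_div, div_mul_eq_mul_div, le_div_iff₀ hC₁, one_mul]
  calc C₁ ≤ N ν * (expSize P (pi ν))⁻¹ * pi ν i ω := h1
    _ = _ := by rw [div_eq_mul_inv]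

variable {C : ℝ} {ν : ℕ}

theorem integrable_weight_pow (hs : PoissonSurvey P μ f B θ₀ N Y pi A VS) {i : Fin (N ν)} {b : ℝ}
    (hb : ∀ᵐ ω ∂P, (pi ν i ω)⁻¹ ≤ b) {g : 𝓨 → ℝ} (hgi : Integrable g (modelLaw μ f θ₀)) (k : ℕ) :
    Integrable (fun ω => (pi ν i ω)⁻¹ ^ k * g (Y ν i ω)) P ∧
      |∫ ω, (pi ν i ω)⁻¹ ^ k * g (Y ν i ω) ∂P| ≤ b ^ k * ∫ y, |g y| ∂modelLaw μ f θ₀ := by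
  have hgY := hs.integrable_comp hgi ν i
  have hle : ∀ᵐ ω ∂P, ‖(pi ν i ω)⁻¹ ^ k * g (Y ν i ω)‖ ≤ b ^ k * |g (Y ν i ω)| := by
    filter_upwards [hb] with ω hω
    have h0 : 0 ≤ (pi ν i ω)⁻¹ := (inv_pos.2 (hs.pi_pos ν i ω)).le
    rw [norm_mul, Real.norm_eq_abs, Real.norm_eq_abs, abs_of_nonneg (pow_nonneg h0 k)]
    gcongr
  have hint : Integrable (fun ω => (pi ν i ω)⁻¹ ^ k * g (Y ν i ω)) P :=
    (hgY.abs.const_mul (b ^ k)).mono' ((((hs.measurable_pi ν i).inv.pow_const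
      k).aestronglyMeasurable).mul hgY.aestronglyMeasurable) hle
  refine ⟨hint, ?_⟩
  rw [← hs.integral_comp hgi.abs ν i, ← integral_const_mul]
  exact (norm_integral_le_integral_norm _).trans
    (integral_mono_ae hint.norm (hgY.abs.const_mul _) hle)

/-- Conditioning on (yᵢ, πᵢ) replaces the selection indicator by πᵢ, which cancels one weight. Hence
k + 1 weights in a sum over the sample become k in its mean. -/
theorem integral_sel_weight_pow (hs : PoissonSurvey P μ f B θ₀ N Y pi A VS) {i : Fin (N ν)}
    {b : ℝ} (hb : ∀ᵐ ω ∂P, (pi ν i ω)⁻¹ ≤ b) {g : 𝓨 → ℝ} (hg : Measurable g)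
    (hgi : Integrable g (modelLaw μ f θ₀)) (k : ℕ) :
    Integrable (fun ω => selInd A ν i ω * ((pi ν i ω)⁻¹ ^ k * g (Y ν i ω))) P ∧
      ∫ ω, selInd A ν i ω * ((pi ν i ω)⁻¹ ^ (k + 1) * g (Y ν i ω)) ∂P =
        ∫ ω, (pi ν i ω)⁻¹ ^ k * g (Y ν i ω) ∂P := by
  constructor
  · refine (hs.integrable_weight_pow hb hgi k).1.abs.mono'
      ((hs.measurable_selInd ν i).aestronglyMeasurable.mul
        (hs.integrable_weight_pow hb hgi k).1.aestronglyMeasurable)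
      (Eventually.of_forall fun ω => ?_)
    rw [norm_mul, Real.norm_eq_abs, Real.norm_eq_abs]
    have := abs_selInd_le (A := A) ν i ω
    nlinarith [abs_nonneg ((pi ν i ω)⁻¹ ^ k * g (Y ν i ω))]
  · have h1 := hs.integral_selInd_mul ν i (φ := fun p => p.2⁻¹ ^ (k + 1) * g p.1)
      ((measurable_snd.inv.pow_const _).mul (hg.comp measurable_fst))
      (hs.integrable_weight_pow hb hgi (k + 1)).1
    rw [h1]
    refine integral_congr_ae (Eventually.of_forall fun ω => ?_)
    have := (hs.pi_pos ν i ω).ne'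
    beta_reduce
    rw [pow_succ]
    field_simp

/-- Sums of functions of the independent units: a bound for the mean squared error. -/
theorem integral_sq_sum_sub_le (hs : PoissonSurvey P μ f B θ₀ N Y pi A VS)
    {φ : Fin (N ν) → 𝓨 × ℝ × Prop → ℝ} (hφ : ∀ i, Measurable (φ i))
    (hL2 : ∀ i, MemLp (fun ω => φ i (Y ν i ω, pi ν i ω, i ∈ A ν ω)) 2 P) :
    Integrable (fun ω => (∑ i, φ i (Y ν i ω, pi ν i ω, i ∈ A ν ω) -
        ∑ i, ∫ ω, φ i (Y ν i ω, pi ν i ω, i ∈ A ν ω) ∂P) ^ 2) P ∧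
      ∫ ω, (∑ i, φ i (Y ν i ω, pi ν i ω, i ∈ A ν ω) -
        ∑ i, ∫ ω, φ i (Y ν i ω, pi ν i ω, i ∈ A ν ω) ∂P) ^ 2 ∂P ≤
      ∑ i, ∫ ω, φ i (Y ν i ω, pi ν i ω, i ∈ A ν ω) ^ 2 ∂P := by
  set X : Fin (N ν) → Ω → ℝ := fun i ω => φ i (Y ν i ω, pi ν i ω, i ∈ A ν ω) with hX
  have hindep : iIndepFun X P := (hs.indep ν).comp φ hφ
  have hsum : MemLp (∑ i, X i) 2 P := memLp_finsetSum' _ fun i _ => hL2 i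
  have hsum' : MemLp (fun ω => ∑ i, X i ω) 2 P := memLp_finsetSum _ fun i _ => hL2 i
  have hmean : ∑ i, ∫ ω, X i ω ∂P = ∫ ω, (∑ i, X i) ω ∂P := by
    simp only [Finset.sum_apply]
    rw [integral_finsetSum _ fun i _ => (hL2 i).integrable (by norm_num)]
  have hvar : Var[∑ i, X i; P] = ∑ i, Var[X i; P] :=
    IndepFun.variance_sum (fun i _ => hL2 i) fun i _ j _ hij => hindep.indepFun hij
  constructor
  · have h1 : MemLp (fun ω => ∑ i, X i ω - ∑ i, ∫ ω, X i ω ∂P) 2 P := hsum'.sub (memLp_const _)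
    exact h1.integrable_sq
  · have h2 : ∫ ω, (∑ i, X i ω - ∑ i, ∫ ω, X i ω ∂P) ^ 2 ∂P = Var[∑ i, X i; P] := by
      rw [variance_eq_integral hsum.aemeasurable, hmean]
      simp only [Finset.sum_apply]
    rw [h2, hvar]
    refine Finset.sum_le_sum fun i _ => ?_
    have := variance_le_expectation_sq (hL2 i).aestronglyMeasurable
    simpa using this

end PoissonSurvey

end SurveyMoments

/-! ### Limits of weighted sums over Poisson samples -/

section SurveyLimits

variable {r q : ℕ} {𝓨 Ω : Type*} [MeasurableSpace 𝓨] [MeasurableSpace Ω]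
  {P : Measure Ω} [IsProbabilityMeasure P]
  {μ : Measure 𝓨} {f : 𝓨 → Param r q → ℝ} {Θ B : Set (Param r q)} {θ₀ : Param r q}
  {N : ℕ → ℕ} {Y : (ν : ℕ) → Fin (N ν) → Ω → 𝓨} {pi : (ν : ℕ) → Fin (N ν) → Ω → ℝ}
  {A : (ν : ℕ) → Ω → Finset (Fin (N ν))}
  {VS : Param r q → Matrix (Fin r ⊕ Fin q) (Fin r ⊕ Fin q) ℝ}

/-- The sum `∑_{i ∈ A} wᵢ^(k+1) g(yᵢ)`, scaled by its order of magnitude, if `n₀` is the expected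
sample size. -/
def scaledSum {n : ℕ} (n₀ : ℝ) (A : Finset (Fin n)) (pi : Fin n → ℝ) (y : Fin n → 𝓨) (k : ℕ)
    (g : 𝓨 → ℝ) : ℝ :=
  n₀ ^ k / (n : ℝ) ^ (k + 1) * ∑ i ∈ A, (pi i)⁻¹ ^ (k + 1) * g (y i)

theorem scaledSum_sub {n : ℕ} (n₀ : ℝ) (A : Finset (Fin n)) (pi : Fin n → ℝ) (y : Fin n → 𝓨)
    (k : ℕ) (g g' : 𝓨 → ℝ) :
    scaledSum n₀ A pi y k (fun a => g a - g' a) =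
      scaledSum n₀ A pi y k g - scaledSum n₀ A pi y k g' := by
  simp only [scaledSum, mul_sub, Finset.sum_sub_distrib]

/-- The filter of convergence in probability as `ν → ∞`. -/
abbrev surveyFilter (P : Measure Ω) : Filter (Σ _ : ℕ, Ω) := kernelFilter atTop fun _ => P

namespace PoissonSurvey

variable {C : ℝ} {ν : ℕ}

theorem scaledSum_eq (ν : ℕ) (ω : Ω) (k : ℕ) (g : 𝓨 → ℝ) :
    scaledSum (expSize P (pi ν)) (A ν ω) (fun i => pi ν i ω) (fun i => Y ν i ω) k g =
      ∑ i, expSize P (pi ν) ^ k / (N ν : ℝ) ^ (k + 1) *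
        (selInd A ν i ω * ((pi ν i ω)⁻¹ ^ (k + 1) * g (Y ν i ω))) := by
  rw [scaledSum, ← Finset.mul_sum, sum_selInd]

/-- The mean of a scaled sum. -/
theorem integral_scaledSum (hs : PoissonSurvey P μ f B θ₀ N Y pi A VS) {b : ℝ}
    (hb : ∀ i, ∀ᵐ ω ∂P, (pi ν i ω)⁻¹ ≤ b) {g : 𝓨 → ℝ} (hg : Measurable g)
    (hgi : Integrable g (modelLaw μ f θ₀)) (k : ℕ) :
    Integrable (fun ω => scaledSum (expSize P (pi ν)) (A ν ω) (fun i => pi ν i ω)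
        (fun i => Y ν i ω) k g) P ∧
      ∫ ω, scaledSum (expSize P (pi ν)) (A ν ω) (fun i => pi ν i ω) (fun i => Y ν i ω) k g ∂P =
        expSize P (pi ν) ^ k / (N ν : ℝ) ^ (k + 1) *
          ∑ i, ∫ ω, (pi ν i ω)⁻¹ ^ k * g (Y ν i ω) ∂P := by
  simp only [scaledSum_eq]
  have hi : ∀ i, Integrable (fun ω => selInd A ν i ω * ((pi ν i ω)⁻¹ ^ (k + 1) * g (Y ν i ω))) P :=
    fun i => (hs.integral_sel_weight_pow (hb i) hg hgi (k + 1)).1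
  refine ⟨integrable_finsetSum _ fun i _ => (hi i).const_mul _, ?_⟩
  rw [integral_finsetSum _ fun i _ => (hi i).const_mul _, Finset.mul_sum]
  refine Finset.sum_congr rfl fun i _ => ?_
  rw [integral_const_mul, (hs.integral_sel_weight_pow (hb i) hg hgi k).2]

/-- Weights are at most C·N/n₀, so the factor n₀^k/N^(k+1) exactly compensates N terms carrying k
weights each. -/
theorem integral_abs_scaledSum_le (hs : PoissonSurvey P μ f B θ₀ N Y pi A VS)
    (hC : 0 < C) (hn : 0 < expSize P (pi ν)) (hN : 0 < (N ν : ℝ))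
    (hb : ∀ i, ∀ᵐ ω ∂P, (pi ν i ω)⁻¹ ≤ C * (N ν / expSize P (pi ν)))
    {g : 𝓨 → ℝ} (hg : Measurable g) (hgi : Integrable g (modelLaw μ f θ₀)) (k : ℕ) :
    ∫ ω, |scaledSum (expSize P (pi ν)) (A ν ω) (fun i => pi ν i ω) (fun i => Y ν i ω) k g| ∂P ≤
      C ^ k * ∫ y, |g y| ∂modelLaw μ f θ₀ := by
  obtain ⟨hi, he⟩ := hs.integral_scaledSum hb hg.abs hgi.abs k
  have hle : ∀ ω, |scaledSum (expSize P (pi ν)) (A ν ω) (fun i => pi ν i ω) (fun i => Y ν i ω) k g|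
      ≤ scaledSum (expSize P (pi ν)) (A ν ω) (fun i => pi ν i ω) (fun i => Y ν i ω) k
        fun y => |g y| := by
    intro ω
    unfold scaledSum
    rw [abs_mul, abs_of_nonneg (by positivity)]
    refine mul_le_mul_of_nonneg_left ((Finset.abs_sum_le_sum_abs _ _).trans
      (Finset.sum_le_sum fun i _ => ?_)) (by positivity)
    rw [abs_mul, abs_of_nonneg (pow_nonneg (inv_pos.2 (hs.pi_pos ν i ω)).le _)]
  refine (integral_mono (hs.integral_scaledSum hb hg hgi k).1.abs hi hle).trans ?_
  rw [he]
  calc expSize P (pi ν) ^ k / (N ν : ℝ) ^ (k + 1) *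
        ∑ i, ∫ ω, (pi ν i ω)⁻¹ ^ k * |g (Y ν i ω)| ∂P
      ≤ expSize P (pi ν) ^ k / (N ν : ℝ) ^ (k + 1) * ∑ i : Fin (N ν),
          (C * (N ν / expSize P (pi ν))) ^ k * ∫ y, |g y| ∂modelLaw μ f θ₀ := by
        gcongr with i
        refine (le_abs_self _).trans ((hs.integrable_weight_pow (hb i) hgi.abs k).2.trans ?_)
        simp only [abs_abs]; rfl
    _ = C ^ k * ∫ y, |g y| ∂modelLaw μ f θ₀ := by
        rw [Finset.sum_const, Finset.card_univ, Fintype.card_fin, nsmul_eq_mul, mul_pow, div_pow]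
        field_simp
        ring

-- Squaring a summand gives 2k + 2 weights, one of which is absorbed by the selection probability.
-- The other 2k + 1, the squared scale and the N terms combine to C^(2k+1)/n₀.
open Classical in
theorem integral_sq_scaledSum_sub_le (hs : PoissonSurvey P μ f B θ₀ N Y pi A VS)
    (hC : 0 < C) (hn : 0 < expSize P (pi ν)) (hN : 0 < (N ν : ℝ))
    (hb : ∀ i, ∀ᵐ ω ∂P, (pi ν i ω)⁻¹ ≤ C * (N ν / expSize P (pi ν)))
    {g : 𝓨 → ℝ} (hg : Measurable g) (hgi : Integrable (fun y => g y ^ 2) (modelLaw μ f θ₀))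
    (hgi1 : Integrable g (modelLaw μ f θ₀)) (k : ℕ) :
    Integrable (fun ω => (scaledSum (expSize P (pi ν)) (A ν ω) (fun i => pi ν i ω)
        (fun i => Y ν i ω) k g - expSize P (pi ν) ^ k / (N ν : ℝ) ^ (k + 1) *
          ∑ i, ∫ ω, (pi ν i ω)⁻¹ ^ k * g (Y ν i ω) ∂P) ^ 2) P ∧
    ∫ ω, (scaledSum (expSize P (pi ν)) (A ν ω) (fun i => pi ν i ω) (fun i => Y ν i ω) k g -
        expSize P (pi ν) ^ k / (N ν : ℝ) ^ (k + 1) *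
          ∑ i, ∫ ω, (pi ν i ω)⁻¹ ^ k * g (Y ν i ω) ∂P) ^ 2 ∂P ≤
      C ^ (2 * k + 1) * (∫ y, g y ^ 2 ∂modelLaw μ f θ₀) / expSize P (pi ν) := by
  set c : ℝ := expSize P (pi ν) ^ k / (N ν : ℝ) ^ (k + 1) with hc
  let φ : Fin (N ν) → 𝓨 × ℝ × Prop → ℝ := fun _ p =>
    c * ((if p.2.2 then 1 else 0) * (p.2.1⁻¹ ^ (k + 1) * g p.1))
  have hφ : ∀ i, Measurable (φ i) := fun i =>
    ((Measurable.ite (measurableSet_setOfPred.2 measurable_snd.snd) measurable_const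
      measurable_const).mul ((measurable_snd.fst.inv.pow_const _).mul
        (hg.comp measurable_fst))).const_mul c
  have hφe : ∀ i ω, φ i (Y ν i ω, pi ν i ω, i ∈ A ν ω) =
      c * (selInd A ν i ω * ((pi ν i ω)⁻¹ ^ (k + 1) * g (Y ν i ω))) := by
    intro i ω
    simp only [φ, selInd]
    congr
  have hsq : ∀ i ω, (c * (selInd A ν i ω * ((pi ν i ω)⁻¹ ^ (k + 1) * g (Y ν i ω)))) ^ 2 =
      c ^ 2 * (selInd A ν i ω * ((pi ν i ω)⁻¹ ^ (2 * k + 1 + 1) * g (Y ν i ω) ^ 2)) := by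
    intro i ω
    have := selInd_mul_self (A := A) ν i ω
    have h2 : (pi ν i ω)⁻¹ ^ (2 * k + 1 + 1) = ((pi ν i ω)⁻¹ ^ (k + 1)) ^ 2 := by
      rw [← pow_mul]; congr 1; ring
    rw [h2]
    linear_combination c ^ 2 * ((pi ν i ω)⁻¹ ^ (k + 1)) ^ 2 * g (Y ν i ω) ^ 2 * this
  have hL2 : ∀ i, MemLp (fun ω => φ i (Y ν i ω, pi ν i ω, i ∈ A ν ω)) 2 P := by
    intro i
    simp only [hφe]
    have hms : AEStronglyMeasurable
        (fun ω => c * (selInd A ν i ω * ((pi ν i ω)⁻¹ ^ (k + 1) * g (Y ν i ω)))) P :=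
      (((hs.measurable_selInd ν i).mul (((hs.measurable_pi ν i).inv.pow_const _).mul
        (hg.comp (hs.measurable_Y ν i)))).const_mul c).aestronglyMeasurable
    rw [memLp_two_iff_integrable_sq hms]
    simp only [hsq]
    exact (hs.integral_sel_weight_pow (hb i) (hg.pow_const 2) hgi _).1.const_mul _
  have hmean : ∑ i, ∫ ω, φ i (Y ν i ω, pi ν i ω, i ∈ A ν ω) ∂P =
      c * ∑ i, ∫ ω, (pi ν i ω)⁻¹ ^ k * g (Y ν i ω) ∂P := by
    rw [Finset.mul_sum]
    refine Finset.sum_congr rfl fun i _ => ?_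
    simp only [hφe]
    rw [integral_const_mul, (hs.integral_sel_weight_pow (hb i) hg hgi1 k).2]
  obtain ⟨h1, h2⟩ := hs.integral_sq_sum_sub_le hφ hL2
  rw [hmean] at h1 h2
  simp only [hφe] at h1 h2
  simp only [scaledSum_eq]
  refine ⟨h1, h2.trans ?_⟩
  calc ∑ i, ∫ ω, (c * (selInd A ν i ω * ((pi ν i ω)⁻¹ ^ (k + 1) * g (Y ν i ω)))) ^ 2 ∂P
      = ∑ i, c ^ 2 * ∫ ω, (pi ν i ω)⁻¹ ^ (2 * k + 1) * g (Y ν i ω) ^ 2 ∂P := by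
        refine Finset.sum_congr rfl fun i _ => ?_
        simp only [hsq]
        rw [integral_const_mul, (hs.integral_sel_weight_pow (hb i) (hg.pow_const 2) hgi _).2]
    _ ≤ ∑ i : Fin (N ν), c ^ 2 * ((C * (N ν / expSize P (pi ν))) ^ (2 * k + 1) *
          ∫ y, g y ^ 2 ∂modelLaw μ f θ₀) := by
        gcongr with i
        refine (le_abs_self _).trans ((hs.integrable_weight_pow (hb i) hgi _).2.trans ?_)
        simp only [abs_pow, sq_abs]; rfl
    _ = _ := by
        rw [Finset.sum_const, Finset.card_univ, Fintype.card_fin, nsmul_eq_mul, hc, mul_pow, div_pow,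
          div_pow, ← pow_mul, ← pow_mul]
        field_simp
        ring

theorem eventually_weight_bound (hs : PoissonSurvey P μ f B θ₀ N Y pi A VS) :
    ∃ C : ℝ, 0 < C ∧ ∀ᶠ ν in atTop, 0 < expSize P (pi ν) ∧ 0 < (N ν : ℝ) ∧
      ∀ i, ∀ᵐ ω ∂P, (pi ν i ω)⁻¹ ≤ C * (N ν / expSize P (pi ν)) := by
  obtain ⟨C, hC, h⟩ := hs.exists_weight_bound
  exact ⟨C, hC, (hs.size_tendsto.eventually_gt_atTop 0).mono fun ν hν => ⟨hν, h ν hν⟩⟩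

/-- Scaled sums of a sequence of functions with vanishing means vanish in the limit. -/
theorem tendsto_scaledSum_zero (hs : PoissonSurvey P μ f B θ₀ N Y pi A VS) {g : ℕ → 𝓨 → ℝ}
    (hg : ∀ ν, Measurable (g ν)) (hgi : ∀ ν, Integrable (g ν) (modelLaw μ f θ₀))
    (h0 : Tendsto (fun ν => ∫ y, |g ν y| ∂modelLaw μ f θ₀) atTop (𝓝 0)) (k : ℕ) :
    Tendsto (fun x : Σ _ : ℕ, Ω => scaledSum (expSize P (pi x.1)) (A x.1 x.2)
      (fun i => pi x.1 i x.2) (fun i => Y x.1 i x.2) k (g x.1)) (surveyFilter P) (𝓝 0) := by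
  obtain ⟨C, hC, hb⟩ := hs.eventually_weight_bound
  refine tendsto_kernelFilter_of_integral
    (hb.mono fun ν hν => (hs.integral_scaledSum hν.2.2 (hg ν) (hgi ν) k).1) ?_
  refine squeeze_zero' (Eventually.of_forall fun ν => integral_nonneg fun _ => abs_nonneg _)
    (hb.mono fun ν hν => hs.integral_abs_scaledSum_le hC hν.1 hν.2.1 hν.2.2 (hg ν) (hgi ν) k) ?_
  simpa using h0.const_mul (C ^ k)

/-- Scaled sums of an integrable function are tight. -/
theorem tight_scaledSum (hs : PoissonSurvey P μ f B θ₀ N Y pi A VS) {g : 𝓨 → ℝ}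
    (hg : Measurable g) (hgi : Integrable g (modelLaw μ f θ₀)) (k : ℕ) :
    TightAlong atTop (fun _ => P) (fun x : Σ _ : ℕ, Ω => scaledSum (expSize P (pi x.1)) (A x.1 x.2)
      (fun i => pi x.1 i x.2) (fun i => Y x.1 i x.2) k g) := by
  obtain ⟨C, hC, hb⟩ := hs.eventually_weight_bound
  exact tightAlong_of_integral (C ^ k * ∫ y, |g y| ∂modelLaw μ f θ₀) (hb.mono fun ν hν =>
    ⟨(hs.integral_scaledSum hν.2.2 hg hgi k).1,
      hs.integral_abs_scaledSum_le hC hν.1 hν.2.1 hν.2.2 hg hgi k⟩)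

/-- A weak law for scaled sums of a sequence of functions. -/
theorem tendsto_scaledSum_sub (hs : PoissonSurvey P μ f B θ₀ N Y pi A VS) {g : ℕ → 𝓨 → ℝ}
    (hg : ∀ ν, Measurable (g ν)) (hgi : ∀ ν, Integrable (g ν) (modelLaw μ f θ₀))
    (hgi2 : ∀ ν, Integrable (fun y => g ν y ^ 2) (modelLaw μ f θ₀))
    (h0 : Tendsto (fun ν => (∫ y, g ν y ^ 2 ∂modelLaw μ f θ₀) / expSize P (pi ν)) atTop (𝓝 0))
    (k : ℕ) :
    Tendsto (fun x : Σ _ : ℕ, Ω => scaledSum (expSize P (pi x.1)) (A x.1 x.2)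
        (fun i => pi x.1 i x.2) (fun i => Y x.1 i x.2) k (g x.1) -
      expSize P (pi x.1) ^ k / (N x.1 : ℝ) ^ (k + 1) *
          ∑ i, ∫ ω, (pi x.1 i ω)⁻¹ ^ k * g x.1 (Y x.1 i ω) ∂P) (surveyFilter P) (𝓝 0) := by
  obtain ⟨C, hC, hb⟩ := hs.eventually_weight_bound
  refine tendsto_kernelFilter_of_sq (hb.mono fun ν hν =>
    (hs.integral_sq_scaledSum_sub_le hC hν.1 hν.2.1 hν.2.2 (hg ν) (hgi2 ν) (hgi ν) k).1) ?_
  refine squeeze_zero' (Eventually.of_forall fun ν => integral_nonneg fun _ => sq_nonneg _)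
    (hb.mono fun ν hν =>
      (hs.integral_sq_scaledSum_sub_le hC hν.1 hν.2.1 hν.2.2 (hg ν) (hgi2 ν) (hgi ν) k).2) ?_
  simpa [mul_div_assoc] using h0.const_mul (C ^ (2 * k + 1))

end PoissonSurvey

end SurveyLimits

/-! ### Laws of large numbers for Poisson samples -/

section SurveyLaws

variable {r q : ℕ} {𝓨 Ω : Type*} [MeasurableSpace 𝓨] [MeasurableSpace Ω]
  {P : Measure Ω} [IsProbabilityMeasure P]
  {μ : Measure 𝓨} {f : 𝓨 → Param r q → ℝ} {Θ B : Set (Param r q)} {θ₀ : Param r q}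
  {N : ℕ → ℕ} {Y : (ν : ℕ) → Fin (N ν) → Ω → 𝓨} {pi : (ν : ℕ) → Fin (N ν) → Ω → ℝ}
  {A : (ν : ℕ) → Ω → Finset (Fin (N ν))}
  {VS : Param r q → Matrix (Fin r ⊕ Fin q) (Fin r ⊕ Fin q) ℝ}

/-- The weights `wᵢ / N` of the units `i ∈ A`, extended by `0` to the population. -/
def popWeight {n : ℕ} (A : Finset (Fin n)) (w : Fin n → ℝ) (i : Fin n) : ℝ :=
  if i ∈ A then (n : ℝ)⁻¹ * w i else 0

theorem sum_popWeight {n : ℕ} (A : Finset (Fin n)) (w g : Fin n → ℝ) :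
    ∑ i, popWeight A w i * g i = (n : ℝ)⁻¹ * ∑ i ∈ A, w i * g i := by
  simp [popWeight, Finset.mul_sum, Finset.sum_ite_mem, mul_assoc]

theorem sum_popWeight_smul {E : Type*} [AddCommGroup E] [Module ℝ E] {n : ℕ} (A : Finset (Fin n))
    (w : Fin n → ℝ) (g : Fin n → E) :
    ∑ i, popWeight A w i • g i = (n : ℝ)⁻¹ • ∑ i ∈ A, w i • g i := by
  simp [popWeight, Finset.smul_sum, ite_smul, Finset.sum_ite_mem, mul_smul]

theorem popWeight_nonneg {n : ℕ} {A : Finset (Fin n)} {w : Fin n → ℝ} (hw : ∀ i, 0 ≤ w i)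
    (i : Fin n) : 0 ≤ popWeight A w i := by
  unfold popWeight
  split_ifs
  · exact mul_nonneg (by positivity) (hw i)
  · exact le_rfl

theorem scaledSum_zero {n : ℕ} (n₀ : ℝ) (A : Finset (Fin n)) (pi : Fin n → ℝ) (y : Fin n → 𝓨)
    (g : 𝓨 → ℝ) : scaledSum n₀ A pi y 0 g = (n : ℝ)⁻¹ * ∑ i ∈ A, (pi i)⁻¹ * g (y i) := by
  simp [scaledSum]

theorem wScore_apply {n : ℕ} (n₀ : ℝ) (A : Finset (Fin n)) (pi : Fin n → ℝ) (y : Fin n → 𝓨)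
    (θ : Param r q) (j : Fin r ⊕ Fin q) :
    wScore f A (fun i => (pi i)⁻¹) y θ j = scaledSum n₀ A pi y 0 fun a => score f θ a j := by
  rw [scaledSum_zero, wScore]
  simp [WithLp.ofLp_sum, Finset.sum_apply]

/-- Truncation of `g` at level `K`. -/
def truncate (K : ℝ) (g : 𝓨 → ℝ) (y : 𝓨) : ℝ := if |g y| ≤ K then g y else 0

theorem measurable_truncate {g : 𝓨 → ℝ} (hg : Measurable g) (K : ℝ) :
    Measurable (truncate K g) :=
  Measurable.ite (measurableSet_le hg.abs measurable_const) hg measurable_const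

theorem abs_truncate_le {K : ℝ} (hK : 0 ≤ K) (g : 𝓨 → ℝ) (y : 𝓨) : |truncate K g y| ≤ K := by
  unfold truncate
  split_ifs with h
  · exact h
  · simpa using hK

theorem abs_truncate_le_abs (K : ℝ) (g : 𝓨 → ℝ) (y : 𝓨) : |truncate K g y| ≤ |g y| := by
  unfold truncate
  split_ifs with h
  · exact le_rfl
  · simp

theorem abs_sub_truncate_le_abs (K : ℝ) (g : 𝓨 → ℝ) (y : 𝓨) :
    |g y - truncate K g y| ≤ |g y| := by
  unfold truncate
  split_ifs with h
  · simp
  · simp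

theorem integrable_truncate {ν₀ : Measure 𝓨} {g : 𝓨 → ℝ} (hg : Measurable g)
    (hgi : Integrable g ν₀) (K : ℝ) : Integrable (truncate K g) ν₀ :=
  hgi.abs.mono' (measurable_truncate hg K).aestronglyMeasurable
    (Eventually.of_forall fun y => abs_truncate_le_abs K g y)

theorem tendsto_integral_sub_truncate {ν₀ : Measure 𝓨} {g : 𝓨 → ℝ} (hg : Measurable g)
    (hgi : Integrable g ν₀) {K : ℕ → ℝ} (hK : Tendsto K atTop atTop) :
    Tendsto (fun ν => ∫ y, |g y - truncate (K ν) g y| ∂ν₀) atTop (𝓝 0) := by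
  rw [← integral_zero 𝓨 ℝ (μ := ν₀)]
  refine tendsto_integral_of_dominated_convergence (fun y => |g y|)
    (fun ν => (hg.sub (measurable_truncate hg _)).abs.aestronglyMeasurable) hgi.abs
    (fun ν => Eventually.of_forall fun y => ?_) (Eventually.of_forall fun y => ?_)
  · rw [Real.norm_eq_abs, abs_abs]
    exact abs_sub_truncate_le_abs _ g y
  · refine tendsto_const_nhds.congr' ?_
    filter_upwards [hK.eventually_ge_atTop |g y|] with ν hν
    simp [truncate, hν]

theorem tendsto_integral_truncate {ν₀ : Measure 𝓨} {g : 𝓨 → ℝ} (hg : Measurable g)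
    (hgi : Integrable g ν₀) {K : ℕ → ℝ} (hK : Tendsto K atTop atTop) :
    Tendsto (fun ν => ∫ y, truncate (K ν) g y ∂ν₀) atTop (𝓝 (∫ y, g y ∂ν₀)) := by
  rw [tendsto_iff_norm_sub_tendsto_zero]
  refine squeeze_zero (fun ν => norm_nonneg _) (fun ν => ?_)
    (tendsto_integral_sub_truncate hg hgi hK)
  rw [norm_sub_rev, ← integral_sub hgi (integrable_truncate hg hgi _)]
  exact norm_integral_le_integral_norm _

namespace PoissonSurvey

theorem tendsto_size (hs : PoissonSurvey P μ f B θ₀ N Y pi A VS) :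
    Tendsto (fun x : Σ _ : ℕ, Ω => expSize P (pi x.1)) (surveyFilter P) atTop :=
  hs.size_tendsto.comp tendsto_fst_kernelFilter

theorem tendsto_population (hs : PoissonSurvey P μ f B θ₀ N Y pi A VS) :
    Tendsto (fun x : Σ _ : ℕ, Ω => (N x.1 : ℝ)) (surveyFilter P) atTop := by
  refine Tendsto.comp (g := fun ν => (N ν : ℝ)) ?_ tendsto_fst_kernelFilter
  refine tendsto_atTop_mono' _ ?_ hs.size_tendsto
  obtain ⟨C, -, hC⟩ := hs.eventually_weight_bound
  filter_upwards [hC, hs.fraction_tendsto.eventually (gt_mem_nhds one_pos)] with ν hν h1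
  rw [div_lt_one hν.2.1] at h1
  exact h1.le

open Classical in
/-- The sample size is asymptotically equal to its expectation. -/
theorem tendsto_card (hs : PoissonSurvey P μ f B θ₀ N Y pi A VS) :
    Tendsto (fun x : Σ _ : ℕ, Ω => ((A x.1 x.2).card : ℝ) / expSize P (pi x.1))
      (surveyFilter P) (𝓝 1) := by
  have hpi : ∀ ν i, Integrable (pi ν i) P := fun ν i =>
    (integrable_const (1 : ℝ)).mono' (hs.measurable_pi ν i).aestronglyMeasurable
      (Eventually.of_forall fun ω => by
        rw [Real.norm_eq_abs, abs_of_pos (hs.pi_pos ν i ω)]; exact hs.pi_le_one ν i ω)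
  have hsel : ∀ ν i, ∫ ω, selInd A ν i ω ∂P = ∫ ω, pi ν i ω ∂P := by
    intro ν i
    simpa using hs.integral_selInd_mul ν i (φ := fun _ => 1) measurable_const
      (integrable_const 1)
  let φ : (ν : ℕ) → Fin (N ν) → 𝓨 × ℝ × Prop → ℝ := fun ν _ p =>
    (expSize P (pi ν))⁻¹ * (if p.2.2 then 1 else 0)
  have hφ : ∀ ν i, Measurable (φ ν i) := fun ν i =>
    (Measurable.ite (measurableSet_setOfPred.2 measurable_snd.snd) measurable_const
      measurable_const).const_mul _
  have hφe : ∀ ν i ω, φ ν i (Y ν i ω, pi ν i ω, i ∈ A ν ω) =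
      (expSize P (pi ν))⁻¹ * selInd A ν i ω := by
    intro ν i ω
    simp only [φ, selInd]
    congr
  have hL2 : ∀ ν i, MemLp (fun ω => φ ν i (Y ν i ω, pi ν i ω, i ∈ A ν ω)) 2 P := by
    intro ν i
    simp only [hφe]
    refine MemLp.const_mul (MemLp.of_bound (hs.measurable_selInd ν i).aestronglyMeasurable 1
      (Eventually.of_forall fun ω => abs_selInd_le ν i ω)) _
  have hev := hs.size_tendsto.eventually_gt_atTop 0
  have hmean : ∀ ν, 0 < expSize P (pi ν) →
      ∑ i, ∫ ω, φ ν i (Y ν i ω, pi ν i ω, i ∈ A ν ω) ∂P = 1 := by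
    intro ν hν
    simp only [hφe, integral_const_mul, hsel]
    rw [← Finset.mul_sum]
    exact inv_mul_cancel₀ hν.ne'
  have hsum : ∀ ν ω, ∑ i, φ ν i (Y ν i ω, pi ν i ω, i ∈ A ν ω) =
      ((A ν ω).card : ℝ) / expSize P (pi ν) := by
    intro ν ω
    have h1 := sum_selInd (A := A) ν ω fun _ => 1
    simp only [mul_one, Finset.sum_const, nsmul_eq_mul] at h1
    simp only [hφe]
    rw [← Finset.mul_sum, h1, div_eq_mul_inv, mul_comm]
  have hsq : ∀ ν, 0 < expSize P (pi ν) →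
      ∑ i, ∫ ω, φ ν i (Y ν i ω, pi ν i ω, i ∈ A ν ω) ^ 2 ∂P = (expSize P (pi ν))⁻¹ := by
    intro ν hν
    have h1 : ∀ i ω, φ ν i (Y ν i ω, pi ν i ω, i ∈ A ν ω) ^ 2 =
        ((expSize P (pi ν))⁻¹) ^ 2 * selInd A ν i ω := by
      intro i ω
      rw [hφe, mul_pow, sq (selInd A ν i ω), selInd_mul_self]
    simp only [h1, integral_const_mul, hsel]
    rw [← Finset.mul_sum, sq, mul_assoc]
    change _ * (_ * expSize P (pi ν)) = _
    rw [inv_mul_cancel₀ hν.ne', mul_one]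
  rw [← tendsto_sub_nhds_zero_iff]
  refine tendsto_kernelFilter_of_sq (hev.mono fun ν hν => ?_)
    (squeeze_zero' (Eventually.of_forall fun ν => integral_nonneg fun _ => sq_nonneg _)
      (hev.mono fun ν hν => ?_) (tendsto_inv_atTop_zero.comp hs.size_tendsto))
  · have := (hs.integral_sq_sum_sub_le (hφ ν) (hL2 ν)).1
    simpa only [hmean ν hν, hsum] using this
  · have := (hs.integral_sq_sum_sub_le (hφ ν) (hL2 ν)).2
    simpa only [hmean ν hν, hsum, hsq ν hν, Function.comp_apply] using this

/-- Truncation levels growing more slowly than `√n₀`. -/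
def level (P : Measure Ω) (pi : (ν : ℕ) → Fin (N ν) → Ω → ℝ) (ν : ℕ) : ℝ :=
  Real.sqrt (Real.sqrt (expSize P (pi ν)))

theorem level_nonneg (ν : ℕ) : 0 ≤ level P pi ν := Real.sqrt_nonneg _

theorem tendsto_level (hs : PoissonSurvey P μ f B θ₀ N Y pi A VS) :
    Tendsto (level P pi) atTop atTop :=
  Real.tendsto_sqrt_atTop.comp (Real.tendsto_sqrt_atTop.comp hs.size_tendsto)

theorem tendsto_level_sq_div (hs : PoissonSurvey P μ f B θ₀ N Y pi A VS) :
    Tendsto (fun ν => level P pi ν ^ 2 / expSize P (pi ν)) atTop (𝓝 0) := by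
  have h : ∀ ν, level P pi ν ^ 2 / expSize P (pi ν) = (Real.sqrt (expSize P (pi ν)))⁻¹ := by
    intro ν
    rw [level, Real.sq_sqrt (Real.sqrt_nonneg _), Real.sqrt_div_self']
    exact one_div _
  simp only [h]
  exact tendsto_inv_atTop_zero.comp (Real.tendsto_sqrt_atTop.comp hs.size_tendsto)

theorem tendsto_scaledSum_tail (hs : PoissonSurvey P μ f B θ₀ N Y pi A VS) {g : 𝓨 → ℝ}
    (hg : Measurable g) (hgi : Integrable g (modelLaw μ f θ₀)) :
    Tendsto (fun x : Σ _ : ℕ, Ω => scaledSum (expSize P (pi x.1)) (A x.1 x.2)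
      (fun i => pi x.1 i x.2) (fun i => Y x.1 i x.2) 0
        (fun y => |g y - truncate (level P pi x.1) g y|)) (surveyFilter P) (𝓝 0) := by
  refine hs.tendsto_scaledSum_zero (g := fun ν y => |g y - truncate (level P pi ν) g y|)
    (fun ν => (hg.sub (measurable_truncate hg _)).abs)
    (fun ν => (hgi.sub (integrable_truncate hg hgi _)).abs) ?_ 0
  simpa only [abs_abs] using tendsto_integral_sub_truncate hg hgi hs.tendsto_level

/-- The level n₀^(1/4) tends to infinity, so the truncated means converge to the mean of g, while
level²/n₀ → 0 makes the variance negligible. -/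
theorem tendsto_scaledSum_truncate (hs : PoissonSurvey P μ f B θ₀ N Y pi A VS)
    (hm : RegularModel μ f Θ B θ₀) {g : 𝓨 → ℝ}
    (hg : Measurable g) (hgi : Integrable g (modelLaw μ f θ₀)) :
    Tendsto (fun x : Σ _ : ℕ, Ω => scaledSum (expSize P (pi x.1)) (A x.1 x.2)
      (fun i => pi x.1 i x.2) (fun i => Y x.1 i x.2) 0 (truncate (level P pi x.1) g))
      (surveyFilter P) (𝓝 (∫ y, g y ∂modelLaw μ f θ₀)) := by
  have := hm.isProbabilityMeasure
  have hle : ∀ ν y, ‖truncate (level P pi ν) g y ^ 2‖ ≤ level P pi ν ^ 2 := by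
    intro ν y
    rw [Real.norm_eq_abs, abs_pow]
    exact pow_le_pow_left₀ (abs_nonneg _) (abs_truncate_le (level_nonneg ν) g y) 2
  have hi2 : ∀ ν, Integrable (fun y => truncate (level P pi ν) g y ^ 2) (modelLaw μ f θ₀) :=
    fun ν => (integrable_const (level P pi ν ^ 2)).mono'
      ((measurable_truncate hg _).pow_const 2).aestronglyMeasurable
      (Eventually.of_forall fun y => hle ν y)
  have h1 := hs.tendsto_scaledSum_sub (g := fun ν => truncate (level P pi ν) g)
    (fun ν => measurable_truncate hg _) (fun ν => integrable_truncate hg hgi _) hi2 ?_ 0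
  · have h2 := (tendsto_integral_truncate hg hgi hs.tendsto_level).comp
      (tendsto_fst_kernelFilter (κ := fun _ => P))
    rw [← zero_add (∫ y, g y ∂modelLaw μ f θ₀)]
    refine (h1.add h2).congr' ?_
    obtain ⟨C, -, hC⟩ := hs.eventually_weight_bound
    filter_upwards [tendsto_fst_kernelFilter.eventually hC] with x hx
    have hN := hx.2.1.ne'
    simp only [pow_zero, one_mul, zero_add, pow_one, Function.comp_apply]
    have h4 : ∀ i, ∫ ω, truncate (level P pi x.1) g (Y x.1 i ω) ∂P =
        ∫ y, truncate (level P pi x.1) g y ∂modelLaw μ f θ₀ :=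
      fun i => hs.integral_comp (integrable_truncate hg hgi _) _ i
    simp only [h4, Finset.sum_const, Finset.card_univ, Fintype.card_fin, nsmul_eq_mul]
    field_simp
    ring
  · refine squeeze_zero' ?_ ?_ hs.tendsto_level_sq_div
    · filter_upwards [hs.size_tendsto.eventually_gt_atTop 0] with ν hν
      exact div_nonneg (integral_nonneg fun _ => sq_nonneg _) hν.le
    · filter_upwards [hs.size_tendsto.eventually_gt_atTop 0] with ν hν
      gcongr
      refine (integral_mono (hi2 ν) (integrable_const _) fun y =>
        (le_abs_self _).trans (hle ν y)).trans ?_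
      simp

theorem ae_comp_eq (hs : PoissonSurvey P μ f B θ₀ N Y pi A VS) {g g' : 𝓨 → ℝ}
    (h : g =ᵐ[modelLaw μ f θ₀] g') (ν : ℕ) : ∀ᵐ ω ∂P, ∀ i, g (Y ν i ω) = g' (Y ν i ω) := by
  rw [ae_all_iff]
  intro i
  rw [← hs.law_Y ν i] at h
  exact ae_of_ae_map (hs.measurable_Y ν i).aemeasurable h

theorem eventually_comp_eq (hs : PoissonSurvey P μ f B θ₀ N Y pi A VS) {g g' : 𝓨 → ℝ}
    (h : g =ᵐ[modelLaw μ f θ₀] g') :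
    ∀ᶠ x in surveyFilter P, ∀ i, g (Y x.1 i x.2) = g' (Y x.1 i x.2) := by
  rw [Filter.Eventually, mem_kernelFilter]
  refine tendsto_const_nhds.congr fun ν => ?_
  exact (ae_iff.1 (hs.ae_comp_eq h ν)).symm

/-- An integrable g need not have a second moment, so g is truncated: the bounded part obeys the
variance bound and the tail is small in mean. Passing to a measurable representative of g changes
the sums only on null events. -/
theorem weightedLLN (hs : PoissonSurvey P μ f B θ₀ N Y pi A VS) (hm : RegularModel μ f Θ B θ₀) :
    WeightedLLN (modelLaw μ f θ₀) (surveyFilter P) (n := fun x => N x.1)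
      (fun x => popWeight (A x.1 x.2) fun i => (pi x.1 i x.2)⁻¹) (fun x i => Y x.1 i x.2) := by
  intro g hgi
  obtain ⟨g', hg'm, hgg'⟩ := hgi.aestronglyMeasurable
  have hg' := hg'm.measurable
  have hgi' := hgi.congr hgg'
  have h1 : Tendsto (fun x : Σ _ : ℕ, Ω => scaledSum (expSize P (pi x.1)) (A x.1 x.2)
      (fun i => pi x.1 i x.2) (fun i => Y x.1 i x.2) 0
        (fun y => g' y - truncate (level P pi x.1) g' y)) (surveyFilter P) (𝓝 0) := by
    refine hs.tendsto_scaledSum_zero (g := fun ν y => g' y - truncate (level P pi ν) g' y)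
      (fun ν => hg'.sub (measurable_truncate hg' _))
      (fun ν => hgi'.sub (integrable_truncate hg' hgi' _)) ?_ 0
    exact tendsto_integral_sub_truncate hg' hgi' hs.tendsto_level
  have h2 := h1.add (hs.tendsto_scaledSum_truncate hm hg' hgi')
  rw [zero_add, ← integral_congr_ae hgg'] at h2
  refine h2.congr' ?_
  filter_upwards [hs.eventually_comp_eq hgg'] with x hx
  rw [scaledSum_sub, sub_add_cancel, sum_popWeight, scaledSum_zero]
  simp only [hx]

theorem memLp_sel_weight (hs : PoissonSurvey P μ f B θ₀ N Y pi A VS) {ν : ℕ} {i : Fin (N ν)}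
    {b : ℝ} (hb : ∀ᵐ ω ∂P, (pi ν i ω)⁻¹ ≤ b) {g : 𝓨 → ℝ} (hg : Measurable g)
    (hgi : Integrable (fun y => g y ^ 2) (modelLaw μ f θ₀)) :
    MemLp (fun ω => selInd A ν i ω * ((pi ν i ω)⁻¹ * g (Y ν i ω))) 2 P := by
  have hms : AEStronglyMeasurable (fun ω => selInd A ν i ω * ((pi ν i ω)⁻¹ * g (Y ν i ω))) P :=
    ((hs.measurable_selInd ν i).mul ((hs.measurable_pi ν i).inv.mul
      (hg.comp (hs.measurable_Y ν i)))).aestronglyMeasurable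
  rw [memLp_two_iff_integrable_sq hms]
  refine (hs.integral_sel_weight_pow hb (hg.pow_const 2) hgi 2).1.congr
    (Eventually.of_forall fun ω => ?_)
  have := selInd_mul_self (A := A) ν i ω
  beta_reduce
  linear_combination (-(pi ν i ω)⁻¹ ^ 2 * g (Y ν i ω) ^ 2) * this

open Classical in
/-- The covariance of two weighted means of centred variables. -/
theorem covariance_scaledSum (hs : PoissonSurvey P μ f B θ₀ N Y pi A VS) {ν : ℕ} {b : ℝ}
    (hb : ∀ i, ∀ᵐ ω ∂P, (pi ν i ω)⁻¹ ≤ b) {g h : 𝓨 → ℝ} (hg : Measurable g) (hh : Measurable h)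
    (hgi : Integrable g (modelLaw μ f θ₀))
    (hgi2 : Integrable (fun y => g y ^ 2) (modelLaw μ f θ₀))
    (hhi2 : Integrable (fun y => h y ^ 2) (modelLaw μ f θ₀))
    (hghi : Integrable (fun y => g y * h y) (modelLaw μ f θ₀))
    (hg0 : ∫ y, g y ∂modelLaw μ f θ₀ = 0) :
    cov[fun ω => scaledSum (expSize P (pi ν)) (A ν ω) (fun i => pi ν i ω) (fun i => Y ν i ω) 0 g,
      fun ω => scaledSum (expSize P (pi ν)) (A ν ω) (fun i => pi ν i ω) (fun i => Y ν i ω) 0 h; P] =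
      1 / (N ν : ℝ) ^ 2 * ∑ i, ∫ ω, (pi ν i ω)⁻¹ * (g (Y ν i ω) * h (Y ν i ω)) ∂P := by
  let φ : (𝓨 → ℝ) → 𝓨 × ℝ × Prop → ℝ := fun g p => (if p.2.2 then 1 else 0) * (p.2.1⁻¹ * g p.1)
  have hφ : ∀ g : 𝓨 → ℝ, Measurable g → Measurable (φ g) := fun g hg =>
    (Measurable.ite (measurableSet_setOfPred.2 measurable_snd.snd) measurable_const
      measurable_const).mul (measurable_snd.fst.inv.mul (hg.comp measurable_fst))
  have hφe : ∀ g i, (φ g ∘ fun ω => (Y ν i ω, pi ν i ω, i ∈ A ν ω)) =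
      fun ω => selInd A ν i ω * ((pi ν i ω)⁻¹ * g (Y ν i ω)) := by
    intro g i
    ext ω
    simp only [φ, selInd, Function.comp_apply]
    congr
  have hLg := fun i => hs.memLp_sel_weight (hb i) hg hgi2
  have hLh := fun i => hs.memLp_sel_weight (hb i) hh hhi2
  have he : ∀ g : 𝓨 → ℝ, (fun ω => scaledSum (expSize P (pi ν)) (A ν ω) (fun i => pi ν i ω)
      (fun i => Y ν i ω) 0 g) = fun ω => (N ν : ℝ)⁻¹ *
        ∑ i, selInd A ν i ω * ((pi ν i ω)⁻¹ * g (Y ν i ω)) := by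
    intro g
    ext ω
    rw [sum_selInd, scaledSum_zero]
  rw [he g, he h, covariance_const_mul_left, covariance_const_mul_right,
    covariance_fun_sum_fun_sum hLg hLh, ← mul_assoc]
  congr 1
  · ring
  refine Finset.sum_congr rfl fun i _ => ?_
  -- Off-diagonal covariances vanish by independence. On the diagonal the first factor has mean zero
  -- and one of the two weights is absorbed.
  rw [Finset.sum_eq_single i]
  · have h1 : ∫ ω, selInd A ν i ω * ((pi ν i ω)⁻¹ * g (Y ν i ω)) ∂P = 0 := by
      have := (hs.integral_sel_weight_pow (hb i) hg hgi 0).2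
      simp only [zero_add, pow_one, pow_zero, one_mul] at this
      rw [this, hs.integral_comp hgi, hg0]
    rw [covariance_eq_sub (hLg i) (hLh i), h1, zero_mul, sub_zero]
    have h2 := (hs.integral_sel_weight_pow (hb i) (hg.mul hh) hghi 1).2
    simp only [pow_one, Pi.mul_apply] at h2
    rw [← h2]
    refine integral_congr_ae (Eventually.of_forall fun ω => ?_)
    have := selInd_mul_self (A := A) ν i ω
    simp only [Pi.mul_apply]
    linear_combination ((pi ν i ω)⁻¹ ^ 2 * g (Y ν i ω) * h (Y ν i ω)) * this
  · intro j _ hji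
    refine IndepFun.covariance_eq_zero ?_ (hLg i) (hLh j)
    have := ((hs.indep ν).indepFun hji.symm).comp (hφ g hg) (hφ h hh)
    rwa [hφe, hφe] at this
  · simp

/-- `n₀ N⁻² ∑_{i ∈ A} wᵢ² Sⱼ(yᵢ) Sₖ(yᵢ)` converges to the limit of `n₀ cov(Ŝⱼ, Ŝₖ)`. -/
theorem tendsto_score_products (hs : PoissonSurvey P μ f B θ₀ N Y pi A VS)
    (hm : RegularModel μ f Θ B θ₀) (j k : Fin r ⊕ Fin q) :
    Tendsto (fun x : Σ _ : ℕ, Ω => scaledSum (expSize P (pi x.1)) (A x.1 x.2)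
      (fun i => pi x.1 i x.2) (fun i => Y x.1 i x.2) 1
        fun y => score f θ₀ y j * score f θ₀ y k) (surveyFilter P) (𝓝 (VS θ₀ j k)) := by
  have hmj := hm.measurable_score_apply hm.interior j
  have hmk := hm.measurable_score_apply hm.interior k
  have hprod : ∀ j k, Integrable (fun y => score f θ₀ y j * score f θ₀ y k) (modelLaw μ f θ₀) := by
    intro j k
    refine (hm.integrable_norm_score_pow (k := 2) (by norm_num)).mono'
      ((hm.measurable_score_apply hm.interior j).mul
        (hm.measurable_score_apply hm.interior k)).aestronglyMeasurable
      (Eventually.of_forall fun y => ?_)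
    rw [norm_mul, sq]
    exact mul_le_mul (abs_apply_le_norm _ j) (abs_apply_le_norm _ k) (norm_nonneg _)
      (norm_nonneg _)
  have hi2 : Integrable (fun y => (score f θ₀ y j * score f θ₀ y k) ^ 2) (modelLaw μ f θ₀) := by
    refine (hm.integrable_norm_score_pow (k := 4) (by norm_num)).mono'
      ((hmj.mul hmk).pow_const 2).aestronglyMeasurable (Eventually.of_forall fun y => ?_)
    have h1 := mul_le_mul (abs_apply_le_norm (score f θ₀ y) j)
      (abs_apply_le_norm (score f θ₀ y) k) (abs_nonneg _) (norm_nonneg _)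
    rw [Real.norm_eq_abs, abs_pow, abs_mul]
    calc _ ≤ (‖score f θ₀ y‖ * ‖score f θ₀ y‖) ^ 2 :=
          pow_le_pow_left₀ (by positivity) h1 2
      _ = _ := by ring
  -- With squared weights the means are not model integrals, since πᵢ may depend on yᵢ; their limit
  -- is identified by the covariance formula with the assumed limit of n₀ cov. Fourth moments of the
  -- score enter through the variance bound.
  have h1 := hs.tendsto_scaledSum_sub (g := fun _ y => score f θ₀ y j * score f θ₀ y k)
    (fun _ => hmj.mul hmk) (fun _ => hprod j k) (fun _ => hi2)
    (tendsto_const_nhds.div_atTop hs.size_tendsto) 1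
  have h2 := ((hs.score_var θ₀ hm.interior).2 j k).comp
      (tendsto_fst_kernelFilter (κ := fun _ => P))
  have h3 := h1.add h2
  rw [zero_add] at h3
  refine h3.congr' ?_
  obtain ⟨C, -, hC⟩ := hs.eventually_weight_bound
  filter_upwards [tendsto_fst_kernelFilter.eventually hC] with x hx
  have h4 := hs.covariance_scaledSum hx.2.2 hmj hmk (hm.integrable_score_apply j)
    (by simpa only [sq] using hprod j j)
    (by simpa only [sq] using hprod k k) (hprod j k) (hm.integral_score_eq_zero j)
  simp only [Function.comp_apply, wScore_apply (expSize P (pi x.1))]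
  rw [h4]
  simp only [pow_one, Nat.reduceAdd]
  ring

/-- Third absolute moments of the weighted scores are of smaller order than `√n₀`. -/
theorem tendsto_score_cubes (hs : PoissonSurvey P μ f B θ₀ N Y pi A VS)
    (hm : RegularModel μ f Θ B θ₀) :
    Tendsto (fun x : Σ _ : ℕ, Ω => (Real.sqrt (expSize P (pi x.1)))⁻¹ *
      scaledSum (expSize P (pi x.1)) (A x.1 x.2) (fun i => pi x.1 i x.2) (fun i => Y x.1 i x.2) 2
        fun y => ‖score f θ₀ y‖ ^ 3) (surveyFilter P) (𝓝 0) := by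
  refine (hs.tight_scaledSum ((hm.measurable_score hm.interior).norm.pow_const 3)
    (hm.integrable_norm_score_pow (by norm_num)) 2).boundedAlong _ ?_
  exact tendsto_inv_atTop_zero.comp (Real.tendsto_sqrt_atTop.comp hs.tendsto_size)

/-- The normalized weighted score is bounded in probability. -/
theorem tight_score (hs : PoissonSurvey P μ f B θ₀ N Y pi A VS)
    (hm : RegularModel μ f Θ B θ₀) (j : Fin r ⊕ Fin q) :
    TightAlong atTop (fun _ => P) fun x : Σ _ : ℕ, Ω => Real.sqrt (expSize P (pi x.1)) *
      wScore f (A x.1 x.2) (fun i => (pi x.1 i x.2)⁻¹) (fun i => Y x.1 i x.2) θ₀ j := by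
  have hmj := hm.measurable_score_apply hm.interior j
  have hi2 : Integrable (fun y => score f θ₀ y j ^ 2) (modelLaw μ f θ₀) := by
    refine (hm.integrable_norm_score_pow (k := 2) (by norm_num)).mono'
      (hmj.pow_const 2).aestronglyMeasurable (Eventually.of_forall fun y => ?_)
    rw [norm_pow]
    exact pow_le_pow_left₀ (norm_nonneg _) (abs_apply_le_norm _ j) 2
  have hlim := (hs.score_var θ₀ hm.interior).2 j j
  refine TightAlong.of_sq (tightAlong_of_integral (VS θ₀ j j + 1) ?_)
  obtain ⟨C, hC, hb⟩ := hs.eventually_weight_bound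
  filter_upwards [hb, hlim.eventually (gt_mem_nhds (lt_add_one _))] with ν hν h1
  set X : Ω → ℝ := fun ω => wScore f (A ν ω) (fun i => (pi ν i ω)⁻¹) (fun i => Y ν i ω) θ₀ j
    with hX
  have hXe : X = fun ω => scaledSum (expSize P (pi ν)) (A ν ω) (fun i => pi ν i ω)
      (fun i => Y ν i ω) 0 fun y => score f θ₀ y j := by
    ext ω
    exact wScore_apply (expSize P (pi ν)) _ _ _ _ _
  obtain ⟨hi, hmean⟩ := hs.integral_scaledSum hν.2.2 hmj (hm.integrable_score_apply j) 0
  rw [← hXe] at hi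
  have hmean0 : ∫ ω, X ω ∂P = 0 := by
    have h2 : ∀ i, ∫ ω, (pi ν i ω)⁻¹ ^ 0 * score f θ₀ (Y ν i ω) j ∂P = 0 := by
      intro i
      simp only [pow_zero, one_mul]
      rw [hs.integral_comp (hm.integrable_score_apply j), hm.integral_score_eq_zero]
    rw [hXe, hmean]
    simp only [h2, Finset.sum_const_zero, mul_zero]
  have hvar : Var[X; P] = ∫ ω, X ω ^ 2 ∂P := by
    rw [variance_eq_integral hi.aemeasurable, hmean0]
    simp only [sub_zero]
  rw [covariance_self hi.aemeasurable, hvar] at h1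
  have hsqi := (hs.integral_sq_scaledSum_sub_le hC hν.1 hν.2.1 hν.2.2 hmj hi2
    (hm.integrable_score_apply j) 0).1
  rw [← hmean, ← congrArg (fun X => ∫ ω, X ω ∂P) hXe, hmean0] at hsqi
  have hsqi' : Integrable (fun ω => X ω ^ 2) P := by
    rw [hXe]; simpa only [sub_zero] using hsqi
  have he : ∀ ω, (Real.sqrt (expSize P (pi ν)) * X ω) ^ 2 = expSize P (pi ν) * X ω ^ 2 := by
    intro ω
    rw [mul_pow, Real.sq_sqrt hν.1.le]
  refine ⟨?_, ?_⟩
  · change Integrable (fun ω => (Real.sqrt (expSize P (pi ν)) * X ω) ^ 2) P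
    simp only [he]
    exact hsqi'.const_mul _
  · change ∫ ω, |(Real.sqrt (expSize P (pi ν)) * X ω) ^ 2| ∂P ≤ _
    simp only [he, abs_of_nonneg (mul_nonneg hν.1.le (sq_nonneg _))]
    rw [integral_const_mul]
    exact h1.le

end PoissonSurvey

end SurveyLaws

/-! ### The characteristic function of bootstrap sums -/

section BootstrapCharFun

/-- Taylor's estimate for |t| ≤ 1 and the triangle inequality for |t| ≥ 1; the constant 4 serves
both ranges. -/
theorem norm_cexp_sub_taylor_le (t : ℝ) :
    ‖Complex.exp (t * Complex.I) - 1 - (t * Complex.I - t ^ 2 / 2)‖ ≤ 4 * |t| ^ 3 := by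
  rcases le_total |t| 1 with h | h
  · have h1 : ‖(t * Complex.I : ℂ)‖ ≤ 1 := by simpa using h
    have h2 := Complex.exp_bound h1 (n := 3) (by norm_num)
    simp only [Finset.sum_range_succ, Finset.sum_range_zero, Nat.factorial] at h2
    have h3 : ‖(t * Complex.I : ℂ)‖ = |t| := by simp
    rw [h3] at h2
    have h4 : Complex.exp (t * Complex.I) - 1 - (t * Complex.I - t ^ 2 / 2) =
        Complex.exp (t * Complex.I) - (0 + (t * Complex.I) ^ 0 / (1 : ℕ) +
          (t * Complex.I) ^ 1 / ((0 + 1) * 1 : ℕ) + (t * Complex.I) ^ 2 / ((1 + 1) * ((0 + 1) * 1) : ℕ)) := by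
      push_cast
      have := Complex.I_sq
      linear_combination ((t : ℂ) ^ 2 / 2) * this
    rw [h4]
    refine h2.trans ?_
    have : 0 ≤ |t| ^ 3 := by positivity
    norm_num
    nlinarith
  · have h1 : ‖Complex.exp (t * Complex.I)‖ = 1 := Complex.norm_exp_ofReal_mul_I t
    have h2 : ‖Complex.exp (t * Complex.I) - 1 - (t * Complex.I - t ^ 2 / 2)‖ ≤
        1 + 1 + (|t| + |t| ^ 2 / 2) := by
      refine (norm_sub_le _ _).trans (add_le_add ((norm_sub_le _ _).trans ?_)
        ((norm_sub_le _ _).trans ?_))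
      · rw [h1]; simp
      · simp
    refine h2.trans ?_
    nlinarith [pow_nonneg (abs_nonneg t) 2, mul_nonneg (sub_nonneg.2 h) (sub_nonneg.2 h),
      mul_nonneg (mul_nonneg (sub_nonneg.2 h) (sub_nonneg.2 h)) (sub_nonneg.2 h)]

variable {γ : Type*} {l : Filter γ} {n : γ → ℕ} {A : ∀ x, Finset (Fin (n x))}
  {b : ∀ x, Fin (n x) → ℝ} {R : γ → ℝ} {σ : ℝ}

/-- A triangular array of powers `(1 + z)^n`, with `z` a weighted sum of `exp(i b) - 1`, has a
Gaussian limit after centring. -/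
theorem tendsto_exp_mul_one_add_pow (hn : Tendsto (fun x => (n x : ℝ)) l atTop)
    (hR : Tendsto (fun x => (n x : ℝ) * R x) l (𝓝 1))
    (h1 : BoundedAlong l fun x => ∑ i ∈ A x, b x i)
    (h2 : Tendsto (fun x => ∑ i ∈ A x, b x i ^ 2) l (𝓝 σ))
    (h3 : Tendsto (fun x => ∑ i ∈ A x, |b x i| ^ 3) l (𝓝 0)) :
    Tendsto (fun x => Complex.exp (-((∑ i ∈ A x, b x i : ℝ) : ℂ) * Complex.I) *
      (1 + (R x : ℂ) * ∑ i ∈ A x, (Complex.exp (b x i * Complex.I) - 1)) ^ n x) l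
      (𝓝 (Complex.exp (-(σ : ℂ) / 2))) := by
  set T : γ → ℝ := fun x => ∑ i ∈ A x, b x i with hT
  set Q : γ → ℝ := fun x => ∑ i ∈ A x, b x i ^ 2 with hQ
  set ρ : γ → ℝ := fun x => (n x : ℝ) * R x with hρ
  let D : γ → ℂ := fun x => ∑ i ∈ A x, (Complex.exp (b x i * Complex.I) - 1 -
    (b x i * Complex.I - b x i ^ 2 / 2))
  let z : γ → ℂ := fun x => (R x : ℂ) * ∑ i ∈ A x, (Complex.exp (b x i * Complex.I) - 1)
  have hD : Tendsto D l (𝓝 0) := by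
    refine squeeze_zero_norm (a := fun x => 4 * ∑ i ∈ A x, |b x i| ^ 3) (fun x => ?_)
      (by simpa using h3.const_mul 4)
    refine (norm_sum_le _ _).trans ?_
    rw [Finset.mul_sum]
    exact Finset.sum_le_sum fun i _ => norm_cexp_sub_taylor_le _
  -- T is the drift, Q the variance and D the third-order error; the factor ρ = nR tends to 1.
  have hz : ∀ x, (n x : ℂ) * z x =
      (ρ x : ℂ) * ((T x : ℂ) * Complex.I - (Q x : ℂ) / 2 + D x) := by
    intro x
    simp only [z, D, hT, hQ, hρ, Finset.sum_sub_distrib]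
    push_cast
    rw [← Finset.sum_mul, ← Finset.sum_div]
    ring
  change Tendsto (fun x => Complex.exp (-(T x : ℂ) * Complex.I) * (1 + z x) ^ n x) l _
  clear_value D z T
  have hzb : BoundedAlong l fun x => ‖(n x : ℂ) * z x‖ := by
    have hb : BoundedAlong l fun x => ρ x * (|T x| + (Q x / 2 + ‖D x‖)) :=
      (BoundedAlong.of_tendsto hR).mul ((h1.mono (Eventually.of_forall fun x => by rw [abs_abs])).add
        (BoundedAlong.of_tendsto ((h2.div_const 2).add hD.norm)))
    refine hb.mono (Eventually.of_forall fun x => ?_)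
    have hQ0 : 0 ≤ Q x := Finset.sum_nonneg fun i _ => sq_nonneg _
    rw [abs_norm, hz, norm_mul, abs_mul, Complex.norm_real, Real.norm_eq_abs,
      abs_of_nonneg (by positivity : 0 ≤ |T x| + (Q x / 2 + ‖D x‖))]
    refine mul_le_mul_of_nonneg_left ?_ (abs_nonneg _)
    refine (norm_add_le _ _).trans ?_
    have h4 := norm_sub_le ((T x : ℂ) * Complex.I) ((Q x : ℂ) / 2)
    have h5 : ‖(T x : ℂ) * Complex.I‖ = |T x| := by simp
    have h6 : ‖(Q x : ℂ) / 2‖ = Q x / 2 := by simp [abs_of_nonneg hQ0]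
    rw [h5, h6] at h4
    linarith
  have hinv : Tendsto (fun x => ((n x : ℝ))⁻¹) l (𝓝 0) := tendsto_inv_atTop_zero.comp hn
  have hz0 : Tendsto (fun x => ‖z x‖) l (𝓝 0) := by
    refine (hzb _ hinv).congr' ?_
    filter_upwards [hn.eventually_gt_atTop 0] with x hx
    rw [norm_mul, Complex.norm_natCast, ← mul_assoc, inv_mul_cancel₀ hx.ne', one_mul]
  have hzz : Tendsto (fun x => (n x : ℝ) * ‖z x‖ ^ 2) l (𝓝 0) := by
    refine (hzb _ hz0).congr fun x => ?_
    beta_reduce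
    rw [norm_mul, Complex.norm_natCast]
    ring
  -- log(1 + z) = z + O(|z|²), and n|z|² = |nz|·|z| → 0 because nz is bounded along the filter and
  -- so z → 0.
  have hlog : Tendsto (fun x => (n x : ℂ) * (Complex.log (1 + z x) - z x)) l (𝓝 0) := by
    refine squeeze_zero_norm' ?_ hzz
    filter_upwards [hz0.eventually (gt_mem_nhds (by norm_num : (0 : ℝ) < 1 / 2))] with x hx
    rw [norm_mul, Complex.norm_natCast]
    refine mul_le_mul_of_nonneg_left
      ((Complex.norm_log_one_add_sub_self_le (by linarith)).trans ?_) (Nat.cast_nonneg _)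
    have h4 : (1 - ‖z x‖)⁻¹ ≤ 2 := by
      rw [inv_le_comm₀ (by linarith) (by norm_num)]
      linarith
    nlinarith [sq_nonneg ‖z x‖]
  have hρc : Tendsto (fun x => (ρ x : ℂ)) l (𝓝 1) :=
    (Complex.continuous_ofReal.tendsto' 1 1 Complex.ofReal_one).comp hR
  -- The centring uses T instead of ρT; the discrepancy (ρ − 1)T vanishes because T is bounded along
  -- the filter.
  have hlin : Tendsto (fun x => (((ρ x - 1) * T x : ℝ) : ℂ)) l (𝓝 0) := by
    have := h1 (fun x => ρ x - 1) (by simpa using hR.sub_const 1)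
    exact (Complex.continuous_ofReal.tendsto' 0 0 Complex.ofReal_zero).comp this
  have hQc : Tendsto (fun x => (Q x : ℂ)) l (𝓝 σ) := (Complex.continuous_ofReal.tendsto σ).comp h2
  have hexp : Tendsto (fun x => (((ρ x - 1) * T x : ℝ) : ℂ) * Complex.I -
      (ρ x : ℂ) * ((Q x : ℂ) / 2) + (ρ x : ℂ) * D x +
      (n x : ℂ) * (Complex.log (1 + z x) - z x)) l (𝓝 (-(σ : ℂ) / 2)) := by
    have := (((hlin.mul_const Complex.I).sub (hρc.mul (hQc.div_const 2))).add
      (hρc.mul hD)).add hlog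
    refine this.trans (le_of_eq ?_)
    congr 1
    ring
  refine ((Complex.continuous_exp.tendsto _).comp hexp).congr' ?_
  filter_upwards [hz0.eventually (gt_mem_nhds (by norm_num : (0 : ℝ) < 1))] with x hx
  have hne : 1 + z x ≠ 0 := by
    intro h
    have : z x = -1 := by linear_combination h
    rw [this] at hx
    simp at hx
  rw [Function.comp_apply]
  rw [← Complex.exp_log hne, ← Complex.exp_nat_mul, ← Complex.exp_add, Complex.exp_log hne]
  congr 1
  have := hz x
  push_cast
  linear_combination -this

end BootstrapCharFun

/-! ### Mean squared error of bootstrap sums -/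

section BootstrapSecondMoment

variable {N : ℕ} {A : Finset (Fin N)} {pi : Fin N → ℝ}

/-- With ρ = N/W and t = Σ aᵢ, the bias is (ρ − 1)t and the variance is ρΣaᵢ² − Nt²/W², whose
negative part is dropped. -/
theorem integral_sq_linear_sub_le (hA : A.Nonempty) (h0 : ∀ i, 0 < pi i) (h1 : ∀ i, pi i ≤ 1)
    (a : Fin N → ℝ) :
    ∫ m, (∑ i ∈ A, a i * m i - ∑ i ∈ A, a i) ^ 2 ∂bootLaw A pi ≤
      N * (∑ j ∈ A, (pi j)⁻¹)⁻¹ * ∑ i ∈ A, a i ^ 2 +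
        (N * (∑ j ∈ A, (pi j)⁻¹)⁻¹ - 1) ^ 2 * (∑ i ∈ A, a i) ^ 2 := by
  have := isProbabilityMeasure_bootLaw hA h0 h1
  set t := ∑ i ∈ A, a i with ht
  set R := (∑ j ∈ A, (pi j)⁻¹)⁻¹ with hR
  have he : ∀ m : Fin N → ℕ, (∑ i ∈ A, a i * m i - t) ^ 2 =
      (∑ i ∈ A, a i * m i) ^ 2 - 2 * t * (∑ i ∈ A, a i * m i) + t ^ 2 := fun m => by ring
  simp only [he]
  rw [integral_add (integrable_bootLaw _) (integrable_bootLaw _),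
    integral_sub (integrable_bootLaw _) (integrable_bootLaw _), integral_const_mul,
    integral_linear_bootLaw hA h0 h1, integral_linear_sq_bootLaw hA h0 h1]
  simp only [integral_const, probReal_univ, one_smul]
  rw [← hR, ← ht]
  have : 0 ≤ N * R ^ 2 * t ^ 2 := by positivity
  nlinarith

end BootstrapSecondMoment

/-! ### Limits of bootstrap sums -/

section BootstrapLimits

open Matrix

variable {r q : ℕ} {𝓨 Ω : Type*} [MeasurableSpace 𝓨] [MeasurableSpace Ω]
  {P : Measure Ω} [IsProbabilityMeasure P]
  {μ : Measure 𝓨} {f : 𝓨 → Param r q → ℝ} {Θ B : Set (Param r q)} {θ₀ : Param r q}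
  {N : ℕ → ℕ} {Y : (ν : ℕ) → Fin (N ν) → Ω → 𝓨} {pi : (ν : ℕ) → Fin (N ν) → Ω → ℝ}
  {A : (ν : ℕ) → Ω → Finset (Fin (N ν))}
  {VS : Param r q → Matrix (Fin r ⊕ Fin q) (Fin r ⊕ Fin q) ℝ}

/-- The bootstrap law given the sample. -/
abbrev bootKernel (pi : (ν : ℕ) → Fin (N ν) → Ω → ℝ) (A : (ν : ℕ) → Ω → Finset (Fin (N ν)))
    (x : Σ _ : ℕ, Ω) : Measure (Fin (N x.1) → ℕ) :=
  bootLaw (A x.1 x.2) fun i => pi x.1 i x.2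

/-- The filter of convergence in bootstrap probability, in probability. -/
abbrev bootFilter (P : Measure Ω) (pi : (ν : ℕ) → Fin (N ν) → Ω → ℝ)
    (A : (ν : ℕ) → Ω → Finset (Fin (N ν))) : Filter (Σ x : (Σ _ : ℕ, Ω), (Fin (N x.1) → ℕ)) :=
  kernelFilter (surveyFilter P) (bootKernel pi A)

/-- The deviation of the bootstrap score from the weighted score, multiplied by the square root of
the sample size. -/
def scoreDev {n : ℕ} (f : 𝓨 → Param r q → ℝ) (A : Finset (Fin n)) (pi : Fin n → ℝ)
    (y : Fin n → 𝓨) (θ : Param r q) (m : Fin n → ℕ) : Param r q :=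
  Real.sqrt A.card • (wScore f A (fun i => (pi i)⁻¹ * m i) y θ - wScore f A (fun i => (pi i)⁻¹) y θ)

/-- The coefficients of a linear form of `scoreDev` as a function of the bootstrap counts. -/
def devCoef {n : ℕ} (f : 𝓨 → Param r q → ℝ) (A : Finset (Fin n)) (pi : Fin n → ℝ)
    (y : Fin n → 𝓨) (θ : Param r q) (v : Fin r ⊕ Fin q → ℝ) (i : Fin n) : ℝ :=
  Real.sqrt A.card * ((n : ℝ)⁻¹ * ((pi i)⁻¹ * (v ⬝ᵥ (score f θ (y i)).ofLp)))

theorem dotProduct_wScore {n : ℕ} (f : 𝓨 → Param r q → ℝ) (A : Finset (Fin n)) (w : Fin n → ℝ)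
    (y : Fin n → 𝓨) (θ : Param r q) (v : Fin r ⊕ Fin q → ℝ) :
    v ⬝ᵥ (wScore f A w y θ).ofLp = (n : ℝ)⁻¹ * ∑ i ∈ A, w i * (v ⬝ᵥ (score f θ (y i)).ofLp) := by
  simp only [wScore, WithLp.ofLp_smul, WithLp.ofLp_sum, dotProduct_smul, dotProduct_sum,
    smul_eq_mul]

theorem sum_devCoef {n : ℕ} (f : 𝓨 → Param r q → ℝ) (A : Finset (Fin n)) (pi : Fin n → ℝ)
    (y : Fin n → 𝓨) (θ : Param r q) (v : Fin r ⊕ Fin q → ℝ) :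
    ∑ i ∈ A, devCoef f A pi y θ v i =
      Real.sqrt A.card * (v ⬝ᵥ (wScore f A (fun i => (pi i)⁻¹) y θ).ofLp) := by
  rw [dotProduct_wScore]
  simp only [devCoef, ← Finset.mul_sum]

theorem dotProduct_scoreDev {n : ℕ} (f : 𝓨 → Param r q → ℝ) (A : Finset (Fin n)) (pi : Fin n → ℝ)
    (y : Fin n → 𝓨) (θ : Param r q) (v : Fin r ⊕ Fin q → ℝ) (m : Fin n → ℕ) :
    v ⬝ᵥ (scoreDev f A pi y θ m).ofLp =
      ∑ i ∈ A, devCoef f A pi y θ v i * m i - ∑ i ∈ A, devCoef f A pi y θ v i := by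
  rw [sum_devCoef, scoreDev, WithLp.ofLp_smul, WithLp.ofLp_sub, dotProduct_smul, dotProduct_sub,
    dotProduct_wScore f A (fun i => (pi i)⁻¹ * m i), smul_eq_mul, mul_sub]
  congr 1
  simp only [devCoef, Finset.mul_sum]
  exact Finset.sum_congr rfl fun i _ => by ring

namespace PoissonSurvey

theorem eventually_card (hs : PoissonSurvey P μ f B θ₀ N Y pi A VS) :
    ∀ᶠ x in surveyFilter P, 0 < expSize P (pi x.1) ∧ 0 < (N x.1 : ℝ) ∧ (A x.1 x.2).Nonempty := by
  filter_upwards [hs.tendsto_size.eventually_gt_atTop 0,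
    hs.tendsto_population.eventually_gt_atTop 0,
    hs.tendsto_card.eventually (lt_mem_nhds (by norm_num : (0 : ℝ) < 1))] with x h1 h2 h3
  refine ⟨h1, h2, Finset.card_pos.1 ?_⟩
  rw [lt_div_iff₀ h1, zero_mul] at h3
  exact_mod_cast h3

/-- The law of large numbers for g = 1: the total weight W estimates the population size. -/
theorem tendsto_weight_ratio (hs : PoissonSurvey P μ f B θ₀ N Y pi A VS)
    (hm : RegularModel μ f Θ B θ₀) :
    Tendsto (fun x : Σ _ : ℕ, Ω => (N x.1 : ℝ) * (∑ j ∈ A x.1 x.2, (pi x.1 j x.2)⁻¹)⁻¹)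
      (surveyFilter P) (𝓝 1) := by
  have := hm.isProbabilityMeasure
  have h := hs.weightedLLN hm (fun _ => 1) (integrable_const 1)
  simp only [integral_const, probReal_univ, smul_eq_mul, mul_one] at h
  have h2 := h.inv₀ one_ne_zero
  rw [inv_one] at h2
  refine h2.congr fun x => ?_
  have h3 := sum_popWeight (A x.1 x.2) (fun i => (pi x.1 i x.2)⁻¹) fun _ => 1
  simp only [mul_one] at h3
  rw [h3, mul_inv, inv_inv]

/-- The sum is at most level²/n₀ times n₀N⁻²Σwᵢ², which is tight. -/
theorem tendsto_scaledSum_sq_truncate (hs : PoissonSurvey P μ f B θ₀ N Y pi A VS)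
    (hm : RegularModel μ f Θ B θ₀) (g : 𝓨 → ℝ) :
    Tendsto (fun x : Σ _ : ℕ, Ω => ∑ i ∈ A x.1 x.2, ((N x.1 : ℝ)⁻¹ * ((pi x.1 i x.2)⁻¹ *
      truncate (level P pi x.1) g (Y x.1 i x.2))) ^ 2) (surveyFilter P) (𝓝 0) := by
  have := hm.isProbabilityMeasure
  have h1 := (hs.tight_scaledSum (g := fun _ => 1) measurable_const (integrable_const 1)
    1).boundedAlong _ (hs.tendsto_level_sq_div.comp tendsto_fst_kernelFilter)
  refine squeeze_zero' (Eventually.of_forall fun x => Finset.sum_nonneg fun i _ => sq_nonneg _)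
    ?_ h1
  filter_upwards [hs.eventually_card] with x hx
  have hn := hx.1
  rw [Function.comp_apply, scaledSum]
  have h2 : level P pi x.1 ^ 2 / expSize P (pi x.1) * (expSize P (pi x.1) ^ 1 /
      (N x.1 : ℝ) ^ (1 + 1) * ∑ i ∈ A x.1 x.2, (pi x.1 i x.2)⁻¹ ^ (1 + 1) * 1) =
      ∑ i ∈ A x.1 x.2, ((N x.1 : ℝ)⁻¹ * ((pi x.1 i x.2)⁻¹ * level P pi x.1)) ^ 2 := by
    rw [Finset.mul_sum, Finset.mul_sum]
    refine Finset.sum_congr rfl fun i _ => ?_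
    simp only [Nat.reduceAdd, mul_one, pow_one]
    field_simp
  rw [h2]
  refine Finset.sum_le_sum fun i _ => ?_
  rw [mul_pow, mul_pow, mul_pow, mul_pow, ← sq_abs (truncate _ _ _)]
  gcongr
  exact abs_truncate_le (level_nonneg _) _ _

theorem eventually_bootstrap_comp_eq (hs : PoissonSurvey P μ f B θ₀ N Y pi A VS) {g g' : 𝓨 → ℝ}
    (h : g =ᵐ[modelLaw μ f θ₀] g') :
    ∀ᶠ z in bootFilter P pi A, ∀ i, g (Y z.1.1 i z.1.2) = g' (Y z.1.1 i z.1.2) :=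
  tendsto_fst_kernelFilter.eventually (hs.eventually_comp_eq h)

/-- The conditional mean is N/W times the same sum with all counts equal to 1, which is small;
Markov's inequality is applied conditionally. -/
theorem tendsto_bootstrap_tail (hs : PoissonSurvey P μ f B θ₀ N Y pi A VS)
    (hm : RegularModel μ f Θ B θ₀) {g : 𝓨 → ℝ} (hg : Measurable g)
    (hgi : Integrable g (modelLaw μ f θ₀)) :
    Tendsto (fun z : Σ x : (Σ _ : ℕ, Ω), (Fin (N x.1) → ℕ) => ∑ i ∈ A z.1.1 z.1.2,
      ((N z.1.1 : ℝ)⁻¹ * ((pi z.1.1 i z.1.2)⁻¹ * |g (Y z.1.1 i z.1.2) -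
        truncate (level P pi z.1.1) g (Y z.1.1 i z.1.2)|)) * z.2 i) (bootFilter P pi A) (𝓝 0) := by
  have h1 := (hs.tendsto_weight_ratio hm).mul (hs.tendsto_scaledSum_tail hg hgi)
  rw [mul_zero] at h1
  refine tendsto_kernelFilter_of_integral (Eventually.of_forall fun x => integrable_bootLaw _)
    (h1.congr' ?_)
  filter_upwards [hs.eventually_card] with x hx
  have h2 := integral_linear_bootLaw hx.2.2 (fun i => hs.pi_pos x.1 i x.2)
    (fun i => hs.pi_le_one x.1 i x.2) fun i => (N x.1 : ℝ)⁻¹ * ((pi x.1 i x.2)⁻¹ *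
      |g (Y x.1 i x.2) - truncate (level P pi x.1) g (Y x.1 i x.2)|)
  rw [scaledSum_zero, Finset.mul_sum]
  refine h2.symm.trans (integral_congr_ae (Eventually.of_forall fun m => ?_))
  refine (abs_of_nonneg (Finset.sum_nonneg fun i _ => ?_)).symm
  have := (hs.pi_pos x.1 i x.2).le
  positivity

/-- Given the sample, the bootstrap sum of the truncated function is close in mean square to the
sample sum: the variance tends to 0 with level²/n₀, and the bias is proportional to N/W − 1. -/
theorem tendsto_bootstrap_truncate (hs : PoissonSurvey P μ f B θ₀ N Y pi A VS)
    (hm : RegularModel μ f Θ B θ₀) {g : 𝓨 → ℝ} (hg : Measurable g)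
    (hgi : Integrable g (modelLaw μ f θ₀)) :
    Tendsto (fun z : Σ x : (Σ _ : ℕ, Ω), (Fin (N x.1) → ℕ) => ∑ i ∈ A z.1.1 z.1.2,
      ((N z.1.1 : ℝ)⁻¹ * ((pi z.1.1 i z.1.2)⁻¹ *
        truncate (level P pi z.1.1) g (Y z.1.1 i z.1.2))) * z.2 i) (bootFilter P pi A)
      (𝓝 (∫ y, g y ∂modelLaw μ f θ₀)) := by
  have hρ := hs.tendsto_weight_ratio hm
  have ht := hs.tendsto_scaledSum_truncate hm hg hgi
  have h1 := (hρ.mul (hs.tendsto_scaledSum_sq_truncate hm g)).add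
    (((hρ.sub_const 1).pow 2).mul (ht.pow 2))
  simp only [mul_zero, sub_self, ne_eq, OfNat.ofNat_ne_zero, not_false_eq_true, zero_pow, zero_mul,
    add_zero] at h1
  have h2 : Tendsto (fun z : Σ x : (Σ _ : ℕ, Ω), (Fin (N x.1) → ℕ) => ∑ i ∈ A z.1.1 z.1.2,
      ((N z.1.1 : ℝ)⁻¹ * ((pi z.1.1 i z.1.2)⁻¹ *
        truncate (level P pi z.1.1) g (Y z.1.1 i z.1.2))) * z.2 i - ∑ i ∈ A z.1.1 z.1.2,
      ((N z.1.1 : ℝ)⁻¹ * ((pi z.1.1 i z.1.2)⁻¹ *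
        truncate (level P pi z.1.1) g (Y z.1.1 i z.1.2)))) (bootFilter P pi A) (𝓝 0) := by
    refine tendsto_kernelFilter_of_sq (Eventually.of_forall fun x => integrable_bootLaw _)
      (squeeze_zero' (Eventually.of_forall fun x => integral_nonneg fun _ => sq_nonneg _) ?_ h1)
    filter_upwards [hs.eventually_card] with x hx
    have h3 : scaledSum (expSize P (pi x.1)) (A x.1 x.2) (fun i => pi x.1 i x.2)
        (fun i => Y x.1 i x.2) 0 (truncate (level P pi x.1) g) = ∑ i ∈ A x.1 x.2, (N x.1 : ℝ)⁻¹ *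
          ((pi x.1 i x.2)⁻¹ * truncate (level P pi x.1) g (Y x.1 i x.2)) := by
      rw [scaledSum_zero, Finset.mul_sum]
    rw [h3]
    exact integral_sq_linear_sub_le hx.2.2 (fun i => hs.pi_pos x.1 i x.2)
      (fun i => hs.pi_le_one x.1 i x.2) _
  rw [← zero_add (∫ y, g y ∂modelLaw μ f θ₀)]
  refine (h2.add (ht.comp tendsto_fst_kernelFilter)).congr fun z => ?_
  rw [Function.comp_apply, scaledSum_zero, Finset.mul_sum, sub_add_cancel]

theorem bootstrap_weightedLLN (hs : PoissonSurvey P μ f B θ₀ N Y pi A VS)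
    (hm : RegularModel μ f Θ B θ₀) :
    WeightedLLN (modelLaw μ f θ₀) (bootFilter P pi A) (n := fun z => N z.1.1)
      (fun z => popWeight (A z.1.1 z.1.2) fun i => (pi z.1.1 i z.1.2)⁻¹ * z.2 i)
      (fun z i => Y z.1.1 i z.1.2) := by
  intro g hgi
  obtain ⟨g', hg'm, hgg'⟩ := hgi.aestronglyMeasurable
  have hg' := hg'm.measurable
  have hgi' := hgi.congr hgg'
  have h1 : Tendsto (fun z : Σ x : (Σ _ : ℕ, Ω), (Fin (N x.1) → ℕ) => ∑ i ∈ A z.1.1 z.1.2,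
      ((N z.1.1 : ℝ)⁻¹ * ((pi z.1.1 i z.1.2)⁻¹ * (g' (Y z.1.1 i z.1.2) -
        truncate (level P pi z.1.1) g' (Y z.1.1 i z.1.2)))) * z.2 i) (bootFilter P pi A) (𝓝 0) := by
    refine squeeze_zero_norm (fun z => (norm_sum_le _ _).trans (Finset.sum_le_sum fun i _ => ?_))
      (hs.tendsto_bootstrap_tail hm hg' hgi')
    have := (hs.pi_pos z.1.1 i z.1.2).le
    rw [norm_mul, norm_mul, norm_mul, Real.norm_eq_abs, Real.norm_eq_abs, Real.norm_eq_abs,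
      Real.norm_eq_abs, abs_of_nonneg (by positivity : 0 ≤ (N z.1.1 : ℝ)⁻¹),
      abs_of_nonneg (by positivity : 0 ≤ (pi z.1.1 i z.1.2)⁻¹), Nat.abs_cast]
  have h2 := h1.add (hs.tendsto_bootstrap_truncate hm hg' hgi')
  rw [zero_add, ← integral_congr_ae hgg'] at h2
  refine h2.congr' ?_
  filter_upwards [hs.eventually_bootstrap_comp_eq hgg'] with z hz
  rw [sum_popWeight, ← Finset.sum_add_distrib, Finset.mul_sum]
  refine Finset.sum_congr rfl fun i _ => ?_
  rw [hz i]
  ring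

end PoissonSurvey

end BootstrapLimits

/-! ### The bootstrap central limit theorem -/

section BootstrapCLT

open Matrix

variable {r q : ℕ} {𝓨 Ω : Type*} [MeasurableSpace 𝓨] [MeasurableSpace Ω]
  {P : Measure Ω} [IsProbabilityMeasure P]
  {μ : Measure 𝓨} {f : 𝓨 → Param r q → ℝ} {Θ B : Set (Param r q)} {θ₀ : Param r q}
  {N : ℕ → ℕ} {Y : (ν : ℕ) → Fin (N ν) → Ω → 𝓨} {pi : (ν : ℕ) → Fin (N ν) → Ω → ℝ}
  {A : (ν : ℕ) → Ω → Finset (Fin (N ν))}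
  {VS : Param r q → Matrix (Fin r ⊕ Fin q) (Fin r ⊕ Fin q) ℝ}

/-- The coefficients `devCoef` for the sample `x`. -/
def surveyCoef (f : 𝓨 → Param r q → ℝ) (Y : (ν : ℕ) → Fin (N ν) → Ω → 𝓨)
    (pi : (ν : ℕ) → Fin (N ν) → Ω → ℝ) (A : (ν : ℕ) → Ω → Finset (Fin (N ν))) (θ₀ : Param r q)
    (v : Fin r ⊕ Fin q → ℝ) (x : Σ _ : ℕ, Ω) (i : Fin (N x.1)) : ℝ :=
  devCoef f (A x.1 x.2) (fun i => pi x.1 i x.2) (fun i => Y x.1 i x.2) θ₀ v i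

/-- `scoreDev` for the sample and bootstrap counts `z`. -/
def surveyDev (f : 𝓨 → Param r q → ℝ) (Y : (ν : ℕ) → Fin (N ν) → Ω → 𝓨)
    (pi : (ν : ℕ) → Fin (N ν) → Ω → ℝ) (A : (ν : ℕ) → Ω → Finset (Fin (N ν))) (θ₀ : Param r q)
    (z : Σ x : (Σ _ : ℕ, Ω), (Fin (N x.1) → ℕ)) : Param r q :=
  scoreDev f (A z.1.1 z.1.2) (fun i => pi z.1.1 i z.1.2) (fun i => Y z.1.1 i z.1.2) θ₀ z.2

theorem dotProduct_surveyDev (v : Fin r ⊕ Fin q → ℝ)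
    (z : Σ x : (Σ _ : ℕ, Ω), (Fin (N x.1) → ℕ)) :
    v ⬝ᵥ (surveyDev f Y pi A θ₀ z).ofLp =
      ∑ i ∈ A z.1.1 z.1.2, surveyCoef f Y pi A θ₀ v z.1 i * z.2 i -
        ∑ i ∈ A z.1.1 z.1.2, surveyCoef f Y pi A θ₀ v z.1 i :=
  dotProduct_scoreDev f _ _ _ θ₀ v z.2

theorem abs_dotProduct_le_sum_mul_norm (v : Fin r ⊕ Fin q → ℝ) (s : Param r q) :
    |v ⬝ᵥ s.ofLp| ≤ (∑ j, |v j|) * ‖s‖ := by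
  rw [dotProduct, Finset.sum_mul]
  refine (Finset.abs_sum_le_sum_abs _ _).trans (Finset.sum_le_sum fun j _ => ?_)
  rw [abs_mul]
  exact mul_le_mul_of_nonneg_left (abs_apply_le_norm s j) (abs_nonneg _)

namespace PoissonSurvey

theorem tendsto_sqrt_card_ratio (hs : PoissonSurvey P μ f B θ₀ N Y pi A VS) :
    Tendsto (fun x : Σ _ : ℕ, Ω => Real.sqrt (A x.1 x.2).card / Real.sqrt (expSize P (pi x.1)))
      (surveyFilter P) (𝓝 1) := by
  have h := (Real.continuous_sqrt.tendsto 1).comp hs.tendsto_card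
  rw [Real.sqrt_one] at h
  exact h.congr fun x => Real.sqrt_div (Nat.cast_nonneg _) _

/-- `√n Ŝ_w(θ₀)` is tight. -/
theorem boundedAlong_score (hs : PoissonSurvey P μ f B θ₀ N Y pi A VS)
    (hm : RegularModel μ f Θ B θ₀) (j : Fin r ⊕ Fin q) :
    BoundedAlong (surveyFilter P) fun x : Σ _ : ℕ, Ω => Real.sqrt (A x.1 x.2).card *
      wScore f (A x.1 x.2) (fun i => (pi x.1 i x.2)⁻¹) (fun i => Y x.1 i x.2) θ₀ j := by
  refine ((BoundedAlong.of_tendsto hs.tendsto_sqrt_card_ratio).mul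
    (hs.tight_score hm j).boundedAlong).congr ?_
  filter_upwards [hs.eventually_card] with x hx
  have := (Real.sqrt_pos.2 hx.1).ne'
  field_simp

/-- `√n Ŝ_w(θ₀)` remains bounded if the bootstrap is adjoined. -/
theorem boundedAlong_bootstrap_score (hs : PoissonSurvey P μ f B θ₀ N Y pi A VS)
    (hm : RegularModel μ f Θ B θ₀) (j : Fin r ⊕ Fin q) :
    BoundedAlong (bootFilter P pi A) fun z => Real.sqrt (A z.1.1 z.1.2).card *
      wScore f (A z.1.1 z.1.2) (fun i => (pi z.1.1 i z.1.2)⁻¹) (fun i => Y z.1.1 i z.1.2) θ₀ j := by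
  refine ((BoundedAlong.of_tendsto
    (hs.tendsto_sqrt_card_ratio.comp tendsto_fst_kernelFilter)).mul
    (hs.tight_score hm j).boundedAlong_fst).congr ?_
  filter_upwards [tendsto_fst_kernelFilter.eventually hs.eventually_card] with z hz
  have := (Real.sqrt_pos.2 hz.1).ne'
  simp only [Function.comp_apply]
  field_simp

theorem boundedAlong_sum_coef (hs : PoissonSurvey P μ f B θ₀ N Y pi A VS)
    (hm : RegularModel μ f Θ B θ₀) (v : Fin r ⊕ Fin q → ℝ) :
    BoundedAlong (surveyFilter P) fun x : Σ _ : ℕ, Ω =>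
      ∑ i ∈ A x.1 x.2, surveyCoef f Y pi A θ₀ v x i := by
  refine (BoundedAlong.sum Finset.univ fun j _ =>
    (BoundedAlong.const (v j)).mul (hs.boundedAlong_score hm j)).congr
    (Eventually.of_forall fun x => ?_)
  simp only [surveyCoef]
  rw [sum_devCoef, dotProduct, Finset.mul_sum]
  exact Finset.sum_congr rfl fun j _ => by ring

/-- This is asymptotically the conditional variance of the linear form: n/n₀ → 1 times the
normalized sums of squared weights and score products, whose limits are the entries of Σ_S. -/
theorem tendsto_sum_coef_sq (hs : PoissonSurvey P μ f B θ₀ N Y pi A VS)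
    (hm : RegularModel μ f Θ B θ₀) (v : Fin r ⊕ Fin q → ℝ) :
    Tendsto (fun x : Σ _ : ℕ, Ω => ∑ i ∈ A x.1 x.2, surveyCoef f Y pi A θ₀ v x i ^ 2)
      (surveyFilter P) (𝓝 (v ⬝ᵥ (VS θ₀ *ᵥ v))) := by
  have h1 : Tendsto (fun x : Σ _ : ℕ, Ω => ((A x.1 x.2).card : ℝ) / expSize P (pi x.1) *
      ∑ j, ∑ k, v j * (v k * scaledSum (expSize P (pi x.1)) (A x.1 x.2)
        (fun i => pi x.1 i x.2) (fun i => Y x.1 i x.2) 1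
          fun y => score f θ₀ y j * score f θ₀ y k)) (surveyFilter P)
      (𝓝 (1 * ∑ j, ∑ k, v j * (v k * VS θ₀ j k))) :=
    hs.tendsto_card.mul (tendsto_finsetSum _ fun j _ => tendsto_finsetSum _ fun k _ =>
      ((hs.tendsto_score_products hm j k).const_mul _).const_mul _)
  have h2 : 1 * ∑ j, ∑ k, v j * (v k * VS θ₀ j k) = v ⬝ᵥ (VS θ₀ *ᵥ v) := by
    simp only [one_mul, dotProduct, mulVec, Finset.mul_sum]
    exact Finset.sum_congr rfl fun j _ => Finset.sum_congr rfl fun k _ => by ring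
  rw [h2] at h1
  refine h1.congr' ?_
  filter_upwards [hs.eventually_card] with x hx
  have hn := hx.1.ne'
  have hN := hx.2.1.ne'
  have h3 : ∀ y, (v ⬝ᵥ (score f θ₀ y).ofLp) ^ 2 =
      ∑ j, ∑ k, v j * (v k * (score f θ₀ y j * score f θ₀ y k)) := by
    intro y
    rw [sq, dotProduct, Finset.sum_mul_sum]
    exact Finset.sum_congr rfl fun j _ => Finset.sum_congr rfl fun k _ => by ring
  have h4 : ∀ i, surveyCoef f Y pi A θ₀ v x i ^ 2 = ∑ j, ∑ k, v j * (v k *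
      (((A x.1 x.2).card : ℝ) * ((N x.1 : ℝ)⁻¹ ^ 2 * ((pi x.1 i x.2)⁻¹ ^ 2 *
        (score f θ₀ (Y x.1 i x.2) j * score f θ₀ (Y x.1 i x.2) k))))) := by
    intro i
    rw [surveyCoef, devCoef, mul_pow, mul_pow, mul_pow, Real.sq_sqrt (Nat.cast_nonneg _), h3]
    simp only [Finset.mul_sum]
    exact Finset.sum_congr rfl fun j _ => Finset.sum_congr rfl fun k _ => by ring
  simp only [h4]
  rw [Finset.sum_comm (s := A x.1 x.2), Finset.mul_sum]
  refine Finset.sum_congr rfl fun j _ => ?_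
  rw [Finset.sum_comm (s := A x.1 x.2), Finset.mul_sum]
  refine Finset.sum_congr rfl fun k _ => ?_
  simp only [← Finset.mul_sum, scaledSum, pow_one, Nat.reduceAdd]
  field_simp

/-- Lyapunov's condition: three weights against the factor n^(3/2)/N³ leave a sum of order
n₀^(−1/2), by the third moment of the score. -/
theorem tendsto_sum_coef_cube (hs : PoissonSurvey P μ f B θ₀ N Y pi A VS)
    (hm : RegularModel μ f Θ B θ₀) (v : Fin r ⊕ Fin q → ℝ) :
    Tendsto (fun x : Σ _ : ℕ, Ω => ∑ i ∈ A x.1 x.2, |surveyCoef f Y pi A θ₀ v x i| ^ 3)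
      (surveyFilter P) (𝓝 0) := by
  have h1 := ((hs.tendsto_sqrt_card_ratio.pow 3).mul (hs.tendsto_score_cubes hm)).const_mul
    ((∑ j, |v j|) ^ 3)
  rw [mul_zero, mul_zero] at h1
  refine squeeze_zero' (Eventually.of_forall fun x => Finset.sum_nonneg fun i _ => by positivity)
    ?_ h1
  filter_upwards [hs.eventually_card] with x hx
  have hn := Real.sqrt_pos.2 hx.1
  have hN := hx.2.1
  have hle : ∀ i, |surveyCoef f Y pi A θ₀ v x i| ^ 3 ≤ (∑ j, |v j|) ^ 3 *
      (Real.sqrt (A x.1 x.2).card ^ 3 * ((N x.1 : ℝ)⁻¹ ^ 3 * ((pi x.1 i x.2)⁻¹ ^ 3 *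
        ‖score f θ₀ (Y x.1 i x.2)‖ ^ 3))) := by
    intro i
    have hp := (inv_pos.2 (hs.pi_pos x.1 i x.2)).le
    have h2 := abs_dotProduct_le_sum_mul_norm v (score f θ₀ (Y x.1 i x.2))
    rw [surveyCoef, devCoef, abs_mul, abs_mul, abs_mul, abs_of_nonneg (Real.sqrt_nonneg _),
      abs_of_nonneg (by positivity : 0 ≤ (N x.1 : ℝ)⁻¹), abs_of_nonneg hp, mul_pow, mul_pow, mul_pow]
    calc _ ≤ Real.sqrt (A x.1 x.2).card ^ 3 * ((N x.1 : ℝ)⁻¹ ^ 3 * ((pi x.1 i x.2)⁻¹ ^ 3 *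
          ((∑ j, |v j|) * ‖score f θ₀ (Y x.1 i x.2)‖) ^ 3)) := by gcongr
      _ = _ := by ring
  refine (Finset.sum_le_sum fun i _ => hle i).trans (le_of_eq ?_)
  simp only [← Finset.mul_sum, scaledSum, Nat.reduceAdd]
  generalize ∑ i ∈ A x.1 x.2, (pi x.1 i x.2)⁻¹ ^ 3 * ‖score f θ₀ (Y x.1 i x.2)‖ ^ 3 = S
  have h4 : expSize P (pi x.1) ^ 2 = Real.sqrt (expSize P (pi x.1)) ^ 4 := by
    nth_rewrite 1 [← Real.sq_sqrt hx.1.le]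
    ring
  rw [h4]
  field_simp

/-- The bias (N/W − 1)Σ coefficients is negligible since the sum is bounded in probability. The
bound supplies tightness of the bootstrap score and of the limiting quadratic form. -/
theorem eventually_second_moment (hs : PoissonSurvey P μ f B θ₀ N Y pi A VS)
    (hm : RegularModel μ f Θ B θ₀) (v : Fin r ⊕ Fin q → ℝ) :
    ∀ᶠ x in surveyFilter P, ∫ m, (v ⬝ᵥ (surveyDev f Y pi A θ₀ ⟨x, m⟩).ofLp) ^ 2
      ∂bootKernel pi A x ≤ v ⬝ᵥ (VS θ₀ *ᵥ v) + 1 := by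
  have hρ := hs.tendsto_weight_ratio hm
  have h1 : Tendsto (fun x : Σ _ : ℕ, Ω => ((N x.1 : ℝ) * (∑ j ∈ A x.1 x.2, (pi x.1 j x.2)⁻¹)⁻¹ - 1)
      * ∑ i ∈ A x.1 x.2, surveyCoef f Y pi A θ₀ v x i) (surveyFilter P) (𝓝 0) :=
    hs.boundedAlong_sum_coef hm v _ (by simpa using hρ.sub_const 1)
  have h2 := (hρ.mul (hs.tendsto_sum_coef_sq hm v)).add (h1.pow 2)
  simp only [one_mul, ne_eq, OfNat.ofNat_ne_zero, not_false_eq_true, zero_pow, add_zero] at h2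
  filter_upwards [h2.eventually (gt_mem_nhds (lt_add_one _)), hs.eventually_card] with x hx hA
  have h3 := integral_sq_linear_sub_le hA.2.2 (fun i => hs.pi_pos x.1 i x.2)
      (fun i => hs.pi_le_one x.1 i x.2) (surveyCoef f Y pi A θ₀ v x)
  rw [← mul_pow] at h3
  simp only [dotProduct_surveyDev]
  exact h3.trans hx.le

theorem tight_surveyDev (hs : PoissonSurvey P μ f B θ₀ N Y pi A VS)
    (hm : RegularModel μ f Θ B θ₀) (v : Fin r ⊕ Fin q → ℝ) :
    TightAlong (surveyFilter P) (bootKernel pi A)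
      fun z => v ⬝ᵥ (surveyDev f Y pi A θ₀ z).ofLp := by
  refine TightAlong.of_sq (tightAlong_of_integral (v ⬝ᵥ (VS θ₀ *ᵥ v) + 1) ?_)
  filter_upwards [hs.eventually_second_moment hm v] with x hx
  refine ⟨integrable_bootLaw _, ?_⟩
  simpa only [abs_of_nonneg (sq_nonneg (v ⬝ᵥ (surveyDev f Y pi A θ₀ _).ofLp))] using hx

/-- The generating function makes the characteristic function an explicit N-th power, with exactly
the centring of `tendsto_exp_mul_one_add_pow`. -/
theorem tendsto_charFun_surveyDev (hs : PoissonSurvey P μ f B θ₀ N Y pi A VS)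
    (hm : RegularModel μ f Θ B θ₀) (v : Fin r ⊕ Fin q → ℝ) :
    Tendsto (fun x => ∫ m, Complex.exp (((v ⬝ᵥ (surveyDev f Y pi A θ₀ ⟨x, m⟩).ofLp : ℝ) : ℂ) *
      Complex.I) ∂bootKernel pi A x) (surveyFilter P)
      (𝓝 (Complex.exp (-((v ⬝ᵥ (VS θ₀ *ᵥ v) : ℝ) : ℂ) / 2))) := by
  refine (tendsto_exp_mul_one_add_pow hs.tendsto_population (hs.tendsto_weight_ratio hm)
    (hs.boundedAlong_sum_coef hm v) (hs.tendsto_sum_coef_sq hm v)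
    (hs.tendsto_sum_coef_cube hm v)).congr' ?_
  filter_upwards [hs.eventually_card] with x hA
  have h1 := integral_cexp_bootLaw hA.2.2 (fun i => hs.pi_pos x.1 i x.2)
      (fun i => hs.pi_le_one x.1 i x.2) (surveyCoef f Y pi A θ₀ v x)
  rw [Complex.ofReal_inv, ← h1, ← integral_const_mul]
  refine integral_congr_ae (Eventually.of_forall fun m => ?_)
  beta_reduce
  rw [dotProduct_surveyDev, ← Complex.exp_add]
  congr 1
  push_cast
  ring

/-- The standardized bootstrap score converges weakly, in probability, to the standard Gaussian
law. -/
theorem tendsto_integral_standardized (hs : PoissonSurvey P μ f B θ₀ N Y pi A VS)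
    (hm : RegularModel μ f Θ B θ₀) {L : Matrix (Fin q) (Fin r ⊕ Fin q) ℝ}
    (hL : L * VS θ₀ * Lᵀ = 1) (φ : EuclideanSpace ℝ (Fin q) →ᵇ ℝ) :
    Tendsto (fun x => ∫ m, φ (WithLp.toLp 2 (L *ᵥ (surveyDev f Y pi A θ₀ ⟨x, m⟩).ofLp))
      ∂bootKernel pi A x) (surveyFilter P)
      (𝓝 (∫ x, φ x ∂stdGaussian (EuclideanSpace ℝ (Fin q)))) := by
  refine tendsto_integral_stdGaussian (ζ := fun z : Σ x : (Σ _ : ℕ, Ω), (Fin (N x.1) → ℕ) =>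
      WithLp.toLp 2 (L *ᵥ (surveyDev f Y pi A θ₀ z).ofLp))
    (C := 1 + ∑ i, (L i ⬝ᵥ (VS θ₀ *ᵥ L i) + 1)) (fun x => measurable_of_countable _) ?_ ?_ ?_ φ
  · filter_upwards [hs.eventually_card] with x hx
    exact isProbabilityMeasure_bootLaw hx.2.2 (fun i => hs.pi_pos x.1 i x.2)
      (fun i => hs.pi_le_one x.1 i x.2)
  · filter_upwards [hs.eventually_card, (eventually_all (ι := Fin q)).2 fun i =>
      hs.eventually_second_moment hm (L i)] with x hx hx2
    refine ⟨integrable_bootLaw _, ?_⟩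
    have := isProbabilityMeasure_bootLaw hx.2.2 (fun i => hs.pi_pos x.1 i x.2)
      (fun i => hs.pi_le_one x.1 i x.2)
    -- The first moment of the norm is controlled through ‖ζ‖ ≤ 1 + ‖ζ‖² by the second moments of
    -- the coordinates.
    have h1 : ∫ m, (1 + ∑ i, (L i ⬝ᵥ (surveyDev f Y pi A θ₀ ⟨x, m⟩).ofLp) ^ 2)
        ∂bootKernel pi A x ≤ 1 + ∑ i, (L i ⬝ᵥ (VS θ₀ *ᵥ L i) + 1) := by
      rw [integral_add (integrable_bootLaw _) (integrable_bootLaw _),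
        integral_finsetSum _ fun i _ => integrable_bootLaw _]
      simp only [integral_const, probReal_univ, one_smul]
      gcongr with i
      exact hx2 i
    refine (integral_mono (integrable_bootLaw _) (integrable_bootLaw _) fun m => ?_).trans h1
    beta_reduce
    have h2 := EuclideanSpace.norm_sq_eq (WithLp.toLp 2 (L *ᵥ (surveyDev f Y pi A θ₀ ⟨x, m⟩).ofLp))
    simp only [Real.norm_eq_abs, sq_abs] at h2
    have h3 : ∑ i, (L i ⬝ᵥ (surveyDev f Y pi A θ₀ ⟨x, m⟩).ofLp) ^ 2 =
        ‖WithLp.toLp 2 (L *ᵥ (surveyDev f Y pi A θ₀ ⟨x, m⟩).ofLp)‖ ^ 2 := h2.symm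
    rw [h3]
    nlinarith [sq_nonneg (‖WithLp.toLp 2 (L *ᵥ (surveyDev f Y pi A θ₀ ⟨x, m⟩).ofLp)‖ - 1)]
  · intro u
    have h1 := hs.tendsto_charFun_surveyDev hm (u.ofLp ᵥ* L)
    -- L Σ_S Lᵀ = 1 turns the limiting variance in the direction Lᵀu into ‖u‖².
    have h2 : (u.ofLp ᵥ* L) ⬝ᵥ (VS θ₀ *ᵥ (u.ofLp ᵥ* L)) = ‖u‖ ^ 2 := by
      rw [← dotProduct_mulVec, ← mulVec_transpose L, mulVec_mulVec, mulVec_mulVec, hL, one_mulVec,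
        ← inner_eq_dotProduct, real_inner_self_eq_norm_sq]
    rw [h2] at h1
    rw [charFun_stdGaussian]
    refine (h1.congr fun x => ?_).trans (le_of_eq ?_)
    · rw [charFun_apply, integral_map (measurable_of_countable _).aemeasurable (by fun_prop)]
      refine integral_congr_ae (Eventually.of_forall fun m => ?_)
      beta_reduce
      rw [inner_eq_dotProduct, ← dotProduct_mulVec, dotProduct_comm]
    · push_cast; rfl

end PoissonSurvey

end BootstrapCLT

/-! ### The bootstrap likelihood ratio statistic -/

section LikelihoodRatio

open scoped RealInnerProductSpace

variable {V : Type*} [NormedAddCommGroup V] [InnerProductSpace ℝ V] [FiniteDimensional ℝ V]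
  {γ : Type*} {l : Filter γ} {ℓ : γ → V → ℝ} {Θ : Set V} {θ₀ : V} {s : γ → V} {J : V →L[ℝ] V}

/-- Expansion of an unrestricted maximizer. -/
theorem QuadraticCriterion.unrestricted_expansion (H : QuadraticCriterion l ℓ Θ θ₀ s J)
    {θt : γ → V} (hmax : ∀ x, IsArgmax (ℓ x) Θ (θt x)) {Ji : V →L[ℝ] V} (hJi : ∀ v, J (Ji v) = v)
    {rn : γ → ℝ} (hs : BoundedAlong l fun x => rn x * ‖s x‖) :
    Tendsto (fun x => ‖θt x - θ₀‖) l (𝓝 0) ∧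
    Tendsto (fun x => rn x ^ 2 * (ℓ x (θt x) - ℓ x θ₀ - quadApprox J (s x) (Ji (s x)))) l (𝓝 0) ∧
    Tendsto (fun x => rn x * ‖θt x - θ₀ - Ji (s x)‖) l (𝓝 0) := by
  have hmax' : ∀ x, IsArgmax (ℓ x) {θ | θ ∈ Θ ∧ θ - θ₀ ∈ (⊤ : Submodule ℝ V)} (θt x) := by
    intro x
    simpa using hmax x
  have ht : Tendsto (fun _ : γ => ‖θ₀ - θ₀‖) l (𝓝 0) := by
    simpa using tendsto_const_nhds
  exact ⟨H.argmax_tendsto ht hmax', H.argmax_expansion ht hmax' hJi (Pr := 0) (by simp) (by simp) hs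
    (by simpa using BoundedAlong.const (m := l) 0) (hh := fun x => Ji (s x)) (by simp)⟩

/-- Quadratic approximation of the likelihood ratio statistic for a restriction through a point `t`
with the linearization `t - θ₀ ≈ J⁻¹ s'`. -/
theorem QuadraticCriterion.likelihoodRatio (H : QuadraticCriterion l ℓ Θ θ₀ s J)
    {E : Submodule ℝ V} {t θt θp s' : γ → V}
    (hmax : ∀ x, IsArgmax (ℓ x) Θ (θt x))
    (hmaxp : ∀ x, IsArgmax (ℓ x) {θ | θ ∈ Θ ∧ θ - t x ∈ E} (θp x))
    {Ji Pr : V →L[ℝ] V} (hJi : ∀ v, J (Ji v) = v) (hPrE : ∀ v, v - Pr v ∈ E)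
    (hPrJ : ∀ v, ∀ e ∈ E, ⟪J (Pr v), e⟫ = 0)
    {rn : γ → ℝ} (hs : BoundedAlong l fun x => rn x * ‖s x‖)
    (hs' : BoundedAlong l fun x => rn x * ‖s' x‖)
    (ht : Tendsto (fun x => ‖t x - θ₀‖) l (𝓝 0))
    (ht' : Tendsto (fun x => rn x * ‖t x - θ₀ - Ji (s' x)‖) l (𝓝 0)) :
    Tendsto (fun x => 2 * rn x ^ 2 * (ℓ x (θt x) - ℓ x (θp x)) -
      rn x ^ 2 * ⟪Pr (Ji (s x - s' x)), J (Pr (Ji (s x - s' x)))⟫) l (𝓝 0) := by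
  have hτ : BoundedAlong l fun x => rn x * ‖t x - θ₀‖ := by
    refine ((BoundedAlong.of_tendsto ht'.abs).add
      ((BoundedAlong.const ‖Ji‖).mul (hs'.mono (X := fun x => |rn x * ‖s' x‖|)
        (Eventually.of_forall fun x => by rw [abs_abs])))).mono (Eventually.of_forall fun x => ?_)
    have h1 : ‖t x - θ₀‖ ≤ ‖t x - θ₀ - Ji (s' x)‖ + ‖Ji‖ * ‖s' x‖ := by
      have h2 := norm_add_le (t x - θ₀ - Ji (s' x)) (Ji (s' x))
      rw [sub_add_cancel] at h2
      linarith [Ji.le_opNorm (s' x)]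
    rw [abs_mul, abs_mul, abs_mul, abs_norm, abs_norm, abs_norm]
    refine le_trans ?_ (le_abs_self _)
    have := mul_le_mul_of_nonneg_left h1 (abs_nonneg (rn x))
    linarith
  obtain ⟨-, h1, -⟩ := H.unrestricted_expansion hmax hJi hs
  have h2 := (H.argmax_expansion ht hmaxp hJi hPrE hPrJ hs hτ fun x => rfl).1
  set d : γ → V := fun x => t x - θ₀ - Ji (s' x) with hd
  set w : γ → V := fun x => Ji (s x - s' x) with hw
  -- The restriction costs the form at Π(d − w), where d is negligible at rate rn and w contains
  -- only the difference s − s' of the scores.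
  have hv : ∀ x, Pr (t x - θ₀ - Ji (s x)) = Pr (d x) - Pr (w x) := by
    intro x
    rw [← map_sub]
    congr 1
    simp only [hd, hw, map_sub]
    abel
  have hwb : BoundedAlong l fun x => rn x * ‖w x‖ := by
    refine ((BoundedAlong.const ‖Ji‖).mul ((hs.mono (X := fun x => |rn x * ‖s x‖|)
        (Eventually.of_forall fun x => by rw [abs_abs])).add
      (hs'.mono (X := fun x => |rn x * ‖s' x‖|)
        (Eventually.of_forall fun x => by rw [abs_abs])))).mono (Eventually.of_forall fun x => ?_)
    have h3 : ‖w x‖ ≤ ‖Ji‖ * (‖s x‖ + ‖s' x‖) :=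
      (Ji.le_opNorm _).trans (mul_le_mul_of_nonneg_left (norm_sub_le _ _) (norm_nonneg _))
    refine le_trans ?_ (le_abs_self _)
    rw [abs_mul, abs_mul, abs_mul, abs_norm, abs_norm, abs_norm]
    have := mul_le_mul_of_nonneg_left h3 (abs_nonneg (rn x))
    linarith
  let C : ℝ := ‖Pr‖ * (‖J‖ * ‖Pr‖)
  have hbil : ∀ a b : V, |⟪Pr a, J (Pr b)⟫| ≤ C * (‖a‖ * ‖b‖) := by
    intro a b
    refine (abs_real_inner_le_norm _ _).trans ?_
    calc ‖Pr a‖ * ‖J (Pr b)‖ ≤ (‖Pr‖ * ‖a‖) * (‖J‖ * (‖Pr‖ * ‖b‖)) := by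
          gcongr
          · exact Pr.le_opNorm a
          · exact (J.le_opNorm _).trans
              (mul_le_mul_of_nonneg_left (Pr.le_opNorm b) (norm_nonneg _))
      _ = _ := by simp only [C]; ring
  have hdd : Tendsto (fun x => rn x ^ 2 * ⟪Pr (d x), J (Pr (d x))⟫) l (𝓝 0) := by
    have := (ht'.pow 2).const_mul C
    simp only [ne_eq, OfNat.ofNat_ne_zero, not_false_eq_true, zero_pow, mul_zero] at this
    refine squeeze_zero_norm (fun x => ?_) this
    rw [norm_mul, Real.norm_eq_abs, Real.norm_eq_abs, abs_of_nonneg (sq_nonneg _)]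
    refine (mul_le_mul_of_nonneg_left (hbil (d x) (d x)) (sq_nonneg _)).trans (le_of_eq ?_)
    simp only [hd]
    ring
  have hdw : Tendsto (fun x => rn x ^ 2 * ⟪Pr (d x), J (Pr (w x))⟫) l (𝓝 0) := by
    have := ((hwb _ ht').abs).const_mul C
    simp only [abs_zero, mul_zero] at this
    refine squeeze_zero_norm (fun x => ?_) this
    rw [norm_mul, Real.norm_eq_abs, Real.norm_eq_abs, abs_of_nonneg (sq_nonneg _), abs_mul, abs_mul,
      abs_mul, abs_norm, abs_norm]
    refine (mul_le_mul_of_nonneg_left (hbil (d x) (w x)) (sq_nonneg _)).trans (le_of_eq ?_)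
    rw [← sq_abs]
    simp only [hd]
    ring
  have h4 := (((h1.sub h2).const_mul 2).add hdd).sub (hdw.const_mul 2)
  simp only [sub_zero, mul_zero, add_zero] at h4
  -- Twice the gap between the two quadratic maxima is the form at Π(d − w); once the terms
  -- containing d are removed, the form at Πw remains.
  refine h4.congr fun x => ?_
  rw [quadApprox_add H.symm, hJi, sub_self, inner_zero_left, hv]
  have h5 : ⟪Pr (w x), J (Pr (d x))⟫ = ⟪Pr (d x), J (Pr (w x))⟫ := by
    rw [← H.symm, real_inner_comm]
  change _ = _ - rn x ^ 2 * ⟪Pr (w x), J (Pr (w x))⟫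
  simp only [map_sub, inner_sub_left, inner_sub_right]
  rw [h5]
  ring

end LikelihoodRatio

/-! ### Convergence of the bootstrap likelihood ratio -/

section BootstrapLikelihoodRatio

open Matrix
open scoped RealInnerProductSpace

variable {r q : ℕ} {𝓨 Ω : Type*} [MeasurableSpace 𝓨] [MeasurableSpace Ω]
  {P : Measure Ω} [IsProbabilityMeasure P]
  {μ : Measure 𝓨} {f : 𝓨 → Param r q → ℝ} {Θ B : Set (Param r q)} {θ₀ : Param r q}
  {N : ℕ → ℕ} {Y : (ν : ℕ) → Fin (N ν) → Ω → 𝓨} {pi : (ν : ℕ) → Fin (N ν) → Ω → ℝ}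
  {A : (ν : ℕ) → Ω → Finset (Fin (N ν))}
  {VS : Param r q → Matrix (Fin r ⊕ Fin q) (Fin r ⊕ Fin q) ℝ}

theorem wLogLik_eq_sum {n : ℕ} (f : 𝓨 → Param r q → ℝ) (A : Finset (Fin n)) (w : Fin n → ℝ)
    (y : Fin n → 𝓨) :
    wLogLik f A w y = fun θ => ∑ i, popWeight A w i * Real.log (f (y i) θ) := by
  ext θ
  rw [sum_popWeight, wLogLik]

theorem wScore_eq_sum {n : ℕ} (f : 𝓨 → Param r q → ℝ) (A : Finset (Fin n)) (w : Fin n → ℝ)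
    (y : Fin n → 𝓨) (θ : Param r q) :
    wScore f A w y θ = ∑ i, popWeight A w i • score f θ (y i) := by
  rw [sum_popWeight_smul, wScore]

/-- The parameter directions along which `θ₂` is constant. -/
def nuisance (r q : ℕ) : Submodule ℝ (Param r q) where
  carrier := {h | ∀ j, h (Sum.inr j) = 0}
  add_mem' := by
    intro a b ha hb j
    rw [PiLp.add_apply, ha j, hb j, add_zero]
  zero_mem' := fun j => rfl
  smul_mem' := by
    intro c a ha j
    rw [PiLp.smul_apply, ha j, smul_zero]

theorem mem_nuisance {h : Param r q} : h ∈ nuisance r q ↔ ∀ j, h (Sum.inr j) = 0 := Iff.rfl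

theorem sub_mem_nuisance_iff {θ t : Param r q} : θ - t ∈ nuisance r q ↔ second θ = second t := by
  rw [mem_nuisance, funext_iff]
  simp only [PiLp.sub_apply, sub_eq_zero, second]

theorem second_join (θ₁ : Fin r → ℝ) (θ₂ : Fin q → ℝ) : second (join θ₁ θ₂) = θ₂ := rfl

theorem join_second (θ : Param r q) : join (fun j => θ (Sum.inl j)) (second θ) = θ := by
  ext j
  cases j <;> rfl

/-- A maximizer of the profile criterion is a maximizer over a slice of the parameter space. -/
theorem IsArgmax.of_profile {l : Param r q → ℝ} {t : Param r q} {θ₁ : Fin r → ℝ}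
    (h : IsArgmax (fun θ₁ => l (join θ₁ (second t))) {θ₁ | join θ₁ (second t) ∈ Θ} θ₁) :
    IsArgmax l {θ | θ ∈ Θ ∧ θ - t ∈ nuisance r q} (join θ₁ (second t)) := by
  have hrep : ∀ {θ : Param r q}, θ - t ∈ nuisance r q →
      join (fun j => θ (Sum.inl j)) (second t) = θ := by
    intro θ hθ
    rw [← sub_mem_nuisance_iff.1 hθ, join_second]
  rintro ⟨θ, ⟨hθ, hθt⟩, hmax⟩
  obtain ⟨h1, h2⟩ := h ⟨fun j => θ (Sum.inl j), by
    rw [Set.mem_ofPred_eq, hrep hθt]; exact hθ, by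
    intro θ₁' hθ₁'
    have := hmax (show join θ₁' (second t) ∈ {θ | θ ∈ Θ ∧ θ - t ∈ nuisance r q} from
      ⟨hθ₁', sub_mem_nuisance_iff.2 (second_join _ _)⟩)
    simpa only [Set.mem_ofPred_eq, hrep hθt] using this⟩
  refine ⟨⟨h1, sub_mem_nuisance_iff.2 (second_join _ _)⟩, ?_⟩
  rintro θ' ⟨hθ', hθt'⟩
  have := h2 (show (fun j => θ' (Sum.inl j)) ∈ {θ₁ | join θ₁ (second t) ∈ Θ} by
    rw [Set.mem_ofPred_eq, hrep hθt']; exact hθ')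
  simpa only [Set.mem_ofPred_eq, hrep hθt'] using this

theorem boundedAlong_norm_of_apply {γ : Type*} {l : Filter γ} {rn : γ → ℝ} {s : γ → Param r q}
    (h : ∀ j, BoundedAlong l fun x => rn x * s x j) :
    BoundedAlong l fun x => rn x * ‖s x‖ := by
  refine (BoundedAlong.sum Finset.univ fun j _ => (h j).mono (X := fun x => |rn x * s x j|)
    (Eventually.of_forall fun x => by rw [abs_abs])).mono (Eventually.of_forall fun x => ?_)
  rw [abs_mul, abs_norm]
  refine le_trans ?_ (le_abs_self _)
  simp only [abs_mul, ← Finset.mul_sum]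
  exact mul_le_mul_of_nonneg_left (norm_le_sum_abs _) (abs_nonneg _)

theorem profile_sub_mem (M : Matrix (Fin r ⊕ Fin q) (Fin r ⊕ Fin q) ℝ) (v : Param r q) :
    v - matrixCLM (profileMatrix M) v ∈ nuisance r q := by
  intro j
  rw [PiLp.sub_apply, matrixCLM_apply, profileMatrix, fromBlocks_mulVec]
  simp

/-- `M * profileMatrix M` takes values in the θ₂-coordinates, where nuisance directions vanish. -/
theorem inner_profile_eq_zero {M : Matrix (Fin r ⊕ Fin q) (Fin r ⊕ Fin q) ℝ} (hM : M.PosDef)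
    (v : Param r q) {e : Param r q} (he : e ∈ nuisance r q) :
    ⟪matrixCLM M (matrixCLM (profileMatrix M) v), e⟫ = 0 := by
  rw [matrixCLM_mul, mul_profileMatrix hM, real_inner_comm, inner_matrixCLM, fromBlocks_mulVec]
  simp only [dotProduct, Fintype.sum_sum_type]
  simp [mem_nuisance.1 he]

/-- The Gaussian quadratic form with coefficients `c` has the law `weightedChiSq c`. -/
theorem integral_weightedChiSq (c : Fin q → ℝ) (h : ℝ →ᵇ ℝ) :
    ∫ x, h x ∂weightedChiSq c =
      ∫ z, h (∑ i, c i * z i ^ 2) ∂stdGaussian (EuclideanSpace ℝ (Fin q)) := by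
  rw [weightedChiSq, ← map_pi_eq_stdGaussian,
    integral_map (Continuous.aemeasurable (by fun_prop)) h.continuous.aestronglyMeasurable,
    integral_map (by fun_prop) (Continuous.aestronglyMeasurable (by fun_prop))]

/-- The bootstrap likelihood ratio statistic. -/
def bootRatio (f : 𝓨 → Param r q → ℝ) (Y : (ν : ℕ) → Fin (N ν) → Ω → 𝓨)
    (pi : (ν : ℕ) → Fin (N ν) → Ω → ℝ) (A : (ν : ℕ) → Ω → Finset (Fin (N ν)))
    (θstar : (ν : ℕ) → Ω → (Fin (N ν) → ℕ) → Param r q)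
    (θprof : (ν : ℕ) → Ω → (Fin (N ν) → ℕ) → Param r q)
    (z : Σ x : (Σ _ : ℕ, Ω), (Fin (N x.1) → ℕ)) : ℝ :=
  -2 * ((A z.1.1 z.1.2).card : ℝ) *
    (bootLogLik f (A z.1.1 z.1.2) (fun i => pi z.1.1 i z.1.2) (fun i => Y z.1.1 i z.1.2) z.2
        (θprof z.1.1 z.1.2 z.2) -
      bootLogLik f (A z.1.1 z.1.2) (fun i => pi z.1.1 i z.1.2) (fun i => Y z.1.1 i z.1.2) z.2
        (θstar z.1.1 z.1.2 z.2))

/-- The bootstrap likelihood ratio statistic is asymptotically a quadratic form in the bootstrap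
score. -/
theorem PoissonSurvey.tendsto_bootRatio_sub (hs : PoissonSurvey P μ f B θ₀ N Y pi A VS)
    (hm : RegularModel μ f Θ B θ₀) {θhat : ℕ → Ω → Param r q}
    (hθhat : ∀ ν ω, IsArgmax (wLogLik f (A ν ω) (fun i => (pi ν i ω)⁻¹) (fun i => Y ν i ω))
      Θ (θhat ν ω))
    {θstar θprof : (ν : ℕ) → Ω → (Fin (N ν) → ℕ) → Param r q}
    (hθstar : ∀ ν ω m, IsArgmax (bootLogLik f (A ν ω) (fun i => pi ν i ω) (fun i => Y ν i ω) m)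
      Θ (θstar ν ω m))
    (hθprof : ∀ ν ω m, IsArgmax (bootLogLik f (A ν ω) (fun i => pi ν i ω) (fun i => Y ν i ω) m)
      {θ | θ ∈ Θ ∧ θ - θhat ν ω ∈ nuisance r q} (θprof ν ω m))
    {c : Fin q → ℝ} {L : Matrix (Fin q) (Fin r ⊕ Fin q) ℝ}
    (hc : ∀ v : Fin r ⊕ Fin q → ℝ,
      (profileMatrix (info μ f θ₀ θ₀) *ᵥ ((info μ f θ₀ θ₀)⁻¹ *ᵥ v)) ⬝ᵥ
        (info μ f θ₀ θ₀ *ᵥ (profileMatrix (info μ f θ₀ θ₀) *ᵥ ((info μ f θ₀ θ₀)⁻¹ *ᵥ v))) =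
          ∑ i, c i * (L *ᵥ v) i ^ 2) :
    Tendsto (fun z => bootRatio f Y pi A θstar θprof z -
      ∑ i, c i * (L *ᵥ (surveyDev f Y pi A θ₀ z).ofLp) i ^ 2) (bootFilter P pi A) (𝓝 0) := by
  set M := info μ f θ₀ θ₀ with hM
  have hMpos : M.PosDef := hm.info_posDef
  have hJi : ∀ v, matrixCLM M (matrixCLM M⁻¹ v) = v := by
    intro v
    rw [matrixCLM_mul, mul_nonsing_inv _ hMpos.det_pos.ne'.isUnit, matrixCLM_one]
  have hw : ∀ (ν : ℕ) (i : Fin (N ν)) (ω : Ω), 0 ≤ (pi ν i ω)⁻¹ := fun ν i ω =>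
    (inv_pos.2 (hs.pi_pos ν i ω)).le
  have Hbase := hm.quadraticCriterion
    (fun (x : Σ _ : ℕ, Ω) => popWeight_nonneg fun i => hw x.1 i x.2) (hs.weightedLLN hm)
  have Hboot := hm.quadraticCriterion
    (fun (z : Σ x : (Σ _ : ℕ, Ω), (Fin (N x.1) → ℕ)) => popWeight_nonneg fun i =>
      mul_nonneg (hw z.1.1 i z.1.2) (Nat.cast_nonneg (z.2 i))) (hs.bootstrap_weightedLLN hm)
  simp only [← wScore_eq_sum] at Hbase Hboot
  simp only [← congrFun (wLogLik_eq_sum f _ _ _)] at Hbase Hboot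
  -- θ̂ − θ₀ is linearized by 𝓘⁻¹Ŝ_w at rate √n; lifted to the bootstrap level, θ̂ is the point
  -- through which the restriction passes.
  obtain ⟨hhat, -, hhat'⟩ := Hbase.unrestricted_expansion (θt := fun x => θhat x.1 x.2)
    (fun x => hθhat x.1 x.2) hJi (rn := fun x => Real.sqrt (A x.1 x.2).card)
    (boundedAlong_norm_of_apply fun j => hs.boundedAlong_score hm j)
  have hrs : ∀ z : Σ x : (Σ _ : ℕ, Ω), (Fin (N x.1) → ℕ), Real.sqrt (A z.1.1 z.1.2).card •
      (wScore f (A z.1.1 z.1.2) (fun i => (pi z.1.1 i z.1.2)⁻¹ * z.2 i)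
          (fun i => Y z.1.1 i z.1.2) θ₀ -
        wScore f (A z.1.1 z.1.2) (fun i => (pi z.1.1 i z.1.2)⁻¹) (fun i => Y z.1.1 i z.1.2) θ₀) =
      surveyDev f Y pi A θ₀ z := fun z => rfl
  have hsb : ∀ j, BoundedAlong (bootFilter P pi A) fun z => Real.sqrt (A z.1.1 z.1.2).card *
      wScore f (A z.1.1 z.1.2) (fun i => (pi z.1.1 i z.1.2)⁻¹ * z.2 i)
          (fun i => Y z.1.1 i z.1.2) θ₀ j := by
    intro j
    -- The bootstrap score is the sample score, bounded in the outer probability, plus its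
    -- deviation, tight in the inner one.
    refine ((hs.boundedAlong_bootstrap_score hm j).add
      (hs.tight_surveyDev hm (Pi.single j 1)).boundedAlong).congr (Eventually.of_forall fun z => ?_)
    rw [single_one_dotProduct, ← hrs, PiLp.smul_apply, PiLp.sub_apply, smul_eq_mul]
    ring
  have h1 := Hboot.likelihoodRatio (E := nuisance r q) (t := fun z => θhat z.1.1 z.1.2)
    (θt := fun z => θstar z.1.1 z.1.2 z.2) (θp := fun z => θprof z.1.1 z.1.2 z.2)
    (s' := fun z => wScore f (A z.1.1 z.1.2) (fun i => (pi z.1.1 i z.1.2)⁻¹)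
      (fun i => Y z.1.1 i z.1.2) θ₀)
    (fun z => hθstar z.1.1 z.1.2 z.2) (fun z => hθprof z.1.1 z.1.2 z.2) hJi (profile_sub_mem M)
    (fun v e he => inner_profile_eq_zero hMpos v he)
    (rn := fun z => Real.sqrt (A z.1.1 z.1.2).card)
    (boundedAlong_norm_of_apply hsb)
    (boundedAlong_norm_of_apply fun j => hs.boundedAlong_bootstrap_score hm j)
    (hhat.comp tendsto_fst_kernelFilter) (hhat'.comp tendsto_fst_kernelFilter)
  refine h1.congr fun z => ?_
  rw [← hc, ← hrs]
  generalize wScore f (A z.1.1 z.1.2) (fun i => (pi z.1.1 i z.1.2)⁻¹ * z.2 i)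
          (fun i => Y z.1.1 i z.1.2) θ₀ -
        wScore f (A z.1.1 z.1.2) (fun i => (pi z.1.1 i z.1.2)⁻¹) (fun i => Y z.1.1 i z.1.2) θ₀ = d
  rw [inner_matrixCLM, Real.sq_sqrt (Nat.cast_nonneg _), bootRatio]
  congr 1
  · simp only [bootLogLik]
    ring
  · simp only [WithLp.ofLp_smul, mulVec_smul, dotProduct_smul, smul_dotProduct, smul_eq_mul]
    rw [← mul_assoc, Real.mul_self_sqrt (Nat.cast_nonneg _)]
    rfl

/-- The bootstrap quadratic form is tight. -/
theorem PoissonSurvey.tight_quadraticForm (hs : PoissonSurvey P μ f B θ₀ N Y pi A VS)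
    (hm : RegularModel μ f Θ B θ₀) {c : Fin q → ℝ} (hc : ∀ i, 0 < c i)
    (L : Matrix (Fin q) (Fin r ⊕ Fin q) ℝ) :
    TightAlong (surveyFilter P) (bootKernel pi A)
      fun z => ∑ i, c i * (L *ᵥ (surveyDev f Y pi A θ₀ z).ofLp) i ^ 2 := by
  refine tightAlong_of_integral (∑ i, c i * (L i ⬝ᵥ (VS θ₀ *ᵥ L i) + 1)) ?_
  filter_upwards [(eventually_all (ι := Fin q)).2 fun i =>
      hs.eventually_second_moment hm (L i)] with x hx
  refine ⟨integrable_bootLaw _, ?_⟩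
  have h0 : ∀ z, |∑ i, c i * (L *ᵥ (surveyDev f Y pi A θ₀ z).ofLp) i ^ 2| =
      ∑ i, c i * (L *ᵥ (surveyDev f Y pi A θ₀ z).ofLp) i ^ 2 := fun z =>
    abs_of_nonneg (Finset.sum_nonneg fun i _ => mul_nonneg (hc i).le (sq_nonneg _))
  simp only [h0]
  rw [integral_finsetSum _ fun i _ => integrable_bootLaw _]
  simp only [integral_const_mul]
  exact Finset.sum_le_sum fun i _ => mul_le_mul_of_nonneg_left (hx i) (hc i).le

theorem tendstoInMeasure_of_tendsto_surveyFilter {g : (Σ _ : ℕ, Ω) → ℝ} {a : ℝ}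
    (h : Tendsto g (surveyFilter P) (𝓝 a)) :
    TendstoInMeasure P (fun ν ω => g ⟨ν, ω⟩) atTop fun _ => a := by
  rw [tendstoInMeasure_iff_dist]
  exact tendsto_kernelFilter_iff.1 h

/-- Weak convergence, in probability, of the bootstrap likelihood ratio statistic. -/
theorem PoissonSurvey.tendsto_integral_bootRatio (hs : PoissonSurvey P μ f B θ₀ N Y pi A VS)
    (hm : RegularModel μ f Θ B θ₀) {θstar θprof : (ν : ℕ) → Ω → (Fin (N ν) → ℕ) → Param r q}
    {c : Fin q → ℝ} (hc : ∀ i, 0 < c i) {L : Matrix (Fin q) (Fin r ⊕ Fin q) ℝ}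
    (hL : L * VS θ₀ * Lᵀ = 1)
    (hQ : Tendsto (fun z => bootRatio f Y pi A θstar θprof z -
      ∑ i, c i * (L *ᵥ (surveyDev f Y pi A θ₀ z).ofLp) i ^ 2) (bootFilter P pi A) (𝓝 0))
    (h : ℝ →ᵇ ℝ) :
    Tendsto (fun x => ∫ m, h (bootRatio f Y pi A θstar θprof ⟨x, m⟩) ∂bootKernel pi A x)
      (surveyFilter P) (𝓝 (∫ x, h x ∂weightedChiSq c)) := by
  -- The quadratic map is built into the test function, so the Gaussian limit gives the weighted
  -- chi-square law. The replacement of the statistic by the form is bounded by 2‖h‖ and tends to 0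
  -- in bootstrap probability, hence in conditional mean.
  let φ : EuclideanSpace ℝ (Fin q) →ᵇ ℝ :=
    h.compContinuous ⟨fun z => ∑ i, c i * z i ^ 2, by fun_prop⟩
  have h1 := hs.tendsto_integral_standardized hm hL φ
  have h2 := tendsto_comp_sub_of_tight (hs.tight_quadraticForm hm hc L) hQ h.continuous
  have h3 := tendsto_integral_of_bounded (C := 2 * ‖h‖) ?_ (fun z => ?_)
    (fun x => measurable_of_countable _) h2
  · have h4 := h3.add h1
    rw [zero_add] at h4
    rw [integral_weightedChiSq]
    refine h4.congr fun x => ?_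
    rw [integral_sub (integrable_bootLaw _) (integrable_bootLaw _)]
    exact sub_add_cancel _ _
  · filter_upwards [hs.eventually_card] with x hx
    have := isProbabilityMeasure_bootLaw hx.2.2 (fun i => hs.pi_pos x.1 i x.2)
      (fun i => hs.pi_le_one x.1 i x.2)
    exact measure_univ.le
  · have := h.dist_le_two_norm (bootRatio f Y pi A θstar θprof z)
      (∑ i, c i * (L *ᵥ (surveyDev f Y pi A θ₀ z).ofLp) i ^ 2)
    rwa [Real.dist_eq] at this

end BootstrapLikelihoodRatio

end SurveyBootstrap

end

theorem theorem3 {r q : ℕ} {𝓨 Ω : Type*} [MeasurableSpace 𝓨] [MeasurableSpace Ω]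
    (P : Measure Ω) [IsProbabilityMeasure P]
    (μ : Measure 𝓨) (f : 𝓨 → SurveyBootstrap.Param r q → ℝ)
    (Θ B : Set (SurveyBootstrap.Param r q)) (θ₀ : SurveyBootstrap.Param r q)
    (hmodel : SurveyBootstrap.RegularModel μ f Θ B θ₀)
    (N : ℕ → ℕ) (Y : (ν : ℕ) → Fin (N ν) → Ω → 𝓨) (pi : (ν : ℕ) → Fin (N ν) → Ω → ℝ)
    (A : (ν : ℕ) → Ω → Finset (Fin (N ν)))
    (VS : SurveyBootstrap.Param r q → Matrix (Fin r ⊕ Fin q) (Fin r ⊕ Fin q) ℝ)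
    (hsurvey : SurveyBootstrap.PoissonSurvey P μ f B θ₀ N Y pi A VS)
    -- the pseudo maximum likelihood estimator `θ̂`
    (θhat : ℕ → Ω → SurveyBootstrap.Param r q)
    (hθhat : ∀ ν ω, SurveyBootstrap.IsArgmax
      (SurveyBootstrap.wLogLik f (A ν ω) (fun i => (pi ν i ω)⁻¹) (fun i => Y ν i ω))
      Θ (θhat ν ω))
    -- its bootstrap version `θ̂*`
    (θstar : (ν : ℕ) → Ω → (Fin (N ν) → ℕ) → SurveyBootstrap.Param r q)
    (hθstar : ∀ ν ω m, SurveyBootstrap.IsArgmax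
      (SurveyBootstrap.bootLogLik f (A ν ω) (fun i => pi ν i ω) (fun i => Y ν i ω) m)
      Θ (θstar ν ω m))
    -- the bootstrap profile estimator `θ̂₁*⁽⁰⁾` of `θ₁` at `θ₂ = θ̂₂`
    (θ₁star : (ν : ℕ) → Ω → (Fin (N ν) → ℕ) → Fin r → ℝ)
    (hθ₁star : ∀ ν ω m, SurveyBootstrap.IsArgmax
      (fun θ₁ => SurveyBootstrap.bootLogLik f (A ν ω) (fun i => pi ν i ω) (fun i => Y ν i ω) m
        (SurveyBootstrap.join θ₁ (SurveyBootstrap.second (θhat ν ω))))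
      {θ₁ | SurveyBootstrap.join θ₁ (SurveyBootstrap.second (θhat ν ω)) ∈ Θ} (θ₁star ν ω m)) :
    ∃ c : Fin q → ℝ, Antitone c ∧ (∀ i, 0 < c i) ∧
      (SurveyBootstrap.designEffect (SurveyBootstrap.info μ f θ₀ θ₀) (VS θ₀)).charpoly
        = ∏ i, (Polynomial.X - Polynomial.C (c i)) ∧
      SurveyBootstrap.WeakConvInProb P
        (fun ν ω => (SurveyBootstrap.bootLaw (A ν ω) fun i => pi ν i ω).map fun m =>
          -2 * ((A ν ω).card : ℝ) *
            (SurveyBootstrap.bootLogLik f (A ν ω) (fun i => pi ν i ω) (fun i => Y ν i ω) m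
                (SurveyBootstrap.join (θ₁star ν ω m) (SurveyBootstrap.second (θhat ν ω)))
              - SurveyBootstrap.bootLogLik f (A ν ω) (fun i => pi ν i ω) (fun i => Y ν i ω) m
                (θstar ν ω m)))
        (SurveyBootstrap.weightedChiSq c) := by
  obtain ⟨c, hanti, hpos, hchar, L, hL, hc⟩ := SurveyBootstrap.exists_standardization
    hmodel.info_posDef (hsurvey.score_var θ₀ hmodel.interior).1
  refine ⟨c, hanti, hpos, hchar, fun h => ?_⟩
  have h1 := hsurvey.tendsto_bootRatio_sub hmodel hθhat hθstar
    (fun ν ω m => (hθ₁star ν ω m).of_profile) hc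
  have h2 := SurveyBootstrap.tendstoInMeasure_of_tendsto_surveyFilter
    (hsurvey.tendsto_integral_bootRatio hmodel hpos hL h1 h)
  -- The counts live on a countable space, where every map is measurable, so arbitrary choices of
  -- the maximizers are admissible.
  refine h2.congr_left fun ν => Eventually.of_forall fun ω => ?_
  exact (integral_map (measurable_of_countable _).aemeasurable
    h.continuous.aestronglyMeasurable).symm
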